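/- **Setting.** Let $p\ge1$, $k\ge2$, and for $y\in\mathbb R$ write $[y]_+=\max\{y,0\}$, $[y]_-=\min\{y,0\}$, $\mathbf 1^+(y)=\mathbf 1\{y\ge0\}$, $\mathbf 1^-(y)=\mathbf 1\{y<0\}$. A superscript $\pm$ means that the statement holds for both signs. For each sample size $n$ let $z_t=z_{n,t}=(y_t,x_t^{\top})^{\top}$, $t\ge -k+1$, be an $\mathbb R\times\mathbb R^{p-1}$-valued process, with possibly random initial values at $t=-k+1,\dots,0$ (these, and hence the process, may depend on $n$), generated by a canonical censored and kinked structural VAR (CKSVAR): with $y_t^{\pm}=[y_t]_\pm$, $$\begin{bmatrix}y_t\\x_t\end{bmatrix}=c+\sum_{i=1}^k\bigl(\phi_i^+y_{t-i}^++\phi_i^-y_{t-i}^-+\Phi_i^xx_{t-i}\bigr)+u_t,\qquad t\ge1,$$ where $c,\phi_i^\pm\in\mathbb R^p$, $\Phi_i^x\in\mathbb R^{p\times(p-1)}$, and $(u_t)_{t\ge1}$ is a random sequence in $\mathbb R^p$ not depending on $n$. Put $\Phi_i^\pm=[\phi_i^\pm,\Phi_i^x]$, $\Phi^\pm(\lambda)=I_p-\sum_{i=1}^k\Phi_i^\pm\lambda^i$,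 $\Pi^\pm=-\Phi^\pm(1)=[\pi^\pm,\Pi^x]$, $\Gamma_i^\pm=-\sum_{j=i+1}^k\Phi_j^\pm$, $\Gamma_i=-\sum_{j=i+1}^k[\phi_j^+,\phi_j^-,\Phi_j^x]$ for $1\le i\le k-1$, $\Gamma^\pm(1)=I_p-\sum_{i=1}^{k-1}\Gamma_i^\pm$ and $\Gamma(1;y)=\Gamma^+(1)\mathbf 1^+(y)+\Gamma^-(1)\mathbf 1^-(y)$. $D[0,1]$ is the space of cadlag functions $[0,1]\to\mathbb R^p$ with the uniform topology. A (possibly $n$-dependent) process $w_t$ is called $I^*(0)$ if $n^{-1/2}\max_{1\le t\le n}\|w_t\|\to0$ in probability. The joint spectral radius of a bounded set $\mathcal A$ of square matrices is $\rho_{\rm JSR}(\mathcal A)=\limsup_{t\to\infty}\sup\{\rho(B)^{1/t}:B\text{ a product of }t\text{ elements of }\mathcal A\}$, $\rho$ being the spectral radius. **Assumptions.** 1. For some $\delta>0$, $\sup_{t\ge1}E\|u_t\|^{2+\delta}<\infty$, and $n^{-1/2}\sum_{t=1}^{\lfloor n\lambda\rfloor}u_t$ converges weakly on $D[0,1]$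 to $U(\lambda)$, a $p$-dimensional Brownian motion with positive definite variance matrix. 2. $\det\Phi^\pm(\lambda)$ has $q^\pm$ roots at $\lambda=1$ (with multiplicity), all its other roots satisfy $|\lambda|>1$, $\operatorname{rank}\Pi^\pm=p-q^\pm$, and $c$ lies in the column spaces of $\Pi^+$ and of $\Pi^-$. 3. $\operatorname{rank}\Pi^+=\operatorname{rank}\Pi^-=\operatorname{rank}\Pi^x=r$. Consequently $\Pi^x=\alpha\beta_x^{\top}$ and $\pi^\pm=\Pi^x\theta^\pm$ with $\alpha\in\mathbb R^{p\times r}$, $\beta_x\in\mathbb R^{(p-1)\times r}$ of rank $r$ and $\theta^\pm\in\mathbb R^{p-1}$; fix any such choice, and full-column-rank matrices $\alpha_\perp\in\mathbb R^{p\times(p-r)}$, $\beta_{x,\perp}\in\mathbb R^{(p-1)\times(p-1-r)}$ with $\alpha_\perp^{\top}\alpha=0$, $\beta_{x,\perp}^{\top}\beta_x=0$. Set $\theta(y)=\theta^+\mathbf 1^+(y)+\theta^-\mathbf 1^-(y)$, $$\beta(y)^{\top}=\beta_x^{\top}[\theta(y),I_{p-1}],\quad \beta_\perp(y)=\begin{bmatrix}1&0\\-\theta(y)&\beta_{x,\perp}\end{bmatrix},\quad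 P_{\beta_\perp}(y)=\beta_\perp(y)\bigl[\alpha_\perp^{\top}\Gamma(1;y)\beta_\perp(y)\bigr]^{-1}\alpha_\perp^{\top},$$ $$\boldsymbol\alpha=\begin{bmatrix}\alpha&\Gamma_1&\cdots&\Gamma_{k-1}\\&I_{p+1}\\&&\ddots\\&&&I_{p+1}\end{bmatrix},\quad \boldsymbol\beta(y)^{\top}=\begin{bmatrix}\beta(y)^{\top}\\S(y)&-I_{p+1}\\&I_{p+1}&-I_{p+1}\\&&\ddots&\ddots\\&&&I_{p+1}&-I_{p+1}\end{bmatrix},\quad S(y)=\begin{bmatrix}\mathbf 1^+(y)&0\\\mathbf 1^-(y)&0\\0&I_{p-1}\end{bmatrix}.$$ 4. $\rho_{\rm JSR}\bigl(\{I+\boldsymbol\beta(+1)^{\top}\boldsymbol\alpha,\ I+\boldsymbol\beta(-1)^{\top}\boldsymbol\alpha\}\bigr)<1$. 5. $\operatorname{sgn}\det\alpha_\perp^{\top}\Gamma(1;+1)\beta_\perp(+1)=\operatorname{sgn}\det\alpha_\perp^{\top}\Gamma(1;-1)\beta_\perp(-1)\ne0$. 6. The $(2+\delta)$-th absolute moments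 of $\beta(y_t)^{\top}z_t$, $t\in\{-k+1,\dots,0\}$, and of $\Delta z_t=z_t-z_{t-1}$, $t\in\{-k+2,\dots,0\}$, are bounded uniformly in $t$ and $n$; and $n^{-1/2}z_0\to\mathcal Z_0=(\mathcal Y_0,\mathcal X_0^{\top})^{\top}$ in probability, where $\mathcal Z_0$ is non-random and $\pi^+[\mathcal Y_0]_++\pi^-[\mathcal Y_0]_-+\Pi^x\mathcal X_0=0$. **Theorem (kinked cointegration).** Let $\vartheta^{\top}=e_1^{\top}P_{\beta_\perp}(+1)$ and $U_0(\lambda)=\Gamma(1;\mathcal Y_0)\mathcal Z_0+U(\lambda)$. Then: (i) $\xi_t=\beta(y_t)^{\top}z_t$ and $\Delta z_t$ are $I^*(0)$; (ii) $n^{-1/2}z_{\lfloor n\lambda\rfloor}$ converges weakly on $D[0,1]$ to the process $Z(\lambda)=(Y(\lambda),X(\lambda)^{\top})^{\top}$ with $$Z(\lambda)=P_{\beta_\perp}[Y(\lambda)]\,U_0(\lambda)=P_{\beta_\perp}[\vartheta^{\top}U_0(\lambda)]\,U_0(\lambda),$$ and $\operatorname{sgn}Y(\lambda)=\operatorname{sgn}\vartheta^{\top}U_0(\lambda)$.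 -/

import Mathlib

open MeasureTheory ProbabilityTheory Filter Topology Matrix
open scoped ENNReal NNReal unitInterval UniformConvergence Polynomial

noncomputable section

/-! ### The space `D[0,1]` with the uniform topology -/

/-- Right-continuous with left limits. -/
def IsCadlag {E : Type*} [TopologicalSpace E] (f : I → E) : Prop :=
  ∀ t : I, ContinuousWithinAt f (Set.Ici t) t ∧ ∃ l : E, Tendsto f (𝓝[<] t) (𝓝 l)

/-- `D_E[0,1]`: the cadlag functions `[0,1] → E`, with the topology of uniform convergence
(the metric is the supremum distance) and its Borel σ-algebra. -/
def CadlagPath (E : Type*) [PseudoEMetricSpace E] : Type _ :=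
  {f : I →ᵤ E // IsCadlag (UniformFun.toFun f)}

namespace CadlagPath

variable {E : Type*} [PseudoEMetricSpace E]

instance : PseudoEMetricSpace (CadlagPath E) :=
  inferInstanceAs (PseudoEMetricSpace {f : I →ᵤ E // IsCadlag (UniformFun.toFun f)})

instance : MeasurableSpace (CadlagPath E) := borel _

instance : BorelSpace (CadlagPath E) := ⟨rfl⟩

instance : CoeFun (CadlagPath E) (fun _ => I → E) := ⟨fun f => UniformFun.toFun f.1⟩

end CadlagPath

theorem isCadlag_step {E : Type*} [TopologicalSpace E] (n : ℕ) (f : ℕ → E) :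
    IsCadlag (fun s : I => f ⌊(n : ℝ) * (s : ℝ)⌋₊) := by
  intro t
  have hc : Continuous (fun s : I => (n : ℝ) * (s : ℝ)) := by fun_prop
  have hn : (0 : ℝ) ≤ n := Nat.cast_nonneg n
  constructor
  · have hconst : ContinuousWithinAt (fun _ : I => f ⌊(n : ℝ) * (t : ℝ)⌋₊) (Set.Ici t) t :=
      continuousWithinAt_const
    refine hconst.congr_of_eventuallyEq ?_ rfl
    have h1 : ∀ᶠ s : I in 𝓝[≥] t, (n : ℝ) * (s : ℝ) < ⌊(n : ℝ) * (t : ℝ)⌋₊ + 1 :=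
      (hc.continuousAt.eventually_lt continuousAt_const
        (Nat.lt_floor_add_one _)).filter_mono nhdsWithin_le_nhds
    filter_upwards [h1, self_mem_nhdsWithin] with s hs hts
    have h2 : (t : ℝ) ≤ s := hts
    congr 1
    rw [Nat.floor_eq_iff (mul_nonneg hn s.2.1)]
    exact ⟨(Nat.floor_le (mul_nonneg hn t.2.1)).trans (mul_le_mul_of_nonneg_left h2 hn), hs⟩
  · refine ⟨f (⌈(n : ℝ) * (t : ℝ)⌉₊ - 1), tendsto_const_nhds.congr' ?_⟩
    rcases (mul_nonneg hn t.2.1).eq_or_lt with h0 | h0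
    · filter_upwards [self_mem_nhdsWithin] with s hs
      have h2 : (s : ℝ) ≤ t := le_of_lt hs
      have h3 : (n : ℝ) * (s : ℝ) = 0 :=
        le_antisymm ((mul_le_mul_of_nonneg_left h2 hn).trans h0.symm.le) (mul_nonneg hn s.2.1)
      simp [← h0, h3]
    · have hpos : 0 < ⌈(n : ℝ) * (t : ℝ)⌉₊ := Nat.ceil_pos.2 h0
      obtain ⟨l, hl⟩ : ∃ l, ⌈(n : ℝ) * (t : ℝ)⌉₊ = l + 1 := ⟨_, (Nat.sub_add_cancel hpos).symm⟩
      have hlt : (l : ℝ) < (n : ℝ) * (t : ℝ) := Nat.lt_ceil.1 (by omega)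
      have hle : (n : ℝ) * (t : ℝ) ≤ l + 1 := by
        have := Nat.le_ceil ((n : ℝ) * (t : ℝ)); rw [hl] at this; exact_mod_cast this
      have hn' : (0 : ℝ) < n := pos_of_mul_pos_left h0 t.2.1
      have h1 : ∀ᶠ s : I in 𝓝[<] t, (l : ℝ) < (n : ℝ) * (s : ℝ) :=
        (continuousAt_const.eventually_lt hc.continuousAt hlt).filter_mono nhdsWithin_le_nhds
      filter_upwards [h1, self_mem_nhdsWithin] with s hs hts
      have h2 : (s : ℝ) < t := hts
      have h3 : ⌊(n : ℝ) * (s : ℝ)⌋₊ = l := by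
        rw [Nat.floor_eq_iff (mul_nonneg hn s.2.1)]
        exact ⟨hs.le, (mul_lt_mul_of_pos_left h2 hn').trans_le hle⟩
      rw [hl, h3, Nat.add_sub_cancel]

/-- The path `s ↦ f ⌊n s⌋` as an element of `D[0,1]`. -/
def stepPath {E : Type*} [PseudoEMetricSpace E] (n : ℕ) (f : ℕ → E) : CadlagPath E :=
  ⟨UniformFun.ofFun (fun s : I => f ⌊(n : ℝ) * (s : ℝ)⌋₊), isCadlag_step n f⟩

/-! ### Brownian motion, order of integration, joint spectral radius -/

/-- A Brownian motion on `[0,1]`, started at `0`, with variance matrix `V`. -/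
structure IsBrownianMotion {ι Ω : Type*} [Fintype ι] [DecidableEq ι] [MeasurableSpace Ω]
    (B : I → Ω → EuclideanSpace ℝ ι) (V : Matrix ι ι ℝ) (P : Measure Ω) : Prop where
  zero : ∀ᵐ ω ∂P, B 0 ω = 0
  indep : HasIndepIncrements B P
  law : ∀ s t : I, s ≤ t →
    HasLaw (fun ω => B t ω - B s ω) (multivariateGaussian 0 (((t : ℝ) - (s : ℝ)) • V)) P
  cont : ∀ᵐ ω ∂P, Continuous (fun s => B s ω)

/-- `w ∼ I*(0)`, i.e. `sup_{1 ≤ t ≤ n} ‖w_t‖ = o_p(n^{1/2})`. The process may depend on the sample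
size: `w n t` is its value at time `t` for sample size `n`. -/
def IsStarStationary {E Ω : Type*} [NormedAddCommGroup E] [MeasurableSpace Ω] (P : Measure Ω)
    (w : ℕ → ℕ → Ω → E) : Prop :=
  TendstoInMeasure P
    (fun (n : ℕ) ω => (√(n : ℝ))⁻¹ * NNReal.toReal ((Finset.Icc 1 n).sup fun t => ‖w n t ω‖₊))
    atTop (fun _ => 0)

/-- The set of `t`-fold products of elements of `A`. -/
def matrixProducts {ι : Type*} [Fintype ι] [DecidableEq ι] (A : Set (Matrix ι ι ℝ)) (t : ℕ) :
    Set (Matrix ι ι ℝ) :=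
  {B | ∃ M : Fin t → Matrix ι ι ℝ, (∀ s, M s ∈ A) ∧ B = (List.ofFn M).prod}

/-- `limsup_t sup_{B ∈ A^t} ρ(B)^{1/t}`, where `ρ` is the largest modulus of a complex
eigenvalue. -/
def jointSpectralRadius {ι : Type*} [Fintype ι] [DecidableEq ι] (A : Set (Matrix ι ι ℝ)) : ℝ≥0∞ :=
  limsup (fun t : ℕ => ⨆ B ∈ matrixProducts A t,
    spectralRadius ℂ (B.map (algebraMap ℝ ℂ)) ^ (1 / (t : ℝ))) atTop

/-! ### The model -/

/-- Coordinates of `z = (y, x)`, with `x ∈ ℝ^m`; thus `p = m + 1`. -/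
abbrev ZIdx (m : ℕ) : Type := Unit ⊕ Fin m

/-- Coordinates of `z* = (y⁺, y⁻, x)`. -/
abbrev ZStarIdx (m : ℕ) : Type := Unit ⊕ Unit ⊕ Fin m

/-- The space `ℝ^p` in which `z = (y, x)` takes its values, with the Euclidean norm. -/
abbrev ZSpace (m : ℕ) : Type := EuclideanSpace ℝ (ZIdx m)

/-- The component `y` of `z = (y, x)`. -/
def yPart {m : ℕ} (z : ZSpace m) : ℝ := z (Sum.inl ())

/-- `z* = (y⁺, y⁻, x)`, where `y⁺ = max y 0` and `y⁻ = min y 0`. -/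
def zStar {m : ℕ} (z : ZSpace m) : ZStarIdx m → ℝ :=
  Sum.elim (fun _ => max (yPart z) 0) (Sum.elim (fun _ => min (yPart z) 0) (fun j => z (Sum.inr j)))

/-- A matrix acting on Euclidean vectors. -/
def act {ι κ : Type*} [Fintype κ] (A : Matrix ι κ ℝ) (v : EuclideanSpace ℝ κ) :
    EuclideanSpace ℝ ι :=
  WithLp.toLp 2 (A *ᵥ WithLp.ofLp v)

/-- The `(m+1) × (m+2)` matrix `[a, b, C]` with columns `a`, `b` and the columns of `C`. -/
def starCols {m : ℕ} (a b : ZIdx m → ℝ) (C : Matrix (ZIdx m) (Fin m) ℝ) :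
    Matrix (ZIdx m) (ZStarIdx m) ℝ :=
  fromCols (replicateCol Unit a) (fromCols (replicateCol Unit b) C)

/-- The parameters of a CKSVAR with `k` lags in `p = m + 1` variables:
`φ₀⁺ y_t⁺ + φ₀⁻ y_t⁻ + Φ₀ˣ x_t = c + ∑_{i=1}^k (φ_i⁺ y_{t-i}⁺ + φ_i⁻ y_{t-i}⁻ + Φ_iˣ x_{t-i}) + u_t`.
Only the coefficients with index `0, …, k` play a role. -/
structure CKSVAR (m k : ℕ) where
  c : ZIdx m → ℝ
  φpos : ℕ → ZIdx m → ℝ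
  φneg : ℕ → ZIdx m → ℝ
  Φx : ℕ → Matrix (ZIdx m) (Fin m) ℝ

namespace CKSVAR

variable {m k : ℕ} (M : CKSVAR m k)

/-- `Φ_i = [φ_i⁺, φ_i⁻, Φ_iˣ]`. -/
def PhiStar (i : ℕ) : Matrix (ZIdx m) (ZStarIdx m) ℝ := starCols (M.φpos i) (M.φneg i) (M.Φx i)

/-- The CKSVAR is canonical: `Φ₀ = [[1, 1, 0], [0, 0, I]]`. -/
def IsCanonical : Prop :=
  M.PhiStar 0 = fromBlocks 1 (fromCols 1 0) 0 (fromCols 0 1)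

/-- The path `z` (at the times `-k+1, -k+2, …`) satisfies the equations of the model for
`t = 1, 2, …` with errors `u`. -/
def Generates (u : ℕ → ZSpace m) (z : ℤ → ZSpace m) : Prop :=
  ∀ t : ℕ, 1 ≤ t →
    M.PhiStar 0 *ᵥ zStar (z t) =
      M.c + ∑ i ∈ Finset.Icc 1 k, M.PhiStar i *ᵥ zStar (z ((t : ℤ) - (i : ℤ))) + WithLp.ofLp (u t)

/-- `φ_i⁺` if `y ≥ 0`, and `φ_i⁻` if `y < 0`. In all that follows an argument `y` selects the
regime in the same way, so that the values at `1` and at `-1` are the objects with the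
superscripts `+` and `-`. -/
def phi (y : ℝ) (i : ℕ) : ZIdx m → ℝ := if 0 ≤ y then M.φpos i else M.φneg i

/-- `Φ_i^± = [φ_i^±, Φ_iˣ]`. -/
def Phi (y : ℝ) (i : ℕ) : Matrix (ZIdx m) (ZIdx m) ℝ :=
  fromCols (replicateCol Unit (M.phi y i)) (M.Φx i)

/-- The matrix polynomial `Φ^±(λ) = Φ₀^± - ∑_{i=1}^k Φ_i^± λ^i`. -/
def PhiPoly (y : ℝ) : Matrix (ZIdx m) (ZIdx m) ℝ[X] :=
  (M.Phi y 0).map Polynomial.C -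
    ∑ i ∈ Finset.Icc 1 k, (Polynomial.X ^ i : ℝ[X]) • (M.Phi y i).map Polynomial.C

/-- `π^± = -φ^±(1)`. -/
def smallPi (y : ℝ) : ZIdx m → ℝ := -(M.phi y 0 - ∑ i ∈ Finset.Icc 1 k, M.phi y i)

/-- `Πˣ = -Φˣ(1)`. -/
def PiX : Matrix (ZIdx m) (Fin m) ℝ := -(M.Φx 0 - ∑ i ∈ Finset.Icc 1 k, M.Φx i)

/-- `Π^± = [π^±, Πˣ]`. -/
def Pi (y : ℝ) : Matrix (ZIdx m) (ZIdx m) ℝ :=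
  fromCols (replicateCol Unit (M.smallPi y)) M.PiX

/-- `Γ_i^± = -∑_{j=i+1}^k Φ_j^±`. -/
def Gamma (y : ℝ) (i : ℕ) : Matrix (ZIdx m) (ZIdx m) ℝ := -∑ j ∈ Finset.Icc (i + 1) k, M.Phi y j

/-- `Γ(1; y) = Φ₀^± - ∑_{i=1}^{k-1} Γ_i^±`. -/
def GammaOne (y : ℝ) : Matrix (ZIdx m) (ZIdx m) ℝ :=
  M.Phi y 0 - ∑ i ∈ Finset.Icc 1 (k - 1), M.Gamma y i

/-- `Γ_i = [γ_i⁺, γ_i⁻, Γ_iˣ] = -∑_{j=i+1}^k Φ_j`. -/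
def GammaStar (i : ℕ) : Matrix (ZIdx m) (ZStarIdx m) ℝ :=
  -∑ j ∈ Finset.Icc (i + 1) k, M.PhiStar j

/-- The space of common trends `{(y, x) : π⁺ [y]₊ + π⁻ [y]₋ + Πˣ x = 0}`. -/
def commonTrends : Set (ZSpace m) :=
  {z | starCols (M.smallPi 1) (M.smallPi (-1)) M.PiX *ᵥ zStar z = 0}

/-- `det Φ^±(λ)` has exactly `q` roots at unity (counted with multiplicity), and all its other
(complex) roots lie outside the unit circle. -/
def UnitRoots (y : ℝ) (q : ℕ) : Prop :=
  (M.PhiPoly y).det.rootMultiplicity 1 = q ∧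
    ∀ l : ℂ, Polynomial.aeval l (M.PhiPoly y).det = 0 → l ≠ 1 → 1 < ‖l‖

/-- The factorisation `Π^± = Πˣ [θ^±, I] = α [β_y^±, β_xᵀ] = α β^±ᵀ` with `α`, `β_x` of full column
rank `r`, together with orthocomplements of `α` and `β_x`; here `p - r = d + 1`. -/
structure KinkedFactorisation (r d : ℕ) where
  α : Matrix (ZIdx m) (Fin r) ℝ
  βx : Matrix (Fin m) (Fin r) ℝ
  θpos : Fin m → ℝ
  θneg : Fin m → ℝ
  αperp : Matrix (ZIdx m) (Unit ⊕ Fin d) ℝ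
  βxperp : Matrix (Fin m) (Fin d) ℝ
  dim_eq : r + d = m
  α_rank : α.rank = r
  βx_rank : βx.rank = r
  PiX_eq : M.PiX = α * βxᵀ
  θpos_eq : M.PiX *ᵥ θpos = M.smallPi 1
  θneg_eq : M.PiX *ᵥ θneg = M.smallPi (-1)
  αperp_rank : αperp.rank = d + 1
  αperp_mul : αperpᵀ * α = 0
  βxperp_rank : βxperp.rank = d
  βxperp_mul : βxperpᵀ * βx = 0

/-- `S(y)`, for which `S(y) z = (y⁺, y⁻, x)` if `z = (y, x)`. -/
def S (m : ℕ) (y : ℝ) : Matrix (ZStarIdx m) (ZIdx m) ℝ :=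
  fromRows (fromCols (Matrix.of fun _ _ => if 0 ≤ y then 1 else 0) 0)
    (fromBlocks (Matrix.of fun _ _ => if 0 ≤ y then 0 else 1) 0 0 1)

namespace KinkedFactorisation

variable {M} {r d : ℕ} (F : M.KinkedFactorisation r d)

/-- `θ(y)`. -/
def θ (y : ℝ) : Fin m → ℝ := if 0 ≤ y then F.θpos else F.θneg

/-- `β(y)`, where `β(y)ᵀ = β_xᵀ [θ(y), I]`. -/
def β (y : ℝ) : Matrix (ZIdx m) (Fin r) ℝ :=
  (fromCols (replicateCol Unit (F.βxᵀ *ᵥ F.θ y)) F.βxᵀ)ᵀ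

/-- `β_⊥(y) = [[1, 0], [-θ(y), β_{x,⊥}]]`. -/
def βperp (y : ℝ) : Matrix (ZIdx m) (Unit ⊕ Fin d) ℝ :=
  fromBlocks 1 0 (-replicateCol Unit (F.θ y)) F.βxperp

/-- `α_⊥ᵀ Γ(1; y) β_⊥(y)`. -/
def core (y : ℝ) : Matrix (Unit ⊕ Fin d) (Unit ⊕ Fin d) ℝ :=
  F.αperpᵀ * M.GammaOne y * F.βperp y

/-- `P_{β_⊥}(y) = β_⊥(y) [α_⊥ᵀ Γ(1; y) β_⊥(y)]⁻¹ α_⊥ᵀ`. -/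
def proj (y : ℝ) : Matrix (ZIdx m) (ZIdx m) ℝ := F.βperp y * (F.core y)⁻¹ * F.αperpᵀ

/-- `ϑᵀ = e₁ᵀ P_{β_⊥}(+1)`. -/
def vartheta : ZIdx m → ℝ := fun j => F.proj 1 (Sum.inl ()) j

/-- The block matrix `𝛂` with first block row `[α, Γ_1, …, Γ_{k-1}]` and the identity below. -/
def boldα : Matrix (ZIdx m ⊕ (Fin (k - 1) × ZStarIdx m)) (Fin r ⊕ (Fin (k - 1) × ZStarIdx m)) ℝ :=
  fromBlocks F.α (Matrix.of fun a js => M.GammaStar ((js.1 : ℕ) + 1) a js.2) 0 1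

/-- The block matrix `𝛃(y)ᵀ` with block rows `[β(y)ᵀ, 0, …]`, `[S(y), -I, 0, …]`,
`[0, I, -I, 0, …]`, …, `[0, …, I, -I]`. -/
def boldβT (y : ℝ) :
    Matrix (Fin r ⊕ (Fin (k - 1) × ZStarIdx m)) (ZIdx m ⊕ (Fin (k - 1) × ZStarIdx m)) ℝ :=
  fromBlocks (F.β y)ᵀ 0
    (Matrix.of fun is a => if (is.1 : ℕ) = 0 then S m y is.2 a else 0)
    (Matrix.of fun is js => if is.2 = js.2 then
      (if (is.1 : ℕ) = js.1 then -1 else if (is.1 : ℕ) = (js.1 : ℕ) + 1 then 1 else 0) else 0)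

/-- The equilibrium error `β(y)ᵀ z` of `z = (y, x)`. -/
def eqError (z : ZSpace m) : EuclideanSpace ℝ (Fin r) := act (F.β (yPart z))ᵀ z

end KinkedFactorisation

end CKSVAR

end

/-!
A joint spectral radius below one is attained, up to an arbitrarily small loss, by an operator norm
(Berger–Wang), so Assumption 4 provides a norm which both regime matrices `1 + 𝛃(±1)ᵀ 𝛂` contract.
The equilibrium error, stacked with the lagged increments of the process with `y` split into its
positive and negative parts, follows an affine recursion driven by the errors in which every step
applies a convex combination of these two matrices. Its size is therefore at most a constant times
the initial size plus `1 + max ‖u_t‖`, which is `o_p(√n)`; this gives (i).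

Multiplication by `α_⊥ᵀ` removes the error correction from the model, so that `α_⊥ᵀ Γ(1; y_t) z_t`
follows `α_⊥ᵀ` times the partial sums of the errors up to terms of the same size. By the determinant
condition, the piecewise linear map `z ↦ (β(y)ᵀ z, α_⊥ᵀ Γ(1; y) z)` is invertible, with a Lipschitz
inverse. Hence the scaled process is uniformly close to the image of the scaled partial sums under
the Lipschitz map `v ↦ P_{β_⊥}(ϑᵀ v) v`, and continuous mapping gives (ii).
-/

section SeminormComparison

variable {𝕜 E : Type*} [NontriviallyNormedField 𝕜] [CompleteSpace 𝕜]

theorem exists_seminorm_le_mul_norm [NormedAddCommGroup E] [NormedSpace 𝕜 E]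
    [FiniteDimensional 𝕜 E] (N : Seminorm 𝕜 E) : ∃ C > 0, ∀ v, N v ≤ C * ‖v‖ := by
  let b := Module.finBasis 𝕜 E
  let coord i := LinearMap.toContinuousLinearMap (b.coord i)
  have hC : 0 ≤ ∑ i, ‖coord i‖ * N (b i) :=
    Finset.sum_nonneg fun i _ => mul_nonneg (norm_nonneg _) (apply_nonneg _ _)
  refine ⟨∑ i, ‖coord i‖ * N (b i) + 1, by linarith, fun v => ?_⟩
  calc N v = N (∑ i, b.repr v i • b i) := by rw [b.sum_repr]
    _ ≤ ∑ i, N (b.repr v i • b i) :=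
        Finset.le_sum_of_subadditive N (map_zero N).le (map_add_le_add N) Finset.univ _
    _ ≤ ∑ i, ‖coord i‖ * N (b i) * ‖v‖ := by
        refine Finset.sum_le_sum fun i _ => ?_
        rw [map_smul_eq_mul, mul_right_comm]
        exact mul_le_mul_of_nonneg_right ((coord i).le_opNorm v) (apply_nonneg _ _)
    _ ≤ (∑ i, ‖coord i‖ * N (b i) + 1) * ‖v‖ := by
        rw [← Finset.sum_mul]
        exact mul_le_mul_of_nonneg_right (by linarith) (norm_nonneg _)

theorem exists_seminorm_le_mul_of_definite [AddCommGroup E] [Module 𝕜 E] [FiniteDimensional 𝕜 E]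
    {N : Seminorm 𝕜 E} (hN : ∀ v, N v = 0 → v = 0) (p : Seminorm 𝕜 E) :
    ∃ C > 0, ∀ v, p v ≤ C * N v := by
  let _ : Norm E := ⟨N⟩
  have core : NormedSpace.Core 𝕜 E :=
    { norm_nonneg := fun v => apply_nonneg N v
      norm_smul := fun c v => map_smul_eq_mul N c v
      norm_triangle := fun v w => map_add_le_add N v w
      norm_eq_zero_iff := fun v => ⟨hN v, fun h => h ▸ map_zero N⟩ }
  let _ : NormedAddCommGroup E := NormedAddCommGroup.ofCore core
  let _ : NormedSpace 𝕜 E := NormedSpace.ofCore core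
  exact exists_seminorm_le_mul_norm p

end SeminormComparison

section WordProducts

variable {ι M : Type*} [Monoid M]

/-- The product of the members of the family `A` along the word `w`, the first letter being the
leftmost factor. The word keeps track of the number of factors, which the product does not. -/
def wordProd (A : ι → M) (w : List ι) : M := (w.map A).prod

@[simp]
theorem wordProd_nil (A : ι → M) : wordProd A [] = 1 := rfl

@[simp]
theorem wordProd_cons (A : ι → M) (i : ι) (w : List ι) :
    wordProd A (i :: w) = A i * wordProd A w := by
  simp [wordProd]

theorem wordProd_append (A : ι → M) (w w' : List ι) :
    wordProd A (w ++ w') = wordProd A w * wordProd A w' := by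
  simp [wordProd]

theorem wordProd_flatten_replicate (A : ι → M) (j : ℕ) (w : List ι) :
    wordProd A (List.replicate j w).flatten = wordProd A w ^ j := by
  induction j with
  | zero => simp
  | succ j ih => rw [List.replicate_succ, List.flatten_cons, wordProd_append, ih, pow_succ']

theorem map_wordProd {N : Type*} [Monoid N] (f : M →* N) (A : ι → M) (w : List ι) :
    f (wordProd A w) = wordProd (fun i => f (A i)) w := by
  simp [wordProd, map_list_prod, Function.comp_def]

end WordProducts

section AdaptedNorms

variable {ι 𝕜 V : Type*}

section Module

variable [AddCommGroup V]

section CommRing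

variable [CommRing 𝕜] [Module 𝕜 V] {A : ι → Module.End 𝕜 V} {W : Submodule 𝕜 V}

theorem wordProd_smul (a : 𝕜) (w : List ι) :
    wordProd (fun i => a • A i) w = a ^ w.length • wordProd A w := by
  induction w with
  | nil => simp
  | cons i w ih =>
    rw [wordProd_cons, wordProd_cons, ih, smul_mul_smul_comm, List.length_cons, pow_succ']

theorem le_comap_wordProd (hW : ∀ i, W ≤ W.comap (A i)) (w : List ι) :
    W ≤ W.comap (wordProd A w) := by
  induction w with
  | nil => exact fun v hv => hv
  | cons i w ih => exact fun v hv => hW i (ih hv)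

theorem wordProd_restrict (hW : ∀ i, W ≤ W.comap (A i)) (w : List ι) :
    wordProd (fun i => (A i).restrict (hW i)) w =
      (wordProd A w).restrict (le_comap_wordProd hW w) := by
  induction w with
  | nil => rfl
  | cons i w ih => rw [wordProd_cons, ih]; rfl

theorem wordProd_mapQ (hW : ∀ i, W ≤ W.comap (A i)) (w : List ι) :
    wordProd (fun i => W.mapQ W (A i) (hW i)) w =
      W.mapQ W (wordProd A w) (le_comap_wordProd hW w) := by
  induction w with
  | nil => exact (Submodule.mapQ_id W).symm
  | cons i w ih =>
    rw [wordProd_cons, ih]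
    exact (Submodule.mapQ_comp W W W _ _ (le_comap_wordProd hW w) (hW i)).symm

/-- A family of endomorphisms is irreducible if it leaves no proper nonzero subspace invariant. -/
def IsIrreducibleFamily (A : ι → Module.End 𝕜 V) : Prop :=
  ∀ W : Submodule 𝕜 V, (∀ i, W ≤ W.comap (A i)) → W = ⊥ ∨ W = ⊤

end CommRing

section Field

variable [Field 𝕜] [Module 𝕜 V] {W : Submodule 𝕜 V}

theorem hasEigenvalue_of_restrict {f : Module.End 𝕜 V} (hW : W ≤ W.comap f) {μ : 𝕜}
    (h : Module.End.HasEigenvalue (f.restrict hW) μ) : f.HasEigenvalue μ := by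
  obtain ⟨v, hv⟩ := h.exists_hasEigenvector
  refine Module.End.hasEigenvalue_of_hasEigenvector (x := (v : V))
    (Module.End.hasEigenvector_iff.2 ⟨Module.End.mem_eigenspace_iff.2 ?_, ?_⟩)
  · exact congrArg Subtype.val hv.apply_eq_smul
  · simpa using hv.2

theorem hasEigenvalue_of_mapQ [FiniteDimensional 𝕜 V] {f : Module.End 𝕜 V} (hW : W ≤ W.comap f)
    {μ : 𝕜} (h : Module.End.HasEigenvalue (W.mapQ W f hW) μ) : f.HasEigenvalue μ := by
  obtain ⟨x, hx⟩ := h.exists_hasEigenvector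
  let g : Module.End 𝕜 V := f - μ • 1
  let gQ : Module.End 𝕜 (V ⧸ W) := W.mapQ W f hW - μ • 1
  have hgQ : ¬ Function.Injective gQ := fun hinj =>
    hx.2 (hinj (by simp [gQ, hx.apply_eq_smul]))
  have hg : ¬ Function.Injective g := fun hinj => hgQ <| LinearMap.injective_iff_surjective.2 <| by
    intro y
    obtain ⟨y, rfl⟩ := W.mkQ_surjective y
    obtain ⟨v, rfl⟩ := LinearMap.injective_iff_surjective.1 hinj y
    exact ⟨W.mkQ v, by simp [g, gQ]⟩
  rwa [Module.End.hasEigenvalue_iff, Module.End.eigenspace_def, Ne, LinearMap.ker_eq_bot]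

theorem IsIrreducibleFamily.smul {A : ι → Module.End 𝕜 V} (hA : IsIrreducibleFamily A) {a : 𝕜}
    (ha : a ≠ 0) : IsIrreducibleFamily fun i => a • A i :=
  fun W hW => hA W fun i _ hv => (W.smul_mem_iff ha).1 (hW i hv)

end Field

section NormedField

variable [NormedField 𝕜] [Module 𝕜 V]

/-- The family `A` contracts some norm of `V` by the factor `s`. The norm is encoded as a definite
seminorm, since `V` may already carry another one. -/
def ContractsBy (A : ι → Module.End 𝕜 V) (s : ℝ) : Prop :=
  ∃ N : Seminorm 𝕜 V, (∀ v, N v = 0 → v = 0) ∧ ∀ i v, N (A i v) ≤ s * N v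

/-- All eigenvalues of all products of members of `A` have modulus at most `q`; the empty product is
left out. -/
def WordEigenvaluesLE (A : ι → Module.End 𝕜 V) (q : ℝ) : Prop :=
  ∀ w : List ι, w ≠ [] → ∀ μ : 𝕜, (wordProd A w).HasEigenvalue μ → ‖μ‖ ≤ q

variable {A : ι → Module.End 𝕜 V} {W : Submodule 𝕜 V} {s q : ℝ}

theorem ContractsBy.mono {s' : ℝ} (h : ContractsBy A s) (hs : s ≤ s') : ContractsBy A s' := by
  obtain ⟨N, hN, hNA⟩ := h
  exact ⟨N, hN, fun i v => (hNA i v).trans (mul_le_mul_of_nonneg_right hs (apply_nonneg N v))⟩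

theorem ContractsBy.smul (h : ContractsBy A s) (a : 𝕜) :
    ContractsBy (fun i => a • A i) (‖a‖ * s) := by
  obtain ⟨N, hN, hNA⟩ := h
  refine ⟨N, hN, fun i v => ?_⟩
  rw [LinearMap.smul_apply, map_smul_eq_mul, mul_assoc]
  exact mul_le_mul_of_nonneg_left (hNA i v) (norm_nonneg a)

theorem seminorm_wordProd_le {N : Seminorm 𝕜 V} (hs : 0 ≤ s) (h : ∀ i v, N (A i v) ≤ s * N v)
    (w : List ι) (v : V) : N (wordProd A w v) ≤ s ^ w.length * N v := by
  induction w with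
  | nil => simp
  | cons i w ih =>
    rw [wordProd_cons, Module.End.mul_apply, List.length_cons, pow_succ', mul_assoc]
    exact (h i _).trans (mul_le_mul_of_nonneg_left ih hs)

theorem WordEigenvaluesLE.smul (h : WordEigenvaluesLE A q) {a : 𝕜} (ha : a ≠ 0) (ha1 : ‖a‖ ≤ 1) :
    WordEigenvaluesLE (fun i => a • A i) q := by
  intro w hw μ hμ
  have hpow : a ^ w.length ≠ 0 := pow_ne_zero _ ha
  obtain ⟨v, hv⟩ := hμ.exists_hasEigenvector
  have hv' : wordProd A w v = ((a ^ w.length)⁻¹ * μ) • v := by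
    rw [mul_smul, ← hv.apply_eq_smul, wordProd_smul, LinearMap.smul_apply, inv_smul_smul₀ hpow]
  have hle : ‖(a ^ w.length)⁻¹ * μ‖ ≤ q := h w hw _ (Module.End.hasEigenvalue_of_hasEigenvector
    (Module.End.hasEigenvector_iff.2 ⟨Module.End.mem_eigenspace_iff.2 hv', hv.2⟩))
  refine le_trans ?_ hle
  rw [norm_mul, norm_inv, norm_pow]
  refine le_mul_of_one_le_left (norm_nonneg _) ?_
  exact (one_le_inv₀ (pow_pos (norm_pos_iff.2 ha) _)).2 (pow_le_one₀ (norm_nonneg a) ha1)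

theorem WordEigenvaluesLE.restrict (h : WordEigenvaluesLE A q) (hW : ∀ i, W ≤ W.comap (A i)) :
    WordEigenvaluesLE (fun i => (A i).restrict (hW i)) q := fun w hw μ hμ =>
  h w hw μ (hasEigenvalue_of_restrict (le_comap_wordProd hW w) (wordProd_restrict hW w ▸ hμ))

theorem WordEigenvaluesLE.mapQ [FiniteDimensional 𝕜 V] (h : WordEigenvaluesLE A q)
    (hW : ∀ i, W ≤ W.comap (A i)) : WordEigenvaluesLE (fun i => W.mapQ W (A i) (hW i)) q :=
  fun w hw μ hμ =>
    h w hw μ (hasEigenvalue_of_mapQ (le_comap_wordProd hW w) (wordProd_mapQ hW w ▸ hμ))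

end NormedField

end Module

section NormedSubspace

variable [NontriviallyNormedField 𝕜] [CompleteSpace 𝕜] [AddCommGroup V] [Module 𝕜 V]
  [FiniteDimensional 𝕜 V] {A : ι → Module.End 𝕜 V} {W : Submodule 𝕜 V} {s : ℝ}

-- For a retraction `τ` of `V` onto `W` the norm `ε N (τ v) + Q [v]` works once `ε` is small:
-- `τ ∘ A i - A i ∘ τ` vanishes on `W`, hence is controlled by `Q`.
theorem ContractsBy.of_restrict_mapQ [Finite ι] (hW : ∀ i, W ≤ W.comap (A i)) (hs : s < 1)
    (hsub : ContractsBy (fun i => (A i).restrict (hW i)) s)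
    (hquot : ContractsBy (fun i => W.mapQ W (A i) (hW i)) s) : ∃ s' < 1, ContractsBy A s' := by
  obtain ⟨N, hN, hNA⟩ := hsub
  obtain ⟨Q, hQ, hQA⟩ := hquot
  obtain ⟨τ, hτ⟩ := W.subtype.exists_leftInverse_of_injective W.ker_subtype
  have hτW (w : W) : τ w = w := LinearMap.congr_fun hτ w
  let D (i : ι) : (V ⧸ W) →ₗ[𝕜] W := W.liftQ (τ ∘ₗ A i - (A i).restrict (hW i) ∘ₗ τ) <| by
    intro w hw
    have hAw : τ (A i w) = ⟨A i w, hW i hw⟩ := hτW ⟨A i w, hW i hw⟩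
    have hw' : τ w = ⟨w, hw⟩ := hτW ⟨w, hw⟩
    simp [hAw, hw', LinearMap.restrict_apply]
  have hD (i : ι) (v : V) : τ (A i v) = (A i).restrict (hW i) (τ v) + D i (W.mkQ v) := by
    simp [D]
  choose K _ hK using fun i => exists_seminorm_le_mul_of_definite hQ (N.comp (D i))
  obtain ⟨K', hK'⟩ := Finite.exists_le K
  obtain ⟨ε, hε, hεK⟩ := exists_pos_mul_lt (sub_pos.2 hs) (max K' 0)
  lift ε to ℝ≥0 using hε.le
  have hval (v : V) : (ε • N.comp τ + Q.comp W.mkQ) v = ε * N (τ v) + Q (W.mkQ v) := by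
    simp [NNReal.smul_def]
  refine ⟨s + max K' 0 * ε, by linarith, ε • N.comp τ + Q.comp W.mkQ, fun v hv => ?_,
    fun i v => ?_⟩
  · obtain ⟨hτv, hQv⟩ := (add_eq_zero_iff_of_nonneg (mul_nonneg ε.2 (apply_nonneg N (τ v)))
      (apply_nonneg Q (W.mkQ v))).1 ((hval v).symm.trans hv)
    have hvW : v ∈ W := (Submodule.Quotient.mk_eq_zero W).1 (hQ _ hQv)
    have hτ0 : τ v = 0 := hN _ ((mul_eq_zero.1 hτv).resolve_left hε.ne')
    exact congrArg Subtype.val ((hτW ⟨v, hvW⟩).symm.trans hτ0)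
  · have hNv : N (τ (A i v)) ≤ s * N (τ v) + max K' 0 * Q (W.mkQ v) := by
      rw [hD]
      refine (map_add_le_add N _ _).trans (add_le_add (hNA i _) ((hK i _).trans ?_))
      exact mul_le_mul_of_nonneg_right ((hK' i).trans (le_max_left _ _)) (apply_nonneg _ _)
    have hQv : Q (W.mkQ (A i v)) ≤ s * Q (W.mkQ v) := hQA i (W.mkQ v)
    have hpos : 0 ≤ max K' 0 * ε * (ε * N (τ v)) := by positivity
    rw [hval, hval]
    linarith [mul_le_mul_of_nonneg_left hNv hε.le]

end NormedSubspace

theorem exists_pos_lt_one_le_pow {c : ℝ} (hc : c < 1) (t : ℕ) : ∃ s, 0 < s ∧ s < 1 ∧ c ≤ s ^ t := by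
  have hpow : Tendsto (fun s : ℝ => s ^ t) (𝓝[<] 1) (𝓝 1) := by
    simpa using ((continuous_pow t).tendsto (1 : ℝ)).mono_left nhdsWithin_le_nhds
  have hs : ∀ᶠ s in 𝓝[<] (1 : ℝ), s ∈ Set.Ioo (0 : ℝ) 1 := Ioo_mem_nhdsLT one_pos
  obtain ⟨s, hcs, hs0, hs1⟩ := ((hpow.eventually (lt_mem_nhds hc)).and hs).exists
  exact ⟨s, hs0, hs1, hcs.le⟩

theorem exists_one_lt_pow_lt {c : ℝ} (hc : 1 < c) (t : ℕ) : ∃ s, 1 < s ∧ s ^ t < c := by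
  have hpow : Tendsto (fun s : ℝ => s ^ t) (𝓝[>] 1) (𝓝 1) := by
    simpa using ((continuous_pow t).tendsto (1 : ℝ)).mono_left nhdsWithin_le_nhds
  obtain ⟨s, hcs, hs⟩ := ((hpow.eventually (gt_mem_nhds hc)).and self_mem_nhdsWithin).exists
  exact ⟨s, hs, hcs⟩

theorem le_of_forall_pow_le_mul_pow {a b C : ℝ} (hb : 0 < b) (h : ∀ n : ℕ, a ^ n ≤ C * b ^ n) :
    a ≤ b := by
  by_contra! hab
  obtain ⟨n, hn⟩ := pow_unbounded_of_one_lt C ((one_lt_div hb).2 hab)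
  rw [div_pow, lt_div_iff₀ (pow_pos hb n)] at hn
  exact (h n).not_gt hn

theorem exists_lt_dist_lt_of_totallyBounded {X : Type*} [PseudoMetricSpace X] {S : Set X}
    (hS : TotallyBounded S) {ε : ℝ} (hε : 0 < ε) :
    ∃ N : ℕ, ∀ y : ℕ → X, (∀ s ≤ N, y s ∈ S) → ∃ s s', s < s' ∧ s' ≤ N ∧ dist (y s) (y s') < ε := by
  obtain ⟨t, ht, hSt⟩ := Metric.totallyBounded_iff.1 hS (ε / 2) (half_pos hε)
  refine ⟨ht.toFinset.card, fun y hy => ?_⟩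
  have hcover (s) (hs : s ∈ Finset.range (ht.toFinset.card + 1)) :
      ∃ a ∈ ht.toFinset, dist (y s) a < ε / 2 := by
    simpa using hSt (hy s (Finset.mem_range_succ_iff.1 hs))
  have hnonempty : Nonempty X := ⟨y 0⟩
  choose! a ha hya using hcover
  obtain ⟨s, hs, s', hs', hne, heq⟩ : ∃ s ∈ Finset.range (ht.toFinset.card + 1),
      ∃ s' ∈ Finset.range (ht.toFinset.card + 1), s ≠ s' ∧ a s = a s' :=
    Finset.exists_ne_map_eq_of_card_lt_of_maps_to (by simp) ha
  have hdist : dist (y s) (y s') < ε := by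
    have hys' := hya s' hs'
    rw [← heq] at hys'
    linarith [hya s hs, dist_triangle_right (y s) (y s') (a s)]
  rw [Finset.mem_range_succ_iff] at hs hs'
  rcases hne.lt_or_gt with hlt | hlt
  · exact ⟨s, s', hlt, hs', hdist⟩
  · exact ⟨s', s, hlt, hs, dist_comm (y s) (y s') ▸ hdist⟩

section Normed

variable [RCLike 𝕜] [NormedAddCommGroup V] [NormedSpace 𝕜 V] {A : ι → Module.End 𝕜 V} {s : ℝ}

theorem ContractsBy.of_norm_wordProd_le {C : ℝ} (hs : 0 < s)
    (h : ∀ w v, ‖wordProd A w v‖ ≤ C * s ^ w.length * ‖v‖) : ContractsBy A s := by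
  let scaled (w : List ι) (v : V) : ℝ := (s ^ w.length)⁻¹ * ‖wordProd A w v‖
  have hbdd (v : V) : BddAbove (Set.range fun w => scaled w v) := by
    refine ⟨C * ‖v‖, ?_⟩
    rintro _ ⟨w, rfl⟩
    rw [inv_mul_le_iff₀ (pow_pos hs _)]
    exact (h w v).trans_eq (by ring)
  have hle (w : List ι) (v : V) : scaled w v ≤ ⨆ w, scaled w v := le_ciSup (hbdd v) w
  refine ⟨Seminorm.ofSMulLE (fun v => ⨆ w, scaled w v) (by simp [scaled])
    (fun x y => ciSup_le fun w => ?_) (fun c x => ciSup_le fun w => ?_), fun v hv => ?_,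
    fun i v => ciSup_le fun w => ?_⟩
  · refine le_trans ?_ (add_le_add (hle w x) (hle w y))
    rw [← mul_add]
    simp only [scaled, map_add]
    exact mul_le_mul_of_nonneg_left (norm_add_le _ _) (inv_nonneg.2 (pow_nonneg hs.le _))
  · have hsmul : scaled w (c • x) = ‖c‖ * scaled w x := by
      simp only [scaled, map_smul, norm_smul, mul_left_comm]
    exact hsmul.trans_le (mul_le_mul_of_nonneg_left (hle w x) (norm_nonneg c))
  · have hnil : ‖v‖ ≤ ⨆ w, scaled w v := by simpa [scaled] using hle [] v
    exact norm_le_zero_iff.1 (hnil.trans_eq hv)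
  · have hsnoc : scaled (w ++ [i]) v = s⁻¹ * scaled w (A i v) := by
      simp [scaled, wordProd_append, pow_succ]
      ring
    rw [← inv_mul_le_iff₀ hs, ← hsnoc]
    exact hle (w ++ [i]) v

/-- The vectors whose orbit under the products of members of `A` is bounded. -/
def boundedOrbit (A : ι → Module.End 𝕜 V) : Submodule 𝕜 V where
  carrier := {v | ∃ C, ∀ w, ‖wordProd A w v‖ ≤ C}
  zero_mem' := ⟨0, by simp⟩
  add_mem' := by
    rintro x y ⟨C, hC⟩ ⟨D, hD⟩
    exact ⟨C + D, fun w => by rw [map_add]; exact norm_add_le_of_le (hC w) (hD w)⟩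
  smul_mem' := by
    rintro a x ⟨C, hC⟩
    refine ⟨‖a‖ * C, fun w => ?_⟩
    rw [map_smul, norm_smul]
    exact mul_le_mul_of_nonneg_left (hC w) (norm_nonneg a)

theorem boundedOrbit_le_comap (A : ι → Module.End 𝕜 V) (i : ι) :
    boundedOrbit A ≤ (boundedOrbit A).comap (A i) := by
  rintro v ⟨C, hC⟩
  exact ⟨C, fun w => by simpa [wordProd_append] using hC (w ++ [i])⟩

variable [FiniteDimensional 𝕜 V]

theorem exists_forall_norm_apply_le [Finite ι] (A : ι → Module.End 𝕜 V) :
    ∃ K, 1 ≤ K ∧ ∀ i v, ‖A i v‖ ≤ K * ‖v‖ := by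
  obtain ⟨K, hK⟩ := Finite.exists_le fun i => ‖LinearMap.toContinuousLinearMap (A i)‖
  refine ⟨max K 1, le_max_right _ _, fun i v => ?_⟩
  exact (LinearMap.toContinuousLinearMap (A i)).le_of_opNorm_le ((hK i).trans (le_max_left _ _)) v

theorem ContractsBy.exists_norm_wordProd_le (h : ContractsBy A s) (hs : 0 ≤ s) :
    ∃ C, ∀ w v, ‖wordProd A w v‖ ≤ C * s ^ w.length * ‖v‖ := by
  obtain ⟨N, hN, hNA⟩ := h
  obtain ⟨C, -, hCN⟩ := exists_seminorm_le_mul_norm N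
  obtain ⟨D, hD, hDN⟩ := exists_seminorm_le_mul_of_definite hN (normSeminorm 𝕜 V)
  refine ⟨D * C, fun w v => ?_⟩
  calc ‖wordProd A w v‖ ≤ D * N (wordProd A w v) := hDN _
    _ ≤ D * (s ^ w.length * N v) :=
        mul_le_mul_of_nonneg_left (seminorm_wordProd_le hs hNA w v) hD.le
    _ ≤ D * (s ^ w.length * (C * ‖v‖)) := by gcongr; exact hCN v
    _ = D * C * s ^ w.length * ‖v‖ := by ring

theorem ContractsBy.of_length [Finite ι] {t : ℕ} (ht : t ≠ 0) {c : ℝ} (hc : c < 1)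
    (h : ∀ w : List ι, w.length = t → ∀ v, ‖wordProd A w v‖ ≤ c * ‖v‖) :
    ∃ s < 1, ContractsBy A s := by
  obtain ⟨K, hK1, hK⟩ := exists_forall_norm_apply_le A
  have hKw (w : List ι) (v : V) : ‖wordProd A w v‖ ≤ K ^ w.length * ‖v‖ :=
    seminorm_wordProd_le (N := normSeminorm 𝕜 V) (zero_le_one.trans hK1) hK w v
  obtain ⟨s, hs0, hs1, hcs⟩ := exists_pos_lt_one_le_pow hc t
  refine ⟨s, hs1, ContractsBy.of_norm_wordProd_le (C := K ^ t / s ^ t) hs0 fun w => ?_⟩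
  induction hl : w.length using Nat.strong_induction_on generalizing w with
  | _ l ih =>
    intro v
    subst hl
    rcases lt_or_ge w.length t with hlt | hge
    · refine (hKw w v).trans (mul_le_mul_of_nonneg_right ?_ (norm_nonneg _))
      rw [div_mul_eq_mul_div, le_div_iff₀ (pow_pos hs0 t)]
      gcongr ?_ * ?_
      · exact pow_le_pow_right₀ hK1 hlt.le
      · exact pow_le_pow_of_le_one hs0.le hs1.le hlt.le
    · have hdrop := ih (w.length - t) (by omega) (w.drop t) List.length_drop v
      have htake := h (w.take t) (by simp [hge]) (wordProd A (w.drop t) v)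
      rw [← Module.End.mul_apply, ← wordProd_append, List.take_append_drop] at htake
      calc ‖wordProd A w v‖ ≤ s ^ t * ‖wordProd A (w.drop t) v‖ :=
            htake.trans (mul_le_mul_of_nonneg_right hcs (norm_nonneg _))
        _ ≤ s ^ t * (K ^ t / s ^ t * s ^ (w.length - t) * ‖v‖) := by gcongr
        _ = K ^ t / s ^ t * s ^ w.length * ‖v‖ := by
            rw [← pow_sub_mul_pow s hge]
            ring

theorem exists_pos_mul_norm_le_of_le_norm_det {a : ℝ} (ha : 0 < a) (K : ℝ) :
    ∃ c > 0, ∀ g : V →L[𝕜] V, ‖g‖ ≤ K → a ≤ ‖g.det‖ → ∀ x, c * ‖x‖ ≤ ‖g x‖ := by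
  have := FiniteDimensional.proper 𝕜 V
  have := FiniteDimensional.proper 𝕜 (V →L[𝕜] V)
  have hcompact : IsCompact ((Metric.closedBall (0 : V →L[𝕜] V) K ∩ {g | a ≤ ‖g.det‖}) ×ˢ
      Metric.sphere (0 : V) 1) :=
    ((isCompact_closedBall _ _).inter_right
      (isClosed_le continuous_const ContinuousLinearMap.continuous_det.norm)).prod
      (isCompact_sphere _ _)
  have hcont : Continuous fun gx : (V →L[𝕜] V) × V => ‖gx.1 gx.2‖ :=
    isBoundedBilinearMap_apply.continuous.norm
  obtain ⟨c, hc, hcle⟩ := hcompact.exists_forall_le' hcont.continuousOn (a := 0) <| by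
    rintro ⟨g, x⟩ ⟨⟨-, hg⟩, hx⟩
    have hdet : IsUnit (LinearMap.det (g : V →ₗ[𝕜] V)) :=
      isUnit_iff_ne_zero.2 (norm_pos_iff.1 (ha.trans_le hg))
    have hx0 : x ≠ 0 := ne_zero_of_mem_unit_sphere (⟨x, hx⟩ : Metric.sphere (0 : V) 1)
    exact norm_pos_iff.2 fun hgx =>
      hx0 ((LinearMap.equivOfIsUnitDet hdet).injective (by simpa using hgx))
  refine ⟨c, hc, fun g hgK hg x => ?_⟩
  rcases eq_or_ne x 0 with rfl | hx
  · simp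
  have hxpos : 0 < ‖x‖ := norm_pos_iff.2 hx
  have hunit := hcle (g, (‖x‖⁻¹ : 𝕜) • x)
    ⟨⟨mem_closedBall_zero_iff.2 hgK, hg⟩, by simp [norm_smul, hxpos.ne']⟩
  rwa [map_smul, norm_smul, norm_inv, RCLike.norm_ofReal, abs_norm, inv_mul_eq_div,
    le_div_iff₀ hxpos] at hunit

-- Apply the pigeonhole principle to the images of a unit vector under the suffixes of a long word.
theorem exists_word_almost_fixed {K c ε : ℝ} (hK : ∀ w v, ‖wordProd A w v‖ ≤ K * ‖v‖) (hc : 0 < c)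
    (hlong : ∀ t ≠ 0, ∃ w : List ι, w.length = t ∧ ∃ v, c * ‖v‖ < ‖wordProd A w v‖) (hε : 0 < ε) :
    ∃ w ≠ [], ∃ x ≠ 0, ‖wordProd A w x - x‖ < ε * ‖x‖ := by
  have := FiniteDimensional.proper 𝕜 V
  have hK0 : 0 < K := by
    obtain ⟨w, -, v, hv⟩ := hlong 1 one_ne_zero
    exact hc.trans (lt_of_mul_lt_mul_right (hv.trans_le (hK w v)) (norm_nonneg v))
  obtain ⟨n, hn⟩ := exists_lt_dist_lt_of_totallyBounded
    (isCompact_closedBall (0 : V) K).totallyBounded (mul_pos hε (div_pos hc hK0))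
  obtain ⟨w, hw, v, hv⟩ := hlong (n + 1) n.succ_ne_zero
  have hv0 : 0 < ‖v‖ := norm_pos_iff.2 fun h => by simp [h] at hv
  let y (s : ℕ) : V := wordProd A (w.drop s) ((‖v‖⁻¹ : 𝕜) • v)
  have hyK (s) : ‖y s‖ ≤ K := (hK _ _).trans_eq (by simp [norm_smul, hv0.ne'])
  have hylow (s) : c / K ≤ ‖y s‖ := by
    rw [div_le_iff₀' hK0]
    refine le_trans ?_ (hK (w.take s) (y s))
    rw [← Module.End.mul_apply, ← wordProd_append, List.take_append_drop, map_smul, norm_smul,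
      norm_inv, RCLike.norm_ofReal, abs_norm, le_inv_mul_iff₀' hv0]
    exact hv.le
  obtain ⟨s, s', hlt, hle, hdist⟩ := hn y fun s _ => mem_closedBall_zero_iff.2 (hyK s)
  have hsub : wordProd A ((w.drop s).take (s' - s)) (y s') = y s := by
    have hdrop : w.drop s' = (w.drop s).drop (s' - s) := by
      rw [List.drop_drop, Nat.add_sub_cancel' hlt.le]
    simp only [y]
    rw [← Module.End.mul_apply, ← wordProd_append, hdrop, List.take_append_drop]
  refine ⟨(w.drop s).take (s' - s), ?_, y s', norm_pos_iff.1 ((div_pos hc hK0).trans_le (hylow s')),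
    ?_⟩
  · rw [← List.length_pos_iff, List.length_take, List.length_drop]
    omega
  · rw [hsub, ← dist_eq_norm]
    exact hdist.trans_le (mul_le_mul_of_nonneg_left (hylow s') hε.le)

theorem exists_word_expanding_of_boundedOrbit_eq_bot (h : boundedOrbit A = ⊥) (c : ℝ) :
    ∃ T, ∀ v, ∃ w : List ι, w.length ≤ T ∧ c * ‖v‖ ≤ ‖wordProd A w v‖ := by
  have := FiniteDimensional.proper 𝕜 V
  have hcover : Metric.sphere (0 : V) 1 ⊆ ⋃ w : List ι, {v | c < ‖wordProd A w v‖} := by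
    intro v hv
    by_contra hvc
    have hvW : v ∈ boundedOrbit A := ⟨c, by simpa using hvc⟩
    rw [h, Submodule.mem_bot] at hvW
    simp [hvW] at hv
  have hcont (w : List ι) : Continuous fun v => ‖wordProd A w v‖ :=
    (LinearMap.continuous_of_finiteDimensional _).norm
  obtain ⟨F, hF⟩ := (isCompact_sphere (0 : V) 1).elim_finite_subcover _
    (fun w => isOpen_lt continuous_const (hcont w)) hcover
  refine ⟨F.sup List.length, fun v => ?_⟩
  rcases eq_or_ne v 0 with rfl | hv
  · exact ⟨[], by simp, by simp⟩
  have hv0 : 0 < ‖v‖ := norm_pos_iff.2 hv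
  obtain ⟨w, hw, hlt⟩ : ∃ w ∈ F, c < ‖v‖⁻¹ * ‖wordProd A w v‖ := by
    have hunit := hF (a := (‖v‖⁻¹ : 𝕜) • v) (by simp [norm_smul, hv0.ne'])
    simpa [norm_smul] using hunit
  refine ⟨w, Finset.le_sup (f := List.length) hw, ?_⟩
  rw [lt_inv_mul_iff₀ hv0] at hlt
  linarith

theorem boundedOrbit_ne_bot [Nontrivial V] (hA : ∀ s > 1, ContractsBy A s) :
    boundedOrbit A ≠ ⊥ := by
  intro hbot
  obtain ⟨T, hT⟩ := exists_word_expanding_of_boundedOrbit_eq_bot hbot 2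
  obtain ⟨s, hs1, hsT⟩ := exists_one_lt_pow_lt one_lt_two T
  obtain ⟨C, hC⟩ := (hA s hs1).exists_norm_wordProd_le (by linarith)
  obtain ⟨v, hv⟩ := exists_ne (0 : V)
  have hiter (n : ℕ) : ∃ w : List ι, w.length ≤ T * n ∧ 2 ^ n * ‖v‖ ≤ ‖wordProd A w v‖ := by
    induction n with
    | zero => exact ⟨[], by simp, by simp⟩
    | succ n ih =>
      obtain ⟨w, hw, hwv⟩ := ih
      obtain ⟨w', hw', hwv'⟩ := hT (wordProd A w v)
      refine ⟨w' ++ w, ?_, ?_⟩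
      · rw [List.length_append, mul_add]
        omega
      · rw [wordProd_append, Module.End.mul_apply, pow_succ']
        linarith
  have hpow (n : ℕ) : (2 : ℝ) ^ n ≤ |C| * (s ^ T) ^ n := by
    obtain ⟨w, hw, hwv⟩ := hiter n
    refine le_of_mul_le_mul_right ((hwv.trans (hC w v)).trans ?_) (norm_pos_iff.2 hv)
    rw [← pow_mul]
    gcongr
    exacts [le_abs_self C, hs1.le]
  exact (le_of_forall_pow_le_mul_pow (by positivity) hpow).not_gt hsT

theorem IsIrreducibleFamily.exists_norm_wordProd_le [Nontrivial V] (hirr : IsIrreducibleFamily A)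
    (hA : ∀ s > 1, ContractsBy A s) : ∃ K, ∀ w v, ‖wordProd A w v‖ ≤ K * ‖v‖ := by
  have htop : boundedOrbit A = ⊤ :=
    (hirr _ (boundedOrbit_le_comap A)).resolve_left (boundedOrbit_ne_bot hA)
  have := FiniteDimensional.complete 𝕜 V
  obtain ⟨K, hK⟩ := banach_steinhaus
    (g := fun w => LinearMap.toContinuousLinearMap (wordProd A w)) fun v =>
      (htop ▸ Submodule.mem_top : v ∈ boundedOrbit A)
  exact ⟨K, fun w v => (LinearMap.toContinuousLinearMap (wordProd A w)).le_of_opNorm_le (hK w) v⟩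

theorem exists_pos_contractsBy [Finite ι] (A : ι → Module.End 𝕜 V) : ∃ s > 0, ContractsBy A s := by
  obtain ⟨K, hK1, hK⟩ := exists_forall_norm_apply_le A
  exact ⟨K, one_pos.trans_le hK1, normSeminorm 𝕜 V, fun v hv => norm_eq_zero.1 hv, hK⟩

end Normed

section Complex

variable [NormedAddCommGroup V] [NormedSpace ℂ V] [FiniteDimensional ℂ V]
  {A : ι → Module.End ℂ V} {q : ℝ}

theorem pow_finrank_le_norm_det_one_sub {f : Module.End ℂ V} (hq : q ≤ 1)
    (hf : ∀ μ : ℂ, f.HasEigenvalue μ → ‖μ‖ ≤ q) :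
    (1 - q) ^ Module.finrank ℂ V ≤ ‖LinearMap.det (1 - f)‖ := by
  have hsplit := IsAlgClosed.splits f.charpoly
  have hdet : LinearMap.det (1 - f) = (f.charpoly.roots.map fun μ => 1 - μ).prod := by
    rw [← hsplit.eval_eq_prod_roots_of_monic f.charpoly_monic, LinearMap.eval_charpoly, map_one]
  have hcard : f.charpoly.roots.card = Module.finrank ℂ V := by
    rw [← hsplit.natDegree_eq_card_roots, LinearMap.charpoly_natDegree]
  have hroot (μ) (hμ : μ ∈ f.charpoly.roots) : 1 - q ≤ ‖1 - μ‖ := by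
    have hμq := hf μ <| (Module.End.hasEigenvalue_iff_isRoot_charpoly f μ).2
      (Polynomial.isRoot_of_mem_roots hμ)
    have := norm_sub_norm_le 1 μ
    rw [norm_one] at this
    linarith
  have hprod := Multiset.prod_map_le_prod_map₀ (s := f.charpoly.roots) (fun _ => 1 - q)
    (fun μ => ‖1 - μ‖) (fun _ _ => sub_nonneg.2 hq) hroot
  rw [Multiset.map_const', Multiset.prod_replicate, hcard] at hprod
  rw [hdet]
  refine hprod.trans_eq (Eq.symm ((map_multiset_prod (normHom : ℂ →*₀ ℝ) _).trans ?_))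
  rw [Multiset.map_map]
  rfl

theorem WordEigenvaluesLE.exists_contractsBy_of_bounded [Finite ι] {K : ℝ} (hq : q < 1)
    (hA : WordEigenvaluesLE A q) (hK : ∀ w v, ‖wordProd A w v‖ ≤ K * ‖v‖) :
    ∃ s < 1, ContractsBy A s := by
  by_contra hcon
  have hlong (t : ℕ) (ht : t ≠ 0) :
      ∃ w : List ι, w.length = t ∧ ∃ v, 1 / 2 * ‖v‖ < ‖wordProd A w v‖ := by
    by_contra! h
    exact hcon (ContractsBy.of_length ht one_half_lt_one h)
  have hqpos : 0 < (1 - q) ^ Module.finrank ℂ V := pow_pos (sub_pos.2 hq) _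
  obtain ⟨c, hc, hcg⟩ := exists_pos_mul_norm_le_of_le_norm_det (𝕜 := ℂ) (V := V) hqpos (1 + |K|)
  obtain ⟨w, hw, x, -, hfix⟩ := exists_word_almost_fixed hK one_half_pos hlong hc
  let g : V →L[ℂ] V := LinearMap.toContinuousLinearMap (1 - wordProd A w)
  have hgK : ‖g‖ ≤ 1 + |K| := by
    refine ContinuousLinearMap.opNorm_le_bound _ (by positivity) fun v => ?_
    rw [add_mul, one_mul]
    refine (norm_sub_le _ _).trans (add_le_add_right ((hK w v).trans ?_) _)
    exact mul_le_mul_of_nonneg_right (le_abs_self K) (norm_nonneg v)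
  have hgdet : (1 - q) ^ Module.finrank ℂ V ≤ ‖g.det‖ :=
    pow_finrank_le_norm_det_one_sub hq.le (hA w hw)
  refine (hcg g hgK hgdet x).not_gt ?_
  rwa [norm_sub_rev] at hfix

theorem WordEigenvaluesLE.exists_contractsBy_of_irreducible [Finite ι] [Nontrivial V] (hq : q < 1)
    (hA : WordEigenvaluesLE A q) (hirr : IsIrreducibleFamily A) : ∃ s < 1, ContractsBy A s := by
  by_contra hcon
  let S : Set ℝ := {s | 0 < s ∧ ContractsBy A s}
  have hS1 (s) (hs : s ∈ S) : 1 ≤ s := not_lt.1 fun h => hcon ⟨s, h, hs.2⟩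
  have hbdd : BddBelow S := ⟨1, hS1⟩
  have hne : S.Nonempty := exists_pos_contractsBy A
  set r := sInf S
  have hr1 : 1 ≤ r := le_csInf hne hS1
  have hr0 : 0 < r := by linarith
  have hrℂ : (r : ℂ) ≠ 0 := Complex.ofReal_ne_zero.2 hr0.ne'
  have hnorm : ‖(r : ℂ)‖ = r := by rw [Complex.norm_real, Real.norm_of_nonneg hr0.le]
  have hscaled (s) (hs : s > 1) : ContractsBy (fun i => (r : ℂ)⁻¹ • A i) s := by
    obtain ⟨s', hs', hlt⟩ := exists_lt_of_csInf_lt hne (lt_mul_of_one_lt_right hr0 hs)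
    refine (hs'.2.smul _).mono ?_
    rw [norm_inv, hnorm, inv_mul_le_iff₀ hr0]
    exact hlt.le
  obtain ⟨K, hK⟩ := (hirr.smul (inv_ne_zero hrℂ)).exists_norm_wordProd_le hscaled
  have hinv : ‖(r : ℂ)⁻¹‖ ≤ 1 := by rw [norm_inv, hnorm]; exact inv_le_one_of_one_le₀ hr1
  obtain ⟨s, hs, hcontr⟩ :=
    (hA.smul (inv_ne_zero hrℂ) hinv).exists_contractsBy_of_bounded hq hK
  have hrs : ContractsBy A (r * s) := by
    simpa only [smul_inv_smul₀ hrℂ, hnorm] using hcontr.smul (r : ℂ)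
  have hmem : max (r * s) (r / 2) ∈ S :=
    ⟨lt_max_of_lt_right (half_pos hr0), hrs.mono (le_max_left _ _)⟩
  exact (csInf_le hbdd hmem).not_gt (max_lt (mul_lt_of_lt_one_right hr0 hs) (half_lt_self hr0))

-- One direction of the Berger–Wang theorem, by induction on the dimension.
theorem WordEigenvaluesLE.exists_contractsBy [Finite ι] (hq : q < 1)
    (hA : WordEigenvaluesLE A q) : ∃ s < 1, ContractsBy A s := by
  induction hn : Module.finrank ℂ V using Nat.strong_induction_on generalizing V with
  | _ n ih =>
    rcases subsingleton_or_nontrivial V with hV | hV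
    · exact ⟨0, one_pos, 0, fun v _ => Subsingleton.elim _ _, fun i v => by simp⟩
    by_cases hirr : IsIrreducibleFamily A
    · exact hA.exists_contractsBy_of_irreducible hq hirr
    obtain ⟨W, hW, hbot, htop⟩ : ∃ W : Submodule ℂ V, (∀ i, W ≤ W.comap (A i)) ∧ W ≠ ⊥ ∧ W ≠ ⊤ := by
      simpa [IsIrreducibleFamily] using hirr
    have hclosed : IsClosed (W : Set V) := W.closed_of_finiteDimensional
    have hsub : Module.finrank ℂ W < n := hn ▸ Submodule.finrank_lt htop
    have hquot : Module.finrank ℂ (V ⧸ W) < n := by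
      have hadd := W.finrank_quotient_add_finrank
      have hpos : Module.finrank ℂ W ≠ 0 := mt Submodule.finrank_eq_zero.1 hbot
      omega
    obtain ⟨s, hs, hsubA⟩ := ih _ hsub (hA.restrict hW) rfl
    obtain ⟨s', hs', hquotA⟩ := ih _ hquot (hA.mapQ hW) rfl
    exact ContractsBy.of_restrict_mapQ hW (max_lt hs hs') (hsubA.mono (le_max_left _ _))
      (hquotA.mono (le_max_right _ _))

end Complex

end AdaptedNorms

section JointSpectralRadius

variable {n : Type*} [Fintype n] [DecidableEq n]

theorem wordProd_val_mem_matrixProducts {S : Set (Matrix n n ℝ)} (w : List S) :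
    wordProd Subtype.val w ∈ matrixProducts S w.length :=
  ⟨fun s => (w.get s : S), fun s => (w.get s).2,
    congrArg List.prod (List.ext_get (by simp) (by simp))⟩

theorem exists_spectralRadius_le_pow {S : Set (Matrix n n ℝ)} (h : jointSpectralRadius S < 1) :
    ∃ q : ℝ≥0, q < 1 ∧ ∀ᶠ t : ℕ in atTop, ∀ B ∈ matrixProducts S t,
      spectralRadius ℂ (B.map (algebraMap ℝ ℂ)) ≤ (q : ℝ≥0∞) ^ t := by
  obtain ⟨q, hq, hq1⟩ := ENNReal.lt_iff_exists_nnreal_btwn.1 h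
  refine ⟨q, ENNReal.coe_lt_one_iff.1 hq1, ?_⟩
  filter_upwards [eventually_lt_of_limsup_lt hq, eventually_gt_atTop 0] with t ht ht0 B hB
  have hBq := (le_iSup₂ (f := fun B (_ : B ∈ matrixProducts S t) =>
    spectralRadius ℂ (B.map (algebraMap ℝ ℂ)) ^ (1 / (t : ℝ))) B hB).trans ht.le
  rwa [one_div, ENNReal.rpow_inv_le_iff (Nat.cast_pos.2 ht0), ENNReal.rpow_natCast] at hBq

theorem wordProd_toLin' {S : Set (Matrix n n ℝ)} (w : List S) :
    wordProd (fun B : S => ((B : Matrix n n ℝ).map (algebraMap ℝ ℂ)).toLin') w =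
      ((wordProd Subtype.val w).map (algebraMap ℝ ℂ)).toLin' :=
  (map_wordProd ((Matrix.toLinAlgEquiv' (R := ℂ) (n := n)).toRingEquiv.toRingHom.comp
    (algebraMap ℝ ℂ).mapMatrix).toMonoidHom Subtype.val w).symm

-- The eigenvalues of `w` are read off from those of its high powers, which the joint spectral
-- radius controls.
theorem exists_wordEigenvaluesLE_of_jointSpectralRadius_lt_one {S : Set (Matrix n n ℝ)}
    (h : jointSpectralRadius S < 1) :
    ∃ q < 1, WordEigenvaluesLE
      (fun B : S => ((B : Matrix n n ℝ).map (algebraMap ℝ ℂ)).toLin') q := by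
  obtain ⟨q, hq1, hq⟩ := exists_spectralRadius_le_pow h
  obtain ⟨T, hT⟩ := eventually_atTop.1 hq
  refine ⟨q, hq1, fun w hw μ hμ => ?_⟩
  have hlen : 0 < w.length := List.length_pos_iff.2 hw
  let w' := (List.replicate (T + 1) w).flatten
  have hw' : w'.length = w.length * (T + 1) := by simp [w', mul_comm]
  have hspec : μ ^ (T + 1) ∈ spectrum ℂ ((wordProd Subtype.val w').map (algebraMap ℝ ℂ)) := by
    rw [← Matrix.spectrum_toLin', ← wordProd_toLin', wordProd_flatten_replicate]
    exact (hμ.pow (T + 1)).mem_spectrum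
  have hle : (‖μ ^ (T + 1)‖₊ : ℝ≥0∞) ≤ (q : ℝ≥0∞) ^ (w.length * (T + 1)) := by
    rw [← hw']
    refine le_trans ?_ (hT _ (by rw [hw']; nlinarith) _ (wordProd_val_mem_matrixProducts w'))
    exact le_iSup₂ (f := fun (a : ℂ) (_ : a ∈ spectrum ℂ _) => (‖a‖₊ : ℝ≥0∞)) _ hspec
  have hpow : ‖μ‖₊ ≤ q ^ w.length := by
    rw [nnnorm_pow, pow_mul] at hle
    exact le_of_pow_le_pow_left₀ T.succ_ne_zero (by positivity) (mod_cast hle)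
  exact_mod_cast hpow.trans (pow_le_of_le_one zero_le hq1.le hlen.ne')

theorem exists_contractsBy_of_jointSpectralRadius_lt_one {S : Set (Matrix n n ℝ)} (hS : S.Finite)
    (h : jointSpectralRadius S < 1) :
    ∃ s < 1, ContractsBy (fun B : S => (B : Matrix n n ℝ).toLin') s := by
  have : Finite S := hS
  obtain ⟨q, hq, hA⟩ := exists_wordEigenvaluesLE_of_jointSpectralRadius_lt_one h
  obtain ⟨s, hs, N, hN, hNA⟩ := hA.exists_contractsBy hq
  let c : (n → ℝ) →ₗ[ℝ] n → ℂ := Complex.ofRealCLM.toLinearMap.compLeft n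
  have hc (v : n → ℝ) (i : n) : c v i = v i := rfl
  refine ⟨s, hs, (N.restrictScalars ℝ).comp c, fun v hv => ?_, fun B v => ?_⟩
  · ext i
    simpa [hc] using congrFun (hN _ hv) i
  · have hcB : c ((B : Matrix n n ℝ) *ᵥ v) =
        ((B : Matrix n n ℝ).map (algebraMap ℝ ℂ)).toLin' (c v) := by
      ext i
      simp [hc, Matrix.mulVec, dotProduct]
    rw [Seminorm.comp_apply, Matrix.toLin'_apply, hcB]
    exact hNA B (c v)

end JointSpectralRadius

section LinearBounds

theorem exists_norm_linearMap_le {E F : Type*} [NormedAddCommGroup E] [NormedSpace ℝ E]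
    [FiniteDimensional ℝ E] [SeminormedAddCommGroup F] [NormedSpace ℝ F] (f : E →ₗ[ℝ] F) :
    ∃ C > 0, ∀ v, ‖f v‖ ≤ C * ‖v‖ :=
  exists_seminorm_le_mul_norm ((normSeminorm ℝ F).comp f)

theorem exists_norm_mulVec_le {α β : Type*} [Fintype α] [Fintype β] (A : Matrix α β ℝ) :
    ∃ C > 0, ∀ v, ‖A *ᵥ v‖ ≤ C * ‖v‖ :=
  exists_norm_linearMap_le A.mulVecLin

theorem exists_norm_le_mul_norm_ofLp (ι : Type*) [Fintype ι] :
    ∃ C > 0, ∀ v : EuclideanSpace ℝ ι, ‖v‖ ≤ C * ‖WithLp.ofLp v‖ := by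
  obtain ⟨C, hC, h⟩ :=
    exists_norm_linearMap_le (WithLp.linearEquiv 2 ℝ (ι → ℝ)).symm.toLinearMap
  exact ⟨C, hC, fun v => h (WithLp.ofLp v)⟩

theorem norm_ofLp_le_norm {ι : Type*} [Fintype ι] (v : EuclideanSpace ℝ ι) :
    ‖WithLp.ofLp v‖ ≤ ‖v‖ :=
  (pi_norm_le_iff_of_nonneg (norm_nonneg _)).2 fun i => PiLp.norm_apply_le v i

end LinearBounds

section Kink

theorem exists_max_zero_sub_eq_mul (y y' : ℝ) :
    ∃ a ∈ Set.Icc (0 : ℝ) 1, max y 0 - max y' 0 = a * (y - y') := by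
  rcases eq_or_ne y y' with rfl | hne
  · exact ⟨0, by simp, by simp⟩
  wlog hlt : y' < y generalizing y y'
  · obtain ⟨a, ha, h⟩ := this y' y hne.symm (hne.lt_of_le (not_lt.1 hlt))
    exact ⟨a, ha, by linarith⟩
  have hpos := sub_pos.2 hlt
  refine ⟨(max y 0 - max y' 0) / (y - y'), ⟨?_, (div_le_one hpos).2 ?_⟩,
    (div_mul_cancel₀ _ hpos.ne').symm⟩
  · exact div_nonneg (sub_nonneg.2 (max_le_max_right 0 hlt.le)) hpos.le
  · linarith [max_add_min y 0, max_add_min y' 0, min_le_min_right 0 hlt.le]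

theorem ne_zero_of_mem_segment {a b x : ℝ} (hsign : SignType.sign a = SignType.sign b)
    (ha : a ≠ 0) (hx : x ∈ segment ℝ a b) : x ≠ 0 := by
  rcases ha.lt_or_gt with ha | ha
  · have hb : b < 0 := sign_eq_neg_one_iff.1 (hsign ▸ sign_eq_neg_one_iff.2 ha)
    exact ne_of_lt ((convex_Iio 0).segment_subset ha hb hx)
  · have hb : 0 < b := sign_eq_one_iff.1 (hsign ▸ sign_eq_one_iff.2 ha)
    exact ne_of_gt ((convex_Ioi 0).segment_subset ha hb hx)

theorem isCompact_segment {E : Type*} [AddCommGroup E] [Module ℝ E] [TopologicalSpace E]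
    [ContinuousAdd E] [ContinuousSMul ℝ E] (x y : E) : IsCompact (segment ℝ x y) := by
  rw [segment_eq_image]
  exact isCompact_Icc.image (by fun_prop)

theorem updateCol_eq_of_eq_off_col {α n : Type*} [DecidableEq n] {A B : Matrix α n ℝ} {o : n}
    (hcol : ∀ i, ∀ j ≠ o, A i j = B i j) (b : α → ℝ) :
    A.updateCol o b = B.updateCol o b := by
  ext i j
  by_cases hj : j = o
  · rw [hj, updateCol_self, updateCol_self]
  · rw [updateCol_ne hj, updateCol_ne hj, hcol i j hj]

theorem updateCol_col_of_eq_off_col {α n : Type*} [DecidableEq n] {A B : Matrix α n ℝ} {o : n}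
    (hcol : ∀ i, ∀ j ≠ o, A i j = B i j) :
    A.updateCol o (B.col o) = B :=
  (updateCol_eq_of_eq_off_col hcol _).trans (B.updateCol_eq_self o)

variable {α n : Type*} [Fintype n]

/-- The piecewise linear map that is `A` on the half-space `0 ≤ w o` and `B` on its complement. It
is continuous as soon as `A` and `B` differ at most in column `o`. -/
noncomputable def kinkedMulVec (A B : Matrix α n ℝ) (o : n) (w : n → ℝ) : α → ℝ :=
  (if 0 ≤ w o then A else B) *ᵥ w

theorem kinkedMulVec_smul (A B : Matrix α n ℝ) (o : n) {a : ℝ} (ha : 0 ≤ a) (w : n → ℝ) :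
    kinkedMulVec A B o (a • w) = a • kinkedMulVec A B o w := by
  rcases ha.eq_or_lt with rfl | ha
  · simp [kinkedMulVec]
  · simp only [kinkedMulVec, Pi.smul_apply, smul_eq_mul, mul_nonneg_iff_of_pos_left ha,
      Matrix.mulVec_smul]

theorem add_mulVec_mem_segment {A B C : Matrix α n ℝ} (hC : C ∈ segment ℝ A B) (u : α → ℝ)
    (v : n → ℝ) : u + C *ᵥ v ∈ segment ℝ (u + A *ᵥ v) (u + B *ᵥ v) := by
  obtain ⟨a, b, ha, hb, hab, rfl⟩ := hC
  refine ⟨a, b, ha, hb, hab, ?_⟩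
  rw [Matrix.add_mulVec, Matrix.smul_mulVec, Matrix.smul_mulVec, eq_sub_of_add_eq' hab]
  module

theorem exists_norm_mulVec_le_of_segment [Fintype α] (A B : Matrix α n ℝ) :
    ∃ K > 0, ∀ C ∈ segment ℝ A B, ∀ w, ‖C *ᵥ w‖ ≤ K * ‖w‖ := by
  obtain ⟨K, hK, hA⟩ := exists_norm_mulVec_le A
  obtain ⟨L, hL, hB⟩ := exists_norm_mulVec_le B
  refine ⟨K + L, by positivity, fun C hC w => ?_⟩
  have hw := add_mulVec_mem_segment hC 0 w
  simp only [zero_add] at hw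
  refine (convexOn_univ_norm.le_on_segment (Set.mem_univ _) (Set.mem_univ _) hw).trans ?_
  rw [add_mul]
  exact max_le_add_of_nonneg (norm_nonneg _) (norm_nonneg _) |>.trans (add_le_add (hA w) (hB w))

section Increments

variable {A B : Matrix α n ℝ} {o : n}

theorem mulVec_eq_add_smul_of_eq_off_col (hcol : ∀ i, ∀ j ≠ o, A i j = B i j) (w : n → ℝ) :
    A *ᵥ w = B *ᵥ w + w o • (A.col o - B.col o) := by
  classical
  ext i
  simp only [Pi.add_apply, Pi.smul_apply, Pi.sub_apply, mulVec, dotProduct, smul_eq_mul,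
    Matrix.col_apply]
  rw [← sub_eq_iff_eq_add', ← Finset.sum_sub_distrib,
    Finset.sum_eq_single o (fun j _ hj => by rw [hcol i j hj, sub_self]) (by simp)]
  ring

theorem kinkedMulVec_eq_add_smul (hcol : ∀ i, ∀ j ≠ o, A i j = B i j) (w : n → ℝ) :
    kinkedMulVec A B o w = B *ᵥ w + max (w o) 0 • (A.col o - B.col o) := by
  rw [kinkedMulVec]
  split_ifs with hw
  · rw [max_eq_left hw, mulVec_eq_add_smul_of_eq_off_col hcol]
  · rw [max_eq_right (not_le.1 hw).le, zero_smul, add_zero]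

theorem exists_mem_segment_kinkedMulVec_sub (hcol : ∀ i, ∀ j ≠ o, A i j = B i j) (w w' : n → ℝ) :
    ∃ C ∈ segment ℝ A B, kinkedMulVec A B o w - kinkedMulVec A B o w' = C *ᵥ (w - w') := by
  obtain ⟨a, ⟨ha0, ha1⟩, hmax⟩ := exists_max_zero_sub_eq_mul (w o) (w' o)
  refine ⟨a • A + (1 - a) • B, ⟨a, 1 - a, ha0, sub_nonneg.2 ha1, add_sub_cancel _ _, rfl⟩, ?_⟩
  rw [kinkedMulVec_eq_add_smul hcol, kinkedMulVec_eq_add_smul hcol, add_sub_add_comm, ← sub_smul,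
    hmax, ← Matrix.mulVec_sub, Matrix.add_mulVec, Matrix.smul_mulVec, Matrix.smul_mulVec,
    mulVec_eq_add_smul_of_eq_off_col hcol, Pi.sub_apply]
  module

theorem exists_norm_kinkedMulVec_sub_le [Fintype α] (hcol : ∀ i, ∀ j ≠ o, A i j = B i j) :
    ∃ K > 0, ∀ w w', ‖kinkedMulVec A B o w - kinkedMulVec A B o w'‖ ≤ K * ‖w - w'‖ := by
  obtain ⟨K, hK, hbound⟩ := exists_norm_mulVec_le_of_segment A B
  refine ⟨K, hK, fun w w' => ?_⟩
  obtain ⟨C, hC, heq⟩ := exists_mem_segment_kinkedMulVec_sub hcol w w'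
  exact heq ▸ hbound C hC _

end Increments

section Determinants

variable [DecidableEq n] {A B : Matrix n n ℝ} {o : n}

theorem det_mem_segment (hcol : ∀ i, ∀ j ≠ o, A i j = B i j) {C : Matrix n n ℝ}
    (hC : C ∈ segment ℝ A B) : C.det ∈ segment ℝ A.det B.det := by
  obtain ⟨a, b, ha, hb, hab, rfl⟩ := hC
  refine ⟨a, b, ha, hb, hab, ?_⟩
  have hcomb : A.updateCol o (a • A.col o + b • B.col o) = a • A + b • B := by
    refine updateCol_col_of_eq_off_col (B := a • A + b • B) fun i j hj => ?_
    rw [Matrix.add_apply, Matrix.smul_apply, Matrix.smul_apply, ← hcol i j hj, ← add_smul, hab,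
      one_smul]
  rw [← hcomb, det_updateCol_add, det_updateCol_smul, det_updateCol_smul,
    updateCol_col_of_eq_off_col fun _ _ _ => rfl, updateCol_col_of_eq_off_col hcol,
    smul_eq_mul, smul_eq_mul]

theorem exists_norm_le_mul_norm_mulVec {S : Set (Matrix n n ℝ)} (hS : IsCompact S)
    (hdet : ∀ C ∈ S, C.det ≠ 0) : ∃ K > 0, ∀ C ∈ S, ∀ w, ‖w‖ ≤ K * ‖C *ᵥ w‖ := by
  have hpos : ∀ x ∈ S ×ˢ Metric.sphere (0 : n → ℝ) 1, 0 < ‖x.1 *ᵥ x.2‖ := by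
    refine fun x ⟨hC, hw⟩ => norm_pos_iff.2 fun hzero => ?_
    exact Metric.ne_of_mem_sphere hw one_ne_zero
      (Matrix.eq_zero_of_mulVec_eq_zero (hdet _ hC) hzero)
  obtain ⟨c, hc, hmin⟩ := (hS.prod (isCompact_sphere 0 1)).exists_forall_le'
    (continuous_fst.matrix_mulVec continuous_snd).norm.continuousOn hpos
  refine ⟨c⁻¹, inv_pos.2 hc, fun C hC w => ?_⟩
  rcases eq_or_ne w 0 with rfl | hw
  · simp
  have hw0 : 0 < ‖w‖ := norm_pos_iff.2 hw
  have hunit : c ≤ ‖C *ᵥ (‖w‖⁻¹ • w)‖ :=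
    hmin (C, ‖w‖⁻¹ • w) ⟨hC, by simp [norm_smul, hw0.ne']⟩
  rw [Matrix.mulVec_smul, norm_smul, norm_inv, norm_norm, le_inv_mul_iff₀ hw0] at hunit
  rwa [le_inv_mul_iff₀ hc, mul_comm]

theorem exists_norm_sub_le_kinkedMulVec_sub (hcol : ∀ i, ∀ j ≠ o, A i j = B i j)
    (hsign : SignType.sign A.det = SignType.sign B.det) (hdet : A.det ≠ 0) :
    ∃ K > 0, ∀ w w', ‖w - w'‖ ≤ K * ‖kinkedMulVec A B o w - kinkedMulVec A B o w'‖ := by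
  obtain ⟨K, hK, hbound⟩ := exists_norm_le_mul_norm_mulVec (isCompact_segment A B)
    fun C hC => ne_zero_of_mem_segment hsign hdet (det_mem_segment hcol hC)
  refine ⟨K, hK, fun w w' => ?_⟩
  obtain ⟨C, hC, heq⟩ := exists_mem_segment_kinkedMulVec_sub hcol w w'
  exact heq ▸ hbound C hC _

theorem det_mul_inv_mulVec_apply (hA : A.det ≠ 0) (b : n → ℝ) (o : n) :
    A.det * (A⁻¹ *ᵥ b) o = (A.updateCol o b).det := by
  rw [← Matrix.cramer_apply, Matrix.cramer_eq_adjugate_mulVec, Matrix.inv_def,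
    Matrix.smul_mulVec, Pi.smul_apply, smul_eq_mul, Ring.inverse_eq_inv', mul_inv_cancel_left₀ hA]

theorem sign_inv_mulVec_apply_eq (hcol : ∀ i, ∀ j ≠ o, A i j = B i j)
    (hsign : SignType.sign A.det = SignType.sign B.det) (hA : A.det ≠ 0) (b : n → ℝ) :
    SignType.sign ((A⁻¹ *ᵥ b) o) = SignType.sign ((B⁻¹ *ᵥ b) o) := by
  have hB : B.det ≠ 0 := sign_ne_zero.1 (hsign ▸ sign_ne_zero.2 hA)
  have hcramer : A.det * (A⁻¹ *ᵥ b) o = B.det * (B⁻¹ *ᵥ b) o := by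
    rw [det_mul_inv_mulVec_apply hA, det_mul_inv_mulVec_apply hB, updateCol_eq_of_eq_off_col hcol]
  have hmul := congrArg SignType.sign hcramer
  rw [sign_mul, sign_mul, ← hsign] at hmul
  exact mul_left_cancel₀ (sign_ne_zero.2 hA) hmul

end Determinants

end Kink

theorem sum_mulVec_eq_mulVec_add_sum_sub {α β : Type*} [Fintype β] (Φ : ℕ → Matrix α β ℝ)
    (x : ℕ → β → ℝ) (K : ℕ) :
    ∑ i ∈ Finset.Icc 1 K, Φ i *ᵥ x i = (∑ i ∈ Finset.Icc 1 K, Φ i) *ᵥ x 1 +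
      ∑ i ∈ Finset.range (K - 1),
        (-∑ j ∈ Finset.Icc (i + 1 + 1) K, Φ j) *ᵥ (x (i + 1) - x (i + 2)) := by
  induction K with
  | zero => simp
  | succ K ih =>
    have hsplit : ∀ i ∈ Finset.range K,
        (-∑ j ∈ Finset.Icc (i + 1 + 1) (K + 1), Φ j) *ᵥ (x (i + 1) - x (i + 2)) =
          (-∑ j ∈ Finset.Icc (i + 1 + 1) K, Φ j) *ᵥ (x (i + 1) - x (i + 2)) +
            Φ (K + 1) *ᵥ (x (i + 1 + 1) - x (i + 1)) := by
      intro i hi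
      rw [Finset.sum_Icc_succ_top (by have := Finset.mem_range.1 hi; omega), neg_add,
        Matrix.add_mulVec, ← neg_sub (x (i + 1)), Matrix.mulVec_neg,
        Matrix.neg_mulVec _ (Φ (K + 1))]
    have hlast : ∑ i ∈ Finset.range K,
        (-∑ j ∈ Finset.Icc (i + 1 + 1) K, Φ j) *ᵥ (x (i + 1) - x (i + 2)) =
        ∑ i ∈ Finset.range (K - 1),
          (-∑ j ∈ Finset.Icc (i + 1 + 1) K, Φ j) *ᵥ (x (i + 1) - x (i + 2)) := by
      refine (Finset.sum_subset (Finset.range_mono (K.sub_le 1)) fun i _ hi => ?_).symm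
      rw [Finset.Icc_eq_empty (by have := mt Finset.mem_range.2 hi; omega), Finset.sum_empty,
        neg_zero, Matrix.zero_mulVec]
    rw [Nat.add_sub_cancel, Finset.sum_congr rfl hsplit, Finset.sum_add_distrib, hlast,
      ← Matrix.mulVec_sum, Finset.sum_range_sub (fun i => x (i + 1)) K,
      Finset.sum_Icc_succ_top (by omega), Finset.sum_Icc_succ_top (by omega), ih,
      Matrix.add_mulVec, Matrix.mulVec_sub]
    abel

namespace CKSVAR

section Regimes

variable {m k : ℕ} {M : CKSVAR m k}

theorem S_one_apply_eq (i : ZStarIdx m) {j : ZIdx m} (hj : j ≠ Sum.inl ()) :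
    S m 1 i j = S m (-1) i j := by
  obtain ⟨j, rfl⟩ : ∃ l, j = Sum.inr l := by
    rcases j with ⟨⟩ | j
    exacts [absurd rfl hj, ⟨j, rfl⟩]
  rcases i with i | i | i <;> rfl

theorem S_eq_ite (y : ℝ) : S m y = if 0 ≤ y then S m 1 else S m (-1) := by
  have hneg : ¬ (0 : ℝ) ≤ -1 := by norm_num
  by_cases hy : 0 ≤ y
  · rw [if_pos hy]
    simp only [S, hy, zero_le_one]
  · rw [if_neg hy]
    simp only [S, hy, hneg]

theorem S_mulVec (z : ZSpace m) : S m (yPart z) *ᵥ WithLp.ofLp z = zStar z := by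
  have hinl : z (Sum.inl ()) = yPart z := rfl
  ext i
  by_cases hz : 0 ≤ yPart z
  · rcases i with i | i | i <;>
      simp [S, zStar, mulVec, dotProduct, hz, hinl, Matrix.one_apply]
  · have hz' := (not_le.1 hz).le
    rcases i with i | i | i <;>
      simp [S, zStar, mulVec, dotProduct, hz, hz', hinl, Matrix.one_apply]

theorem zStar_eq_kinkedMulVec (z : ZSpace m) :
    zStar z = kinkedMulVec (S m 1) (S m (-1)) (Sum.inl ()) (WithLp.ofLp z) := by
  rw [← S_mulVec, S_eq_ite]
  rfl

theorem exists_mem_segment_zStar_sub (z z' : ZSpace m) :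
    ∃ T ∈ segment ℝ (S m 1) (S m (-1)),
      zStar z - zStar z' = T *ᵥ WithLp.ofLp (z - z') := by
  rw [zStar_eq_kinkedMulVec, zStar_eq_kinkedMulVec]
  exact exists_mem_segment_kinkedMulVec_sub (fun i j => S_one_apply_eq i) _ _

theorem IsCanonical.mulVec_zStar (h : M.IsCanonical) (z : ZSpace m) :
    M.PhiStar 0 *ᵥ zStar z = WithLp.ofLp z := by
  rw [h]
  ext i
  rcases i with ⟨⟩ | i
  · have hinl : z (Sum.inl ()) = yPart z := rfl
    simp [zStar, mulVec, dotProduct, max_add_min, hinl]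
  · simp [zStar, mulVec, dotProduct, Matrix.one_apply]

theorem starCols_smallPi_eq_sum_PhiStar_sub :
    starCols (M.smallPi 1) (M.smallPi (-1)) M.PiX =
      ∑ i ∈ Finset.Icc 1 k, M.PhiStar i - M.PhiStar 0 := by
  have hneg : ¬ (1 : ℝ) ≤ 0 := by norm_num
  ext i j
  rcases j with j | j | j <;>
    simp [starCols, PhiStar, smallPi, PiX, phi, Matrix.sum_apply, hneg]

theorem Generates.error_correction (h : M.IsCanonical) {u : ℕ → ZSpace m} {z : ℤ → ZSpace m}
    (hz : M.Generates u z) {t : ℕ} (ht : 1 ≤ t) :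
    WithLp.ofLp (z t - z (t - 1)) =
      M.c + starCols (M.smallPi 1) (M.smallPi (-1)) M.PiX *ᵥ zStar (z (t - 1)) +
      ∑ i ∈ Finset.range (k - 1), M.GammaStar (i + 1) *ᵥ
        (zStar (z ((t : ℤ) - 1 - i)) - zStar (z ((t : ℤ) - 1 - i - 1))) + WithLp.ofLp (u t) := by
  have hlag (i : ℕ) : M.GammaStar (i + 1) *ᵥ
        (zStar (z ((t : ℤ) - 1 - i)) - zStar (z ((t : ℤ) - 1 - i - 1))) =
      (-∑ j ∈ Finset.Icc (i + 1 + 1) k, M.PhiStar j) *ᵥ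
        (zStar (z ((t : ℤ) - (i + 1 : ℕ))) - zStar (z ((t : ℤ) - (i + 2 : ℕ)))) := by
    have hone : (t : ℤ) - (i + 1 : ℕ) = t - 1 - i := by push_cast; ring
    have htwo : (t : ℤ) - (i + 2 : ℕ) = t - 1 - i - 1 := by push_cast; ring
    rw [GammaStar, hone, htwo]
  have heq := hz t ht
  rw [h.mulVec_zStar, sum_mulVec_eq_mulVec_add_sum_sub M.PhiStar
    (fun i => zStar (z ((t : ℤ) - i)))] at heq
  rw [starCols_smallPi_eq_sum_PhiStar_sub, Matrix.sub_mulVec, h.mulVec_zStar, WithLp.ofLp_sub, heq,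
    Finset.sum_congr rfl fun i _ => hlag i, Nat.cast_one]
  abel

end Regimes

namespace KinkedFactorisation

variable {m k r d : ℕ} {M : CKSVAR m k} (F : M.KinkedFactorisation r d)

/-- The matrix `β*ᵀ = β_xᵀ [θ⁺, θ⁻, I]`, for which `β(y)ᵀ = β*ᵀ S(y)`. -/
noncomputable def βStar : Matrix (Fin r) (ZStarIdx m) ℝ :=
  fromCols (replicateCol Unit (F.βxᵀ *ᵥ F.θpos))
    (fromCols (replicateCol Unit (F.βxᵀ *ᵥ F.θneg)) F.βxᵀ)

theorem transpose_β (y : ℝ) : (F.β y)ᵀ = F.βStar * S m y := by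
  ext i j
  by_cases h : 0 ≤ y <;> rcases j with j | j <;>
    simp [β, βStar, S, Matrix.mul_apply, θ, h, Matrix.one_apply]

theorem ofLp_eqError (z : ZSpace m) : WithLp.ofLp (F.eqError z) = F.βStar *ᵥ zStar z := by
  rw [eqError, act, transpose_β, ← Matrix.mulVec_mulVec, S_mulVec]

theorem starCols_smallPi_eq_α_mul_βStar :
    starCols (M.smallPi 1) (M.smallPi (-1)) M.PiX = F.α * F.βStar := by
  rw [← F.θpos_eq, ← F.θneg_eq, F.PiX_eq]
  ext i j
  rcases j with j | j | j <;>
    simp only [← Matrix.mulVec_mulVec, starCols, βStar, fromCols_apply_inl, fromCols_apply_inr,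
      replicateCol_apply, mulVec, dotProduct, Matrix.mul_apply]

section State

/-- The increments of `z*` at the times `t, t - 1, …, t - k + 2`. -/
noncomputable def lagIncrements (z : ℤ → ZSpace m) (t : ℤ) (js : Fin (k - 1) × ZStarIdx m) : ℝ :=
  zStar (z (t - js.1)) js.2 - zStar (z (t - js.1 - 1)) js.2

/-- The equilibrium error at time `t`, stacked with the lagged increments of `z*`: the variable in
which the error correction form is a first-order autoregression. -/
noncomputable def state (z : ℤ → ZSpace m) (t : ℤ) : Fin r ⊕ (Fin (k - 1) × ZStarIdx m) → ℝ :=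
  Sum.elim (WithLp.ofLp (F.eqError (z t))) (lagIncrements z t)

/-- The increment of the state caused by an increment `x` of `z*`, when the lagged increments
were `w`. -/
noncomputable def stateIncrement (x : ZStarIdx m → ℝ) (w : Fin (k - 1) × ZStarIdx m → ℝ) :
    Fin r ⊕ (Fin (k - 1) × ZStarIdx m) → ℝ :=
  Sum.elim (F.βStar *ᵥ x) fun is =>
    (if (is.1 : ℕ) = 0 then x is.2 else w (⟨is.1 - 1, by omega⟩, is.2)) - w is

theorem state_sub_state (z : ℤ → ZSpace m) (t : ℤ) :
    F.state z t - F.state z (t - 1) =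
      F.stateIncrement (zStar (z t) - zStar (z (t - 1))) (lagIncrements z (t - 1)) := by
  ext i
  rcases i with i | ⟨i, s⟩
  · simp only [Pi.sub_apply, state, stateIncrement, Sum.elim_inl, ofLp_eqError, Matrix.mulVec_sub]
  simp only [Pi.sub_apply, state, stateIncrement, Sum.elim_inr, sub_left_inj]
  split_ifs with hi
  · simp only [lagIncrements, hi, Nat.cast_zero, sub_zero]
  · have htime : t - 1 - ((i - 1 : ℕ) : ℤ) = t - i := by omega
    simp only [lagIncrements, htime]

theorem stateIncrement_add_smul {a b : ℝ} (hab : a + b = 1) (x x' : ZStarIdx m → ℝ)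
    (w : Fin (k - 1) × ZStarIdx m → ℝ) :
    F.stateIncrement (a • x + b • x') w =
      a • F.stateIncrement x w + b • F.stateIncrement x' w := by
  obtain rfl := eq_sub_of_add_eq' hab
  ext i
  rcases i with i | is
  · simp only [stateIncrement, Matrix.mulVec_add, Matrix.mulVec_smul, Pi.add_apply, Pi.smul_apply,
      Sum.elim_inl]
  · simp only [stateIncrement, Pi.add_apply, Pi.smul_apply, Sum.elim_inr, smul_eq_mul]
    split_ifs <;> ring

theorem boldα_mulVec_state (h : M.IsCanonical) {u : ℕ → ZSpace m} {z : ℤ → ZSpace m}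
    (hz : M.Generates u z) {t : ℕ} (ht : 1 ≤ t) :
    F.boldα *ᵥ F.state z (t - 1) + Sum.elim (M.c + WithLp.ofLp (u t)) 0 =
      Sum.elim (WithLp.ofLp (z t - z (t - 1))) (lagIncrements z (t - 1)) := by
  have hα : F.boldα *ᵥ F.state z (t - 1) = Sum.elim
      (F.α *ᵥ WithLp.ofLp (F.eqError (z (t - 1))) + ∑ i ∈ Finset.range (k - 1),
        M.GammaStar (i + 1) *ᵥ
          (zStar (z ((t : ℤ) - 1 - i)) - zStar (z ((t : ℤ) - 1 - i - 1))))
      (lagIncrements z (t - 1)) := by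
    rw [boldα, state, fromBlocks_mulVec, Sum.elim_comp_inl, Sum.elim_comp_inr, Matrix.zero_mulVec,
      Matrix.one_mulVec, zero_add, Finset.sum_range]
    congr 2
    ext a
    simp only [mulVec, dotProduct, Fintype.sum_prod_type, Finset.sum_apply, of_apply, lagIncrements,
      Pi.sub_apply]
  rw [hα, ← Sum.elim_add_add, add_zero, hz.error_correction h ht,
    F.starCols_smallPi_eq_α_mul_βStar, ← Matrix.mulVec_mulVec, ← F.ofLp_eqError]
  congr 1
  abel

theorem sum_bidiagonal_mul {K : ℕ} (w : Fin K → ℝ) (i : Fin K) :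
    ∑ j : Fin K, (if (i : ℕ) = j then -1 else if (i : ℕ) = j + 1 then 1 else 0) * w j =
      (if (i : ℕ) = 0 then 0 else w ⟨i - 1, by omega⟩) - w i := by
  have hsplit (j : Fin K) :
      (if (i : ℕ) = j then -1 else if (i : ℕ) = j + 1 then 1 else 0) * w j =
        (if (i : ℕ) = j + 1 then w j else 0) - if i = j then w j else 0 := by
    rcases eq_or_ne i j with rfl | hij
    · simp
    · by_cases hsucc : (i : ℕ) = j + 1 <;> simp [hij, Fin.val_ne_of_ne hij, hsucc]
  rw [Finset.sum_congr rfl fun j _ => hsplit j, Finset.sum_sub_distrib, Finset.sum_ite_eq,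
    if_pos (Finset.mem_univ _)]
  congr 1
  split_ifs with hi
  · exact Finset.sum_eq_zero fun j _ => if_neg (by omega)
  · rw [Finset.sum_eq_single_of_mem ⟨i - 1, by omega⟩ (Finset.mem_univ _) fun j _ hj =>
      if_neg fun hsucc => hj (Fin.ext (by simp only [hsucc, Nat.add_sub_cancel])), if_pos]
    exact (Nat.succ_pred hi).symm

theorem boldβT_mulVec (y : ℝ) (v : ZIdx m → ℝ) (w : Fin (k - 1) × ZStarIdx m → ℝ) :
    F.boldβT y *ᵥ Sum.elim v w = F.stateIncrement (S m y *ᵥ v) w := by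
  ext i
  rcases i with i | ⟨i, s⟩
  · simp only [boldβT, fromBlocks_mulVec, Sum.elim_comp_inl, Sum.elim_comp_inr, Sum.elim_inl,
      Matrix.zero_mulVec, add_zero, transpose_β, ← Matrix.mulVec_mulVec, stateIncrement]
  have hrow : (F.boldβT y *ᵥ Sum.elim v w) (Sum.inr (i, s)) =
      (if (i : ℕ) = 0 then (S m y *ᵥ v) s else 0) +
        ∑ j : Fin (k - 1), (if (i : ℕ) = j then -1 else if (i : ℕ) = j + 1 then 1 else 0) *
          w (j, s) := by
    simp only [boldβT, mulVec, dotProduct, Fintype.sum_sum_type, fromBlocks_apply₂₁,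
      fromBlocks_apply₂₂, of_apply, Sum.elim_inl, Sum.elim_inr, Fintype.sum_prod_type, ite_mul,
      zero_mul, Finset.sum_ite_eq, Finset.mem_univ, if_true]
    congr 1
    split_ifs
    · rfl
    · simp only [Finset.sum_const_zero, add_zero]
  rw [hrow, sum_bidiagonal_mul fun j => w (j, s), stateIncrement, Sum.elim_inr]
  split_ifs <;> ring

theorem exists_mem_segment_state_sub (h : M.IsCanonical) {u : ℕ → ZSpace m} {z : ℤ → ZSpace m}
    (hz : M.Generates u z) {t : ℕ} (ht : 1 ≤ t) :
    ∃ B ∈ segment ℝ (F.boldβT 1) (F.boldβT (-1)), F.state z t - F.state z (t - 1) =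
      B *ᵥ (F.boldα *ᵥ F.state z (t - 1) + Sum.elim (M.c + WithLp.ofLp (u t)) 0) := by
  obtain ⟨_, ⟨a, b, ha, hb, hab, rfl⟩, hΔ⟩ := exists_mem_segment_zStar_sub (z t) (z (t - 1))
  refine ⟨a • F.boldβT 1 + b • F.boldβT (-1), ⟨a, b, ha, hb, hab, rfl⟩, ?_⟩
  rw [F.boldα_mulVec_state h hz ht, state_sub_state, hΔ]
  simp only [Matrix.add_mulVec, Matrix.smul_mulVec, boldβT_mulVec, F.stateIncrement_add_smul hab]

end State

end KinkedFactorisation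

end CKSVAR

theorem le_max_of_le_convexComb {a : ℕ → ℝ} {s D : ℝ} {n : ℕ} (hs0 : 0 ≤ s) (hs1 : s ≤ 1)
    (hstep : ∀ t < n, a (t + 1) ≤ s * a t + (1 - s) * D) : ∀ t ≤ n, a t ≤ max (a 0) D := by
  intro t
  induction t with
  | zero => exact fun _ => le_max_left _ _
  | succ t ih =>
    intro ht
    calc a (t + 1) ≤ s * a t + (1 - s) * D := hstep t ht
      _ ≤ s * max (a 0) D + (1 - s) * max (a 0) D :=
        add_le_add (mul_le_mul_of_nonneg_left (ih (by omega)) hs0)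
          (mul_le_mul_of_nonneg_left (le_max_right _ _) (sub_nonneg.2 hs1))
      _ = max (a 0) D := by ring

theorem norm_sumElim_add_ofLp_zero_le {ι κ : Type*} [Fintype ι] [Fintype κ] (c : ι → ℝ)
    (v : EuclideanSpace ℝ ι) :
    ‖(Sum.elim (c + WithLp.ofLp v) 0 : ι ⊕ κ → ℝ)‖ ≤ (‖c‖ + 1) * (1 + ‖v‖) := by
  refine (pi_norm_le_iff_of_nonneg (by positivity)).2 fun i => ?_
  rcases i with i | i
  · calc ‖c i + v i‖ ≤ ‖c‖ + ‖v‖ :=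
          (norm_add_le _ _).trans (add_le_add (norm_le_pi_norm _ i) (PiLp.norm_apply_le v i))
      _ ≤ (‖c‖ + 1) * (1 + ‖v‖) := by nlinarith [norm_nonneg c, norm_nonneg v]
  · simp only [Sum.elim_inr, Pi.zero_apply, norm_zero]
    positivity

namespace CKSVAR

namespace KinkedFactorisation

variable {m k r d : ℕ} {M : CKSVAR m k} (F : M.KinkedFactorisation r d)

section Stability

theorem exists_seminorm_state_succ_le (h : M.IsCanonical)
    (N : Seminorm ℝ (Fin r ⊕ (Fin (k - 1) × ZStarIdx m) → ℝ)) {s : ℝ}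
    (hpos : ∀ v, N ((1 + F.boldβT 1 * F.boldα) *ᵥ v) ≤ s * N v)
    (hneg : ∀ v, N ((1 + F.boldβT (-1) * F.boldα) *ᵥ v) ≤ s * N v) :
    ∃ K > 0, ∀ (u : ℕ → ZSpace m) (z : ℤ → ZSpace m), M.Generates u z → ∀ t : ℕ,
      N (F.state z (t + 1)) ≤ s * N (F.state z t) + K * (1 + ‖u (t + 1)‖) := by
  obtain ⟨C, hC, hNC⟩ := exists_seminorm_le_mul_norm N
  obtain ⟨K, hK, hBK⟩ := exists_norm_mulVec_le_of_segment (F.boldβT 1) (F.boldβT (-1))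
  refine ⟨C * (K * (‖M.c‖ + 1)), by positivity, fun u z hz t => ?_⟩
  obtain ⟨B, hB, hstep⟩ := F.exists_mem_segment_state_sub h hz (t := t + 1) (by omega)
  set x := F.state z t
  set e : ZIdx m ⊕ (Fin (k - 1) × ZStarIdx m) → ℝ := Sum.elim (M.c + WithLp.ofLp (u (t + 1))) 0
  have hstate : F.state z (t + 1) = (x + B *ᵥ (F.boldα *ᵥ x)) + B *ᵥ e := by
    rw [Nat.cast_succ, add_sub_cancel_right, Matrix.mulVec_add] at hstep
    rw [sub_eq_iff_eq_add'.1 hstep, add_assoc]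
  have hcontract : N (x + B *ᵥ (F.boldα *ᵥ x)) ≤ s * N x := by
    refine (N.convexOn.le_on_segment (Set.mem_univ _) (Set.mem_univ _)
      (add_mulVec_mem_segment hB x (F.boldα *ᵥ x))).trans (max_le ?_ ?_)
    · simpa only [Matrix.add_mulVec, Matrix.one_mulVec, Matrix.mulVec_mulVec] using hpos x
    · simpa only [Matrix.add_mulVec, Matrix.one_mulVec, Matrix.mulVec_mulVec] using hneg x
  have hnoise : N (B *ᵥ e) ≤ C * (K * (‖M.c‖ + 1)) * (1 + ‖u (t + 1)‖) := by
    calc N (B *ᵥ e) ≤ C * (K * ‖e‖) :=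
          (hNC _).trans (mul_le_mul_of_nonneg_left (hBK B hB e) hC.le)
      _ ≤ C * (K * ((‖M.c‖ + 1) * (1 + ‖u (t + 1)‖))) := by
          gcongr
          exact norm_sumElim_add_ofLp_zero_le _ _
      _ = C * (K * (‖M.c‖ + 1)) * (1 + ‖u (t + 1)‖) := by ring
  rw [hstate]
  exact (map_add_le_add N _ _).trans (add_le_add hcontract hnoise)

theorem exists_norm_state_le (h : M.IsCanonical)
    (hjsr : jointSpectralRadius {1 + F.boldβT 1 * F.boldα, 1 + F.boldβT (-1) * F.boldα} < 1) :
    ∃ C > 0, ∀ (u : ℕ → ZSpace m) (z : ℤ → ZSpace m), M.Generates u z → ∀ (n : ℕ) (L : ℝ),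
      0 ≤ L → (∀ j ∈ Finset.Icc 1 n, ‖u j‖ ≤ L) → ∀ t ≤ n,
        ‖F.state z t‖ ≤ C * (‖F.state z 0‖ + 1 + L) := by
  obtain ⟨s, hs, hcontract⟩ := exists_contractsBy_of_jointSpectralRadius_lt_one
    (Set.toFinite _) hjsr
  obtain ⟨N, hN, hNs⟩ := hcontract.mono (le_max_left s 0)
  replace hs : max s 0 < 1 := max_lt hs one_pos
  have hs0 : 0 ≤ max s 0 := le_max_right _ _
  set s' := max s 0
  have hs' : 0 < 1 - s' := sub_pos.2 hs
  obtain ⟨K, hK, hstep⟩ := F.exists_seminorm_state_succ_le h N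
    (hNs ⟨_, Or.inl rfl⟩) (hNs ⟨_, Or.inr rfl⟩)
  obtain ⟨C₁, hC₁, hN₁⟩ := exists_seminorm_le_mul_norm N
  obtain ⟨C₂, hC₂, hN₂⟩ := exists_seminorm_le_mul_of_definite hN (normSeminorm ℝ _)
  set D := K / (1 - s')
  have hD : 0 < D := div_pos hK hs'
  refine ⟨C₂ * (C₁ + D), by positivity, fun u z hz n L hL hu t ht => ?_⟩
  have hbound : N (F.state z t) ≤ max (N (F.state z 0)) (D * (1 + L)) := by
    refine le_max_of_le_convexComb (a := fun t : ℕ => N (F.state z t)) hs0 hs.le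
      (fun j hj => (hstep u z hz j).trans ?_) t ht
    rw [← mul_assoc, mul_div_cancel₀ _ hs'.ne']
    gcongr
    exact hu (j + 1) (Finset.mem_Icc.2 ⟨by omega, hj⟩)
  calc ‖F.state z t‖ ≤ C₂ * N (F.state z t) := hN₂ _
    _ ≤ C₂ * (C₁ * ‖F.state z 0‖ + D * (1 + L)) := by
        refine mul_le_mul_of_nonneg_left (hbound.trans (max_le ?_ ?_)) hC₂.le
        · exact (hN₁ _).trans (le_add_of_nonneg_right (by positivity))
        · exact le_add_of_nonneg_left (by positivity)
    _ ≤ C₂ * ((C₁ + D) * (‖F.state z 0‖ + 1 + L)) := by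
        refine mul_le_mul_of_nonneg_left ?_ hC₂.le
        have hcross₁ := mul_nonneg hD.le (norm_nonneg (F.state z 0))
        have hcross₂ := mul_nonneg hC₁.le (by linarith : 0 ≤ 1 + L)
        linarith
    _ = C₂ * (C₁ + D) * (‖F.state z 0‖ + 1 + L) := by ring

end Stability

end KinkedFactorisation

variable {m k : ℕ} {M : CKSVAR m k}

theorem PhiStar_mul_S (y : ℝ) (i : ℕ) : M.PhiStar i * S m y = M.Phi y i := by
  ext a j
  by_cases h : 0 ≤ y <;> rcases j with j | j <;>
    simp [PhiStar, starCols, S, Phi, phi, Matrix.mul_apply, h, Matrix.one_apply]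

theorem GammaStar_mul_S (y : ℝ) (i : ℕ) : M.GammaStar i * S m y = M.Gamma y i := by
  simp only [GammaStar, Gamma, Matrix.neg_mul, Matrix.sum_mul, PhiStar_mul_S]

theorem starCols_smallPi_mul_S (y : ℝ) :
    starCols (M.smallPi 1) (M.smallPi (-1)) M.PiX * S m y = M.Pi y := by
  have hneg : ¬ (1 : ℝ) ≤ 0 := by norm_num
  ext i j
  by_cases h : 0 ≤ y <;> rcases j with j | j <;>
    simp [Pi, starCols, S, smallPi, phi, Matrix.mul_apply, Matrix.one_apply, h, hneg]

theorem IsCanonical.GammaOne_mulVec (h : M.IsCanonical) (z : ZSpace m) :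
    M.GammaOne (yPart z) *ᵥ WithLp.ofLp z =
      WithLp.ofLp z - ∑ i ∈ Finset.range (k - 1), M.GammaStar (i + 1) *ᵥ zStar z := by
  have hIcc : Finset.Icc 1 (k - 1) = Finset.Ico (0 + 1) (k - 1 + 1) := by
    ext i
    simp only [Finset.mem_Icc, Finset.mem_Ico]
    omega
  simp only [GammaOne, ← PhiStar_mul_S, ← GammaStar_mul_S, hIcc, ← Finset.sum_Ico_add',
    ← Finset.range_eq_Ico, Matrix.sub_mulVec, Matrix.sum_mulVec, ← Matrix.mulVec_mulVec, S_mulVec,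
    h.mulVec_zStar]

namespace KinkedFactorisation

variable {r d : ℕ} (F : M.KinkedFactorisation r d)

section CommonTrends

theorem norm_zStar_sub_le_state (z : ℤ → ZSpace m) (t : ℤ) {i : ℕ} (hi : i < k - 1) :
    ‖zStar (z t) - zStar (z (t - 1 - i))‖ ≤ k * ‖F.state z t‖ := by
  have hinc : ∀ j < k - 1,
      ‖zStar (z (t - j)) - zStar (z (t - (j + 1 : ℕ)))‖ ≤ ‖F.state z t‖ := by
    intro j hj
    refine (pi_norm_le_iff_of_nonneg (norm_nonneg _)).2 fun s => ?_
    rw [Nat.cast_succ, ← sub_sub]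
    exact norm_le_pi_norm (F.state z t) (Sum.inr (⟨j, hj⟩, s))
  have htime : t - 1 - i = t - (i + 1 : ℕ) := by push_cast; ring
  have htel : zStar (z t) - zStar (z (t - 1 - i)) =
      ∑ j ∈ Finset.range (i + 1), (zStar (z (t - j)) - zStar (z (t - (j + 1 : ℕ)))) := by
    rw [Finset.sum_range_sub' (fun j : ℕ => zStar (z (t - j))), Nat.cast_zero, sub_zero, htime]
  calc ‖zStar (z t) - zStar (z (t - 1 - i))‖ ≤ ∑ _j ∈ Finset.range (i + 1), ‖F.state z t‖ := by
        rw [htel]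
        refine norm_sum_le_of_le _ fun j hj => hinc j ?_
        have := Finset.mem_range.1 hj
        omega
    _ = (i + 1 : ℕ) * ‖F.state z t‖ := by
        rw [Finset.sum_const, Finset.card_range, nsmul_eq_mul]
    _ ≤ k * ‖F.state z t‖ :=
        mul_le_mul_of_nonneg_right (by exact_mod_cast (by omega : i + 1 ≤ k)) (norm_nonneg _)

theorem αperp_mulVec_c (hc : ∃ v, M.Pi 1 *ᵥ v = M.c) : F.αperpᵀ *ᵥ M.c = 0 := by
  obtain ⟨v, hv⟩ := hc
  rw [← hv, ← starCols_smallPi_mul_S, F.starCols_smallPi_eq_α_mul_βStar, Matrix.mulVec_mulVec,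
    ← Matrix.mul_assoc, ← Matrix.mul_assoc, F.αperp_mul, Matrix.zero_mul, Matrix.zero_mul,
    Matrix.zero_mulVec]

theorem αperp_mulVec_sub (h : M.IsCanonical) (hc : ∃ v, M.Pi 1 *ᵥ v = M.c)
    {u : ℕ → ZSpace m} {z : ℤ → ZSpace m} (hz : M.Generates u z) {t : ℕ} (ht : 1 ≤ t) :
    F.αperpᵀ *ᵥ WithLp.ofLp (z t - z (t - 1)) =
      ∑ i ∈ Finset.range (k - 1), (F.αperpᵀ * M.GammaStar (i + 1)) *ᵥ
        (zStar (z ((t : ℤ) - 1 - i)) - zStar (z ((t : ℤ) - 1 - i - 1))) +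
      F.αperpᵀ *ᵥ WithLp.ofLp (u t) := by
  rw [hz.error_correction h ht, F.starCols_smallPi_eq_α_mul_βStar, Matrix.mulVec_add,
    Matrix.mulVec_add, Matrix.mulVec_add, F.αperp_mulVec_c hc, Matrix.mulVec_mulVec,
    ← Matrix.mul_assoc, F.αperp_mul, Matrix.zero_mul, Matrix.zero_mulVec, add_zero, zero_add,
    Matrix.mulVec_sum]
  simp only [Matrix.mulVec_mulVec]

theorem αperp_mulVec_sub_zero (h : M.IsCanonical) (hc : ∃ v, M.Pi 1 *ᵥ v = M.c)
    {u : ℕ → ZSpace m} {z : ℤ → ZSpace m} (hz : M.Generates u z) (j : ℕ) :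
    F.αperpᵀ *ᵥ (WithLp.ofLp (z j) - WithLp.ofLp (z 0)) =
      ∑ i ∈ Finset.range (k - 1), (F.αperpᵀ * M.GammaStar (i + 1)) *ᵥ
        (zStar (z ((j : ℤ) - 1 - i)) - zStar (z (0 - 1 - i))) +
      F.αperpᵀ *ᵥ WithLp.ofLp (∑ t ∈ Finset.Icc 1 j, u t) := by
  induction j with
  | zero => simp
  | succ j ih =>
    have hstep := F.αperp_mulVec_sub h hc hz (t := j + 1) (by omega)
    simp only [Nat.cast_succ, add_sub_cancel_right, WithLp.ofLp_sub] at hstep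
    have htel : ∀ i ∈ Finset.range (k - 1), (F.αperpᵀ * M.GammaStar (i + 1)) *ᵥ
        (zStar (z ((j : ℤ) + 1 - 1 - i)) - zStar (z (0 - 1 - i))) =
        (F.αperpᵀ * M.GammaStar (i + 1)) *ᵥ
          (zStar (z ((j : ℤ) - i)) - zStar (z ((j : ℤ) - i - 1))) +
        (F.αperpᵀ * M.GammaStar (i + 1)) *ᵥ
          (zStar (z ((j : ℤ) - 1 - i)) - zStar (z (0 - 1 - i))) := by
      intro i _
      rw [← Matrix.mulVec_add, add_sub_cancel_right, sub_right_comm (j : ℤ) 1,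
        sub_add_sub_cancel]
    rw [Finset.sum_Icc_succ_top (by omega), WithLp.ofLp_add, Matrix.mulVec_add,
      ← sub_add_sub_cancel _ (WithLp.ofLp (z j)), Matrix.mulVec_add, ih, Nat.cast_succ, hstep,
      Finset.sum_congr rfl htel, Finset.sum_add_distrib]
    abel

theorem αperp_mulVec_GammaOne_sub (h : M.IsCanonical) (hc : ∃ v, M.Pi 1 *ᵥ v = M.c)
    {u : ℕ → ZSpace m} {z : ℤ → ZSpace m} (hz : M.Generates u z) (j : ℕ) :
    F.αperpᵀ *ᵥ (M.GammaOne (yPart (z j)) *ᵥ WithLp.ofLp (z j) -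
        (M.GammaOne (yPart (z 0)) *ᵥ WithLp.ofLp (z 0) +
          WithLp.ofLp (∑ t ∈ Finset.Icc 1 j, u t))) =
      ∑ i ∈ Finset.range (k - 1), (F.αperpᵀ * M.GammaStar (i + 1)) *ᵥ
        ((zStar (z 0) - zStar (z (0 - 1 - i))) -
          (zStar (z j) - zStar (z ((j : ℤ) - 1 - i)))) := by
  have hsum := F.αperp_mulVec_sub_zero h hc hz j
  rw [Matrix.mulVec_sub, sub_eq_iff_eq_add] at hsum
  rw [h.GammaOne_mulVec, h.GammaOne_mulVec]
  simp only [Matrix.mulVec_sub, Matrix.mulVec_add, Matrix.mulVec_sum, Matrix.mulVec_mulVec,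
    Finset.sum_sub_distrib, hsum]
  abel

theorem exists_commonTrend_remainder_le (h : M.IsCanonical) (hc : ∃ v, M.Pi 1 *ᵥ v = M.c) :
    ∃ C > 0, ∀ (u : ℕ → ZSpace m) (z : ℤ → ZSpace m), M.Generates u z → ∀ j : ℕ,
      ‖F.αperpᵀ *ᵥ (M.GammaOne (yPart (z j)) *ᵥ WithLp.ofLp (z j) -
        (M.GammaOne (yPart (z 0)) *ᵥ WithLp.ofLp (z 0) +
          WithLp.ofLp (∑ t ∈ Finset.Icc 1 j, u t)))‖ ≤ C * (‖F.state z j‖ + ‖F.state z 0‖) := by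
  choose K hK0 hK using fun i => exists_norm_mulVec_le (F.αperpᵀ * M.GammaStar (i + 1))
  have hKk : 0 ≤ ∑ i ∈ Finset.range (k - 1), K i * k :=
    Finset.sum_nonneg fun i _ => mul_nonneg (hK0 i).le (Nat.cast_nonneg k)
  refine ⟨∑ i ∈ Finset.range (k - 1), K i * k + 1, by positivity, fun u z hz j => ?_⟩
  rw [F.αperp_mulVec_GammaOne_sub h hc hz]
  calc _ ≤ ∑ i ∈ Finset.range (k - 1), K i * k * (‖F.state z j‖ + ‖F.state z 0‖) := by
        refine norm_sum_le_of_le _ fun i hi => (hK i _).trans ?_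
        rw [mul_assoc]
        refine mul_le_mul_of_nonneg_left ((norm_sub_le _ _).trans ?_) (hK0 i).le
        have hzero := F.norm_zStar_sub_le_state z 0 (Finset.mem_range.1 hi)
        have hj := F.norm_zStar_sub_le_state z j (Finset.mem_range.1 hi)
        linarith
    _ ≤ _ := by
        rw [← Finset.sum_mul]
        exact mul_le_mul_of_nonneg_right (by linarith) (by positivity)

end CommonTrends

end KinkedFactorisation

end CKSVAR

section OrthogonalComplement

variable {n p q : Type*} [Fintype n] [Fintype p] [Fintype q]

theorem isUnit_transpose_mul_self [DecidableEq p] {A : Matrix n p ℝ}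
    (hA : A.rank = Fintype.card p) : IsUnit (Aᵀ * A) := by
  rw [← Matrix.mulVec_surjective_iff_isUnit]
  change Function.Surjective (Aᵀ * A).mulVecLin
  refine LinearMap.range_eq_top.1 (Submodule.eq_top_of_finrank_eq ?_)
  rw [Module.finrank_fintype_fun_eq_card, ← hA, ← Matrix.rank_transpose_mul_self]
  rfl

theorem exists_mulVec_eq_of_transpose_mulVec_eq_zero {A : Matrix n p ℝ} {B : Matrix n q ℝ}
    (hBA : Bᵀ * A = 0) (hrank : A.rank + B.rank = Fintype.card n) {v : n → ℝ}
    (hv : Aᵀ *ᵥ v = 0) : ∃ a, B *ᵥ a = v := by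
  have hAB : Aᵀ * B = 0 := by
    simpa only [Matrix.transpose_mul, Matrix.transpose_transpose, Matrix.transpose_zero] using
      congrArg Matrix.transpose hBA
  have hle : LinearMap.range B.mulVecLin ≤ LinearMap.ker Aᵀ.mulVecLin := by
    rintro _ ⟨a, rfl⟩
    rw [LinearMap.mem_ker, Matrix.mulVecLin_apply, Matrix.mulVecLin_apply, Matrix.mulVec_mulVec,
      hAB, Matrix.zero_mulVec]
  have hfinrank : Module.finrank ℝ (LinearMap.range B.mulVecLin) =
      Module.finrank ℝ (LinearMap.ker Aᵀ.mulVecLin) := by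
    have hnullity := Aᵀ.mulVecLin.finrank_range_add_finrank_ker
    have hrangeA : Module.finrank ℝ (LinearMap.range Aᵀ.mulVecLin) = A.rank := A.rank_transpose
    have hrangeB : Module.finrank ℝ (LinearMap.range B.mulVecLin) = B.rank := rfl
    rw [Module.finrank_fintype_fun_eq_card] at hnullity
    omega
  have hmem : v ∈ LinearMap.ker Aᵀ.mulVecLin := hv
  rwa [← Submodule.eq_of_le_of_finrank_eq hle hfinrank] at hmem

theorem exists_eq_mulVec_add_mulVec [DecidableEq p] {A : Matrix n p ℝ} {B : Matrix n q ℝ}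
    (hA : A.rank = Fintype.card p) (hBA : Bᵀ * A = 0) (hrank : A.rank + B.rank = Fintype.card n)
    (x : n → ℝ) : ∃ a, x = B *ᵥ a + (A * (Aᵀ * A)⁻¹) *ᵥ (Aᵀ *ᵥ x) := by
  have hdet := (Matrix.isUnit_iff_isUnit_det _).1 (isUnit_transpose_mul_self hA)
  obtain ⟨a, ha⟩ := exists_mulVec_eq_of_transpose_mulVec_eq_zero hBA hrank
    (v := x - (A * (Aᵀ * A)⁻¹) *ᵥ (Aᵀ *ᵥ x)) (by
      rw [Matrix.mulVec_sub, Matrix.mulVec_mulVec _ Aᵀ, ← Matrix.mul_assoc,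
        Matrix.mul_nonsing_inv _ hdet, Matrix.one_mulVec, sub_self])
  exact ⟨a, by rw [ha, sub_add_cancel]⟩

end OrthogonalComplement

theorem replicateCol_mulVec_const {α : Type*} (v : α → ℝ) (y : ℝ) :
    replicateCol Unit v *ᵥ (fun _ => y) = y • v := by
  ext i
  simp [mulVec, dotProduct, mul_comm]

namespace CKSVAR

variable {m k : ℕ} {M : CKSVAR m k}

theorem GammaOne_eq_ite (y : ℝ) :
    M.GammaOne y = if 0 ≤ y then M.GammaOne 1 else M.GammaOne (-1) := by
  have hneg : ¬ (1 : ℝ) ≤ 0 := by norm_num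
  split_ifs with h <;> simp [GammaOne, Gamma, Phi, phi, h, hneg]

theorem GammaOne_apply_inr (y y' : ℝ) (i : ZIdx m) (j : Fin m) :
    M.GammaOne y i (Sum.inr j) = M.GammaOne y' i (Sum.inr j) := by
  simp [GammaOne, Gamma, Phi, Matrix.sum_apply]

namespace KinkedFactorisation

variable {r d : ℕ} (F : M.KinkedFactorisation r d)

section Regimes

theorem θ_eq_ite (y : ℝ) : F.θ y = if 0 ≤ y then F.θ 1 else F.θ (-1) := by
  have hneg : ¬ (1 : ℝ) ≤ 0 := by norm_num
  split_ifs with h <;> simp [θ, h, hneg]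

theorem βperp_eq_ite (y : ℝ) : F.βperp y = if 0 ≤ y then F.βperp 1 else F.βperp (-1) := by
  rw [βperp, θ_eq_ite]
  split_ifs <;> rfl

theorem core_eq_ite (y : ℝ) : F.core y = if 0 ≤ y then F.core 1 else F.core (-1) := by
  rw [core, GammaOne_eq_ite, βperp_eq_ite]
  split_ifs <;> rfl

theorem proj_eq_ite (y : ℝ) : F.proj y = if 0 ≤ y then F.proj 1 else F.proj (-1) := by
  rw [proj, core_eq_ite, βperp_eq_ite]
  split_ifs <;> rfl

theorem βperp_one_apply_eq (i : ZIdx m) {j : Unit ⊕ Fin d} (hj : j ≠ Sum.inl ()) :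
    F.βperp 1 i j = F.βperp (-1) i j := by
  rcases j with ⟨⟩ | j
  · exact absurd rfl hj
  · rcases i with i | i <;> rfl

theorem core_one_apply_eq (i : Unit ⊕ Fin d) {j : Unit ⊕ Fin d} (hj : j ≠ Sum.inl ()) :
    F.core 1 i j = F.core (-1) i j := by
  rcases j with ⟨⟩ | j
  · exact absurd rfl hj
  have hcore (y : ℝ) : F.core y i (Sum.inr j) =
      ∑ l, (∑ a, F.αperpᵀ i a * M.GammaOne y a (Sum.inr l)) * F.βxperp l j := by
    simp [core, Matrix.mul_apply, βperp]
  rw [hcore, hcore]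
  simp only [M.GammaOne_apply_inr 1 (-1)]

theorem core_mulVec_eq_kinkedMulVec (w : Unit ⊕ Fin d → ℝ) :
    F.core (w (Sum.inl ())) *ᵥ w = kinkedMulVec (F.core 1) (F.core (-1)) (Sum.inl ()) w := by
  rw [core_eq_ite, kinkedMulVec]

theorem βperp_mulVec_eq_kinkedMulVec (w : Unit ⊕ Fin d → ℝ) :
    F.βperp (w (Sum.inl ())) *ᵥ w =
      kinkedMulVec (F.βperp 1) (F.βperp (-1)) (Sum.inl ()) w := by
  rw [βperp_eq_ite, kinkedMulVec]

theorem βperp_mulVec_inl (y : ℝ) (w : Unit ⊕ Fin d → ℝ) :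
    (F.βperp y *ᵥ w) (Sum.inl ()) = w (Sum.inl ()) := by
  simp [βperp, mulVec, dotProduct]

theorem proj_mulVec (y : ℝ) (v : ZIdx m → ℝ) :
    F.proj y *ᵥ v = F.βperp y *ᵥ ((F.core y)⁻¹ *ᵥ (F.αperpᵀ *ᵥ v)) := by
  rw [proj, Matrix.mulVec_mulVec, Matrix.mulVec_mulVec, Matrix.mul_assoc]

end Regimes

section Decomposition

/-- The matrix through which the equilibrium error `β(y)ᵀ z` enters `z`, when `z` is decomposed
along the columns of `β_⊥(y)` and of `[0; β_x]`. -/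
noncomputable def errorLoading : Matrix (ZIdx m) (Fin r) ℝ :=
  fromRows 0 (F.βx * (F.βxᵀ * F.βx)⁻¹)

theorem ofLp_eqError_eq_βx_mulVec (z : ZSpace m) : WithLp.ofLp (F.eqError z) =
    F.βxᵀ *ᵥ ((fun j => z (Sum.inr j)) + yPart z • F.θ (yPart z)) := by
  have hz : WithLp.ofLp z = Sum.elim (fun _ => yPart z) fun j => z (Sum.inr j) := by
    ext i
    rcases i with i | i <;> rfl
  rw [eqError, act, β, Matrix.transpose_transpose, Matrix.mulVec_add, Matrix.mulVec_smul, add_comm,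
    ← replicateCol_mulVec_const, ← Matrix.fromCols_mulVec_sumElim, ← hz]

theorem exists_eq_βperp_mulVec_add (z : ZSpace m) : ∃ w : Unit ⊕ Fin d → ℝ,
    w (Sum.inl ()) = yPart z ∧ WithLp.ofLp z =
      F.βperp (yPart z) *ᵥ w + F.errorLoading *ᵥ WithLp.ofLp (F.eqError z) := by
  obtain ⟨a, ha⟩ := exists_eq_mulVec_add_mulVec (A := F.βx) (B := F.βxperp)
    (by rw [F.βx_rank, Fintype.card_fin]) F.βxperp_mul
    (by rw [F.βx_rank, F.βxperp_rank, F.dim_eq, Fintype.card_fin])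
    ((fun j => z (Sum.inr j)) + yPart z • F.θ (yPart z))
  refine ⟨Sum.elim (fun _ => yPart z) a, rfl, ?_⟩
  rw [F.ofLp_eqError_eq_βx_mulVec, errorLoading, Matrix.fromRows_mulVec, βperp,
    Matrix.fromBlocks_mulVec]
  ext i
  rcases i with i | i
  · simp [yPart]
  · have hi := congrFun ha i
    simp only [Pi.add_apply, Pi.smul_apply] at hi
    simp only [Sum.elim_comp_inl, Sum.elim_comp_inr, Pi.add_apply, Sum.elim_inr,
      Matrix.neg_mulVec, replicateCol_mulVec_const, Pi.neg_apply, Pi.smul_apply]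
    linarith

theorem GammaOne_mul_errorLoading (y : ℝ) :
    M.GammaOne y * F.errorLoading = M.GammaOne 1 * F.errorLoading := by
  ext i j
  simp [Matrix.mul_apply, errorLoading, M.GammaOne_apply_inr y 1]

theorem αperp_mulVec_GammaOne_mulVec {z : ZSpace m} {w : Unit ⊕ Fin d → ℝ}
    (hz : WithLp.ofLp z =
      F.βperp (yPart z) *ᵥ w + F.errorLoading *ᵥ WithLp.ofLp (F.eqError z)) :
    F.αperpᵀ *ᵥ (M.GammaOne (yPart z) *ᵥ WithLp.ofLp z) = F.core (yPart z) *ᵥ w +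
      (F.αperpᵀ * M.GammaOne 1 * F.errorLoading) *ᵥ WithLp.ofLp (F.eqError z) := by
  rw [hz, core]
  simp only [Matrix.mulVec_add, Matrix.mulVec_mulVec, Matrix.mul_assoc,
    F.GammaOne_mul_errorLoading (yPart z)]

end Decomposition

section TrendMap

/-- The limiting map `v ↦ P_{β_⊥}(ϑᵀ v) v`. -/
noncomputable def trendMap (v : ZSpace m) : ZSpace m :=
  act (F.proj (F.vartheta ⬝ᵥ WithLp.ofLp v)) v

/-- The coordinates of `trendMap v` along the columns of `β_⊥`. -/
noncomputable def trendCoef (v : ZIdx m → ℝ) : Unit ⊕ Fin d → ℝ :=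
  (F.core (F.vartheta ⬝ᵥ v))⁻¹ *ᵥ (F.αperpᵀ *ᵥ v)

theorem vartheta_dotProduct (v : ZIdx m → ℝ) :
    F.vartheta ⬝ᵥ v = ((F.core 1)⁻¹ *ᵥ (F.αperpᵀ *ᵥ v)) (Sum.inl ()) := by
  rw [← F.βperp_mulVec_inl 1 ((F.core 1)⁻¹ *ᵥ _), ← proj_mulVec]
  rfl

theorem yPart_trendMap (v : ZSpace m) :
    yPart (F.trendMap v) = F.trendCoef (WithLp.ofLp v) (Sum.inl ()) := by
  rw [trendCoef, ← F.βperp_mulVec_inl (F.vartheta ⬝ᵥ WithLp.ofLp v) ((F.core _)⁻¹ *ᵥ _),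
    ← proj_mulVec]
  rfl

theorem sign_trendCoef_inl
    (hdet : SignType.sign (F.core 1).det = SignType.sign (F.core (-1)).det)
    (hdet0 : (F.core 1).det ≠ 0) (v : ZIdx m → ℝ) :
    SignType.sign (F.trendCoef v (Sum.inl ())) = SignType.sign (F.vartheta ⬝ᵥ v) := by
  rw [trendCoef, core_eq_ite]
  split_ifs
  · rw [vartheta_dotProduct]
  · rw [vartheta_dotProduct]
    exact (sign_inv_mulVec_apply_eq (fun i j => F.core_one_apply_eq i) hdet hdet0 _).symm

theorem sign_yPart_trendMap
    (hdet : SignType.sign (F.core 1).det = SignType.sign (F.core (-1)).det)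
    (hdet0 : (F.core 1).det ≠ 0) (v : ZSpace m) :
    SignType.sign (yPart (F.trendMap v)) = SignType.sign (F.vartheta ⬝ᵥ WithLp.ofLp v) := by
  rw [yPart_trendMap, F.sign_trendCoef_inl hdet hdet0]

theorem trendCoef_inl_nonneg_iff
    (hdet : SignType.sign (F.core 1).det = SignType.sign (F.core (-1)).det)
    (hdet0 : (F.core 1).det ≠ 0) (v : ZIdx m → ℝ) :
    0 ≤ F.trendCoef v (Sum.inl ()) ↔ 0 ≤ F.vartheta ⬝ᵥ v := by
  rw [← sign_nonneg_iff, F.sign_trendCoef_inl hdet hdet0, sign_nonneg_iff]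

theorem proj_yPart_trendMap
    (hdet : SignType.sign (F.core 1).det = SignType.sign (F.core (-1)).det)
    (hdet0 : (F.core 1).det ≠ 0) (v : ZSpace m) :
    F.proj (yPart (F.trendMap v)) = F.proj (F.vartheta ⬝ᵥ WithLp.ofLp v) := by
  rw [proj_eq_ite, F.proj_eq_ite (F.vartheta ⬝ᵥ WithLp.ofLp v)]
  simp only [yPart_trendMap, F.trendCoef_inl_nonneg_iff hdet hdet0]

theorem kinkedMulVec_core_trendCoef
    (hdet : SignType.sign (F.core 1).det = SignType.sign (F.core (-1)).det)
    (hdet0 : (F.core 1).det ≠ 0) (v : ZIdx m → ℝ) :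
    kinkedMulVec (F.core 1) (F.core (-1)) (Sum.inl ()) (F.trendCoef v) = F.αperpᵀ *ᵥ v := by
  have hneg : (F.core (-1)).det ≠ 0 := sign_ne_zero.1 (hdet ▸ sign_ne_zero.2 hdet0)
  have hunit : IsUnit (F.core (F.vartheta ⬝ᵥ v)).det := by
    rw [core_eq_ite, isUnit_iff_ne_zero]
    split_ifs
    exacts [hdet0, hneg]
  simp only [kinkedMulVec, F.trendCoef_inl_nonneg_iff hdet hdet0, ← F.core_eq_ite]
  rw [trendCoef, Matrix.mulVec_mulVec, Matrix.mul_nonsing_inv _ hunit, Matrix.one_mulVec]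

theorem ofLp_trendMap
    (hdet : SignType.sign (F.core 1).det = SignType.sign (F.core (-1)).det)
    (hdet0 : (F.core 1).det ≠ 0) (v : ZSpace m) :
    WithLp.ofLp (F.trendMap v) = kinkedMulVec (F.βperp 1) (F.βperp (-1)) (Sum.inl ())
      (F.trendCoef (WithLp.ofLp v)) := by
  simp only [kinkedMulVec, F.trendCoef_inl_nonneg_iff hdet hdet0, ← F.βperp_eq_ite]
  rw [trendCoef, ← proj_mulVec]
  rfl

theorem exists_norm_sub_trendCoef_le
    (hdet : SignType.sign (F.core 1).det = SignType.sign (F.core (-1)).det)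
    (hdet0 : (F.core 1).det ≠ 0) : ∃ C > 0, ∀ (w : Unit ⊕ Fin d → ℝ) (v : ZIdx m → ℝ),
    ‖w - F.trendCoef v‖ ≤ C * ‖F.core (w (Sum.inl ())) *ᵥ w - F.αperpᵀ *ᵥ v‖ := by
  obtain ⟨C, hC, hcore⟩ := exists_norm_sub_le_kinkedMulVec_sub
    (fun i j => F.core_one_apply_eq i) hdet hdet0
  refine ⟨C, hC, fun w v => ?_⟩
  rw [core_mulVec_eq_kinkedMulVec, ← F.kinkedMulVec_core_trendCoef hdet hdet0]
  exact hcore w _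

theorem exists_norm_sub_trendMap_le
    (hdet : SignType.sign (F.core 1).det = SignType.sign (F.core (-1)).det)
    (hdet0 : (F.core 1).det ≠ 0) : ∃ C > 0, ∀ z v : ZSpace m, ‖z - F.trendMap v‖ ≤
      C * (‖WithLp.ofLp (F.eqError z)‖ +
        ‖F.αperpᵀ *ᵥ (M.GammaOne (yPart z) *ᵥ WithLp.ofLp z - WithLp.ofLp v)‖) := by
  obtain ⟨C₀, hC₀, hofLp⟩ := exists_norm_le_mul_norm_ofLp (ZIdx m)
  obtain ⟨C₁, hC₁, hβperp⟩ := exists_norm_kinkedMulVec_sub_le fun i j => F.βperp_one_apply_eq i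
  obtain ⟨C₂, hC₂, htrendCoef⟩ := F.exists_norm_sub_trendCoef_le hdet hdet0
  obtain ⟨C₃, hC₃, hB⟩ := exists_norm_mulVec_le F.errorLoading
  obtain ⟨C₄, hC₄, hΓB⟩ := exists_norm_mulVec_le (F.αperpᵀ * M.GammaOne 1 * F.errorLoading)
  refine ⟨C₀ * (C₁ * (C₂ * (1 + C₄)) + C₃), by positivity, fun z v => ?_⟩
  obtain ⟨w, hw, hz⟩ := F.exists_eq_βperp_mulVec_add z
  set ξ := WithLp.ofLp (F.eqError z)
  set R := F.αperpᵀ *ᵥ (M.GammaOne (yPart z) *ᵥ WithLp.ofLp z - WithLp.ofLp v) with hR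
  have hcore : F.core (w (Sum.inl ())) *ᵥ w - F.αperpᵀ *ᵥ WithLp.ofLp v =
      R - (F.αperpᵀ * M.GammaOne 1 * F.errorLoading) *ᵥ ξ := by
    rw [hR, Matrix.mulVec_sub, F.αperp_mulVec_GammaOne_mulVec hz, hw]
    abel
  have hcoef : ‖w - F.trendCoef (WithLp.ofLp v)‖ ≤ C₂ * (‖R‖ + C₄ * ‖ξ‖) := by
    refine (htrendCoef w _).trans (mul_le_mul_of_nonneg_left ?_ hC₂.le)
    rw [hcore]
    exact (norm_sub_le _ _).trans (add_le_add_right (hΓB ξ) _)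
  have hsub : WithLp.ofLp (z - F.trendMap v) =
      (kinkedMulVec (F.βperp 1) (F.βperp (-1)) (Sum.inl ()) w -
        kinkedMulVec (F.βperp 1) (F.βperp (-1)) (Sum.inl ()) (F.trendCoef (WithLp.ofLp v))) +
      F.errorLoading *ᵥ ξ := by
    rw [WithLp.ofLp_sub, F.ofLp_trendMap hdet hdet0, hz,
      ← F.βperp_mulVec_eq_kinkedMulVec w, hw]
    abel
  calc ‖z - F.trendMap v‖ ≤ C₀ * (C₁ * (C₂ * (‖R‖ + C₄ * ‖ξ‖)) + C₃ * ‖ξ‖) := by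
        refine (hofLp _).trans (mul_le_mul_of_nonneg_left ?_ hC₀.le)
        rw [hsub]
        exact (norm_add_le _ _).trans (add_le_add
          ((hβperp _ _).trans (mul_le_mul_of_nonneg_left hcoef hC₁.le)) (hB ξ))
    _ ≤ C₀ * (C₁ * (C₂ * ((1 + C₄) * (‖ξ‖ + ‖R‖))) + C₃ * (‖ξ‖ + ‖R‖)) := by
        gcongr
        · nlinarith [norm_nonneg ξ, norm_nonneg R]
        · exact le_add_of_nonneg_right (norm_nonneg R)
    _ = C₀ * (C₁ * (C₂ * (1 + C₄)) + C₃) * (‖ξ‖ + ‖R‖) := by ring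

theorem exists_norm_trendMap_sub_le
    (hdet : SignType.sign (F.core 1).det = SignType.sign (F.core (-1)).det)
    (hdet0 : (F.core 1).det ≠ 0) :
    ∃ C > 0, ∀ v v' : ZSpace m, ‖F.trendMap v - F.trendMap v'‖ ≤ C * ‖v - v'‖ := by
  obtain ⟨C₀, hC₀, hofLp⟩ := exists_norm_le_mul_norm_ofLp (ZIdx m)
  obtain ⟨C₁, hC₁, hβperp⟩ := exists_norm_kinkedMulVec_sub_le fun i j => F.βperp_one_apply_eq i
  obtain ⟨C₂, hC₂, htrendCoef⟩ := F.exists_norm_sub_trendCoef_le hdet hdet0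
  obtain ⟨C₃, hC₃, hαperp⟩ := exists_norm_mulVec_le F.αperpᵀ
  refine ⟨C₀ * (C₁ * (C₂ * C₃)), by positivity, fun v v' => ?_⟩
  have hcore : F.core (F.trendCoef (WithLp.ofLp v) (Sum.inl ())) *ᵥ F.trendCoef (WithLp.ofLp v) -
      F.αperpᵀ *ᵥ WithLp.ofLp v' = F.αperpᵀ *ᵥ WithLp.ofLp (v - v') := by
    rw [core_mulVec_eq_kinkedMulVec, F.kinkedMulVec_core_trendCoef hdet hdet0,
      ← Matrix.mulVec_sub, ← WithLp.ofLp_sub]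
  have hcoef : ‖F.trendCoef (WithLp.ofLp v) - F.trendCoef (WithLp.ofLp v')‖ ≤
      C₂ * (C₃ * ‖v - v'‖) := by
    refine (htrendCoef _ _).trans (mul_le_mul_of_nonneg_left ?_ hC₂.le)
    rw [hcore]
    exact (hαperp _).trans (mul_le_mul_of_nonneg_left (norm_ofLp_le_norm _) hC₃.le)
  calc ‖F.trendMap v - F.trendMap v'‖ ≤ C₀ * (C₁ * (C₂ * (C₃ * ‖v - v'‖))) := by
        refine (hofLp _).trans (mul_le_mul_of_nonneg_left ?_ hC₀.le)
        rw [WithLp.ofLp_sub, F.ofLp_trendMap hdet hdet0, F.ofLp_trendMap hdet hdet0]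
        exact (hβperp _ _).trans (mul_le_mul_of_nonneg_left hcoef hC₁.le)
    _ = C₀ * (C₁ * (C₂ * C₃)) * ‖v - v'‖ := by ring

end TrendMap

end KinkedFactorisation

end CKSVAR

section Maxima

variable {ι E : Type*} [SeminormedAddCommGroup E] {s : Finset ι} {f : ι → E}

theorem toReal_sup_nnnorm_le {x : ℝ} (hx : 0 ≤ x)
    (h : ∀ t ∈ s, ‖f t‖ ≤ x) : NNReal.toReal (s.sup fun t => ‖f t‖₊) ≤ x := by
  lift x to ℝ≥0 using hx
  exact NNReal.coe_le_coe.2 (Finset.sup_le h)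

theorem norm_le_toReal_sup_nnnorm {t : ι} (ht : t ∈ s) :
    ‖f t‖ ≤ NNReal.toReal (s.sup fun t => ‖f t‖₊) :=
  NNReal.coe_le_coe.2 (Finset.le_sup (f := fun t => ‖f t‖₊) ht)

end Maxima

section ZStar

variable {m : ℕ}

theorem zStar_smul {a : ℝ} (ha : 0 ≤ a) (z : ZSpace m) : zStar (a • z) = a • zStar z := by
  simp only [CKSVAR.zStar_eq_kinkedMulVec, WithLp.ofLp_smul, kinkedMulVec_smul _ _ _ ha]

theorem norm_zStar_sub_le (z z' : ZSpace m) : ‖zStar z - zStar z'‖ ≤ ‖z - z'‖ := by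
  have hy : |yPart z - yPart z'| ≤ ‖z - z'‖ := PiLp.norm_apply_le (z - z') (Sum.inl ())
  refine (pi_norm_le_iff_of_nonneg (norm_nonneg _)).2 fun i => ?_
  rcases i with _ | _ | j
  · exact (abs_max_sub_max_le_abs _ _ _).trans hy
  · refine (abs_min_sub_min_le_max _ _ _ _).trans (max_le hy ?_)
    rw [sub_self, abs_zero]
    exact norm_nonneg _
  · exact PiLp.norm_apply_le (z - z') (Sum.inr j)

theorem continuous_zStar : Continuous (zStar : ZSpace m → ZStarIdx m → ℝ) :=
  (LipschitzWith.of_dist_le_mul (K := 1) fun z z' => by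
    rw [dist_eq_norm, dist_eq_norm, NNReal.coe_one, one_mul]
    exact norm_zStar_sub_le z z').continuous

end ZStar

namespace CKSVAR

variable {m k : ℕ} {M : CKSVAR m k}

section PathwiseBounds

theorem IsCanonical.exists_norm_sub_le_zStar (h : M.IsCanonical) :
    ∃ C > 0, ∀ z z' : ZSpace m, ‖z - z'‖ ≤ C * ‖zStar z - zStar z'‖ := by
  obtain ⟨C, hC, hofLp⟩ := exists_norm_le_mul_norm_ofLp (ZIdx m)
  obtain ⟨K, hK, hmul⟩ := exists_norm_mulVec_le (M.PhiStar 0)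
  refine ⟨C * K, by positivity, fun z z' => (hofLp _).trans ?_⟩
  rw [WithLp.ofLp_sub, ← h.mulVec_zStar, ← h.mulVec_zStar, ← Matrix.mulVec_sub, mul_assoc]
  exact mul_le_mul_of_nonneg_left (hmul _) hC.le

theorem GammaOne_mulVec_eq_kinkedMulVec (z : ZSpace m) :
    M.GammaOne (yPart z) *ᵥ WithLp.ofLp z =
      kinkedMulVec (M.GammaOne 1) (M.GammaOne (-1)) (Sum.inl ()) (WithLp.ofLp z) := by
  rw [GammaOne_eq_ite]
  rfl

theorem GammaOne_mulVec_smul {a : ℝ} (ha : 0 ≤ a) (z : ZSpace m) :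
    M.GammaOne (yPart (a • z)) *ᵥ WithLp.ofLp (a • z) =
      a • M.GammaOne (yPart z) *ᵥ WithLp.ofLp z := by
  rw [GammaOne_mulVec_eq_kinkedMulVec, GammaOne_mulVec_eq_kinkedMulVec, WithLp.ofLp_smul,
    kinkedMulVec_smul _ _ _ ha]

variable (M) in
theorem exists_norm_GammaOne_mulVec_sub_le :
    ∃ C > 0, ∀ z z' : ZSpace m, ‖M.GammaOne (yPart z) *ᵥ WithLp.ofLp z -
      M.GammaOne (yPart z') *ᵥ WithLp.ofLp z'‖ ≤ C * ‖z - z'‖ := by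
  have hcol (i : ZIdx m) : ∀ j ≠ Sum.inl (), M.GammaOne 1 i j = M.GammaOne (-1) i j := by
    rintro (_ | j) hj
    · exact absurd rfl hj
    · exact M.GammaOne_apply_inr _ _ i j
  obtain ⟨C, hC, hkink⟩ := exists_norm_kinkedMulVec_sub_le hcol
  refine ⟨C, hC, fun z z' => ?_⟩
  rw [GammaOne_mulVec_eq_kinkedMulVec, GammaOne_mulVec_eq_kinkedMulVec]
  exact (hkink _ _).trans (mul_le_mul_of_nonneg_left (norm_ofLp_le_norm (z - z')) hC.le)

namespace KinkedFactorisation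

variable {r d : ℕ} (F : M.KinkedFactorisation r d)

theorem eqError_smul {a : ℝ} (ha : 0 ≤ a) (z : ZSpace m) :
    F.eqError (a • z) = a • F.eqError z := by
  apply WithLp.ofLp_injective 2
  rw [WithLp.ofLp_smul, ofLp_eqError, ofLp_eqError, zStar_smul ha, Matrix.mulVec_smul]

theorem continuous_eqError : Continuous F.eqError := by
  have heq : F.eqError = fun z => WithLp.toLp 2 (F.βStar *ᵥ zStar z) :=
    funext fun z => WithLp.ofLp_injective 2 (F.ofLp_eqError z)
  rw [heq]
  exact (PiLp.continuous_toLp 2 _).comp (continuous_const.matrix_mulVec continuous_zStar)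

/-- The size of the initial conditions of a path: it dominates the initial state, and involves
nothing beyond the equilibrium error and the increments. -/
noncomputable def initialSize (z : ℤ → ZSpace m) : ℝ :=
  ‖F.eqError (z 0)‖ + ∑ j ∈ Finset.range (k - 1), ‖z (-(j : ℤ)) - z (-(j : ℤ) - 1)‖

theorem norm_state_zero_le (z : ℤ → ZSpace m) : ‖F.state z 0‖ ≤ F.initialSize z := by
  have hsum : 0 ≤ ∑ j ∈ Finset.range (k - 1), ‖z (-(j : ℤ)) - z (-(j : ℤ) - 1)‖ :=
    Finset.sum_nonneg fun j _ => norm_nonneg _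
  refine (pi_norm_le_iff_of_nonneg (add_nonneg (norm_nonneg _) hsum)).2 fun i => ?_
  rcases i with i | ⟨j, s⟩
  · exact (PiLp.norm_apply_le (F.eqError (z 0)) i).trans (le_add_of_nonneg_right hsum)
  · have hlag : F.state z 0 (Sum.inr (j, s)) =
        (zStar (z (-(j : ℤ))) - zStar (z (-(j : ℤ) - 1))) s := by
      simp [state, lagIncrements]
    calc ‖F.state z 0 (Sum.inr (j, s))‖ ≤ ‖z (-(j : ℤ)) - z (-(j : ℤ) - 1)‖ := by
          rw [hlag]
          exact (norm_le_pi_norm _ s).trans (norm_zStar_sub_le _ _)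
      _ ≤ ∑ j ∈ Finset.range (k - 1), ‖z (-(j : ℤ)) - z (-(j : ℤ) - 1)‖ :=
          Finset.single_le_sum (f := fun j : ℕ => ‖z (-(j : ℤ)) - z (-(j : ℤ) - 1)‖)
            (fun j _ => norm_nonneg _) (Finset.mem_range.2 j.2)
      _ ≤ F.initialSize z := le_add_of_nonneg_left (norm_nonneg _)

theorem initialSize_nonneg (z : ℤ → ZSpace m) : 0 ≤ F.initialSize z :=
  (norm_nonneg _).trans (F.norm_state_zero_le z)

/-- The bound, up to constants, on the equilibrium error and on the increments of a path up to time
`n`: the size of its initial conditions and of the largest error. The summand `1` accounts for the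
intercept of the model. -/
noncomputable def pathSize (u : ℕ → ZSpace m) (z : ℤ → ZSpace m) (n : ℕ) : ℝ :=
  F.initialSize z + 1 + NNReal.toReal ((Finset.Icc 1 n).sup fun t => ‖u t‖₊)

theorem pathSize_nonneg (u : ℕ → ZSpace m) (z : ℤ → ZSpace m) (n : ℕ) : 0 ≤ F.pathSize u z n :=
  add_nonneg (add_nonneg (F.initialSize_nonneg z) zero_le_one) (NNReal.coe_nonneg _)

theorem norm_ofLp_eqError_le_state (z : ℤ → ZSpace m) (t : ℤ) :
    ‖WithLp.ofLp (F.eqError (z t))‖ ≤ ‖F.state z t‖ :=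
  (pi_norm_le_iff_of_nonneg (norm_nonneg _)).2 fun i => norm_le_pi_norm (F.state z t) (Sum.inl i)

theorem norm_zStar_sub_prev_le_state (hk : 2 ≤ k) (z : ℤ → ZSpace m) (t : ℤ) :
    ‖zStar (z t) - zStar (z (t - 1))‖ ≤ ‖F.state z t‖ := by
  refine (pi_norm_le_iff_of_nonneg (norm_nonneg _)).2 fun s => ?_
  simpa [state, lagIncrements] using
    norm_le_pi_norm (F.state z t) (Sum.inr (⟨0, by omega⟩, s))

theorem exists_norm_state_le_pathSize (h : M.IsCanonical)
    (hjsr : jointSpectralRadius {1 + F.boldβT 1 * F.boldα, 1 + F.boldβT (-1) * F.boldα} < 1) :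
    ∃ C > 0, ∀ (u : ℕ → ZSpace m) (z : ℤ → ZSpace m), M.Generates u z →
      ∀ n t : ℕ, t ≤ n → ‖F.state z t‖ ≤ C * F.pathSize u z n := by
  obtain ⟨C, hC, hstate⟩ := F.exists_norm_state_le h hjsr
  refine ⟨C, hC, fun u z hz n t ht =>
    (hstate u z hz n _ (NNReal.coe_nonneg _) (fun _ => norm_le_toReal_sup_nnnorm) t ht).trans ?_⟩
  rw [pathSize]
  gcongr
  exact F.norm_state_zero_le z

theorem exists_norm_eqError_le (h : M.IsCanonical)
    (hjsr : jointSpectralRadius {1 + F.boldβT 1 * F.boldα, 1 + F.boldβT (-1) * F.boldα} < 1) :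
    ∃ C > 0, ∀ (u : ℕ → ZSpace m) (z : ℤ → ZSpace m), M.Generates u z →
      ∀ n t : ℕ, t ≤ n → ‖F.eqError (z t)‖ ≤ C * F.pathSize u z n := by
  obtain ⟨C, hC, hstate⟩ := F.exists_norm_state_le_pathSize h hjsr
  obtain ⟨K, hK, hofLp⟩ := exists_norm_le_mul_norm_ofLp (Fin r)
  refine ⟨K * C, by positivity, fun u z hz n t ht => (hofLp _).trans ?_⟩
  rw [mul_assoc]
  exact mul_le_mul_of_nonneg_left
    ((F.norm_ofLp_eqError_le_state z t).trans (hstate u z hz n t ht)) hK.le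

theorem exists_norm_sub_prev_le (hk : 2 ≤ k) (h : M.IsCanonical)
    (hjsr : jointSpectralRadius {1 + F.boldβT 1 * F.boldα, 1 + F.boldβT (-1) * F.boldα} < 1) :
    ∃ C > 0, ∀ (u : ℕ → ZSpace m) (z : ℤ → ZSpace m), M.Generates u z →
      ∀ n t : ℕ, t ≤ n → ‖z t - z (t - 1)‖ ≤ C * F.pathSize u z n := by
  obtain ⟨C, hC, hstate⟩ := F.exists_norm_state_le_pathSize h hjsr
  obtain ⟨K, hK, hzStar⟩ := h.exists_norm_sub_le_zStar
  refine ⟨K * C, by positivity, fun u z hz n t ht => (hzStar _ _).trans ?_⟩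
  rw [mul_assoc]
  exact mul_le_mul_of_nonneg_left
    ((F.norm_zStar_sub_prev_le_state hk z t).trans (hstate u z hz n t ht)) hK.le

theorem exists_norm_αperp_mulVec_sub_le (h : M.IsCanonical) (hc : ∃ v, M.Pi 1 *ᵥ v = M.c) :
    ∃ C > 0, ∀ (u : ℕ → ZSpace m) (z : ℤ → ZSpace m), M.Generates u z →
      ∀ (t : ℕ) (a : ℝ), 0 ≤ a → ∀ Z₀ : ZSpace m,
        ‖F.αperpᵀ *ᵥ (M.GammaOne (yPart (a • z t)) *ᵥ WithLp.ofLp (a • z t) -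
          WithLp.ofLp (act (M.GammaOne (yPart Z₀)) Z₀ + a • ∑ s ∈ Finset.Icc 1 t, u s))‖ ≤
            C * (a * (‖F.state z t‖ + ‖F.state z 0‖) + ‖a • z 0 - Z₀‖) := by
  obtain ⟨C₁, hC₁, htrend⟩ := F.exists_commonTrend_remainder_le h hc
  obtain ⟨C₂, hC₂, hΓ⟩ := M.exists_norm_GammaOne_mulVec_sub_le
  obtain ⟨C₃, hC₃, hαperp⟩ := exists_norm_mulVec_le F.αperpᵀ
  refine ⟨C₁ + C₃ * C₂, by positivity, fun u z hz t a ha Z₀ => ?_⟩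
  set N := ‖F.state z t‖ + ‖F.state z 0‖
  set D := ‖a • z 0 - Z₀‖
  have hsplit : M.GammaOne (yPart (a • z t)) *ᵥ WithLp.ofLp (a • z t) -
      WithLp.ofLp (act (M.GammaOne (yPart Z₀)) Z₀ + a • ∑ s ∈ Finset.Icc 1 t, u s) =
      a • (M.GammaOne (yPart (z t)) *ᵥ WithLp.ofLp (z t) -
        (M.GammaOne (yPart (z 0)) *ᵥ WithLp.ofLp (z 0) +
          WithLp.ofLp (∑ s ∈ Finset.Icc 1 t, u s))) +
      (M.GammaOne (yPart (a • z 0)) *ᵥ WithLp.ofLp (a • z 0) -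
        M.GammaOne (yPart Z₀) *ᵥ WithLp.ofLp Z₀) := by
    rw [GammaOne_mulVec_smul ha, GammaOne_mulVec_smul ha, WithLp.ofLp_add, WithLp.ofLp_smul, act]
    module
  rw [hsplit, Matrix.mulVec_add, Matrix.mulVec_smul]
  calc _ ≤ a * (C₁ * N) + C₃ * (C₂ * D) := by
        refine (norm_add_le _ _).trans (add_le_add ?_ ?_)
        · rw [norm_smul, Real.norm_of_nonneg ha]
          exact mul_le_mul_of_nonneg_left (htrend u z hz t) ha
        · exact (hαperp _).trans (mul_le_mul_of_nonneg_left (hΓ _ _) hC₃.le)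
    _ ≤ (C₁ + C₃ * C₂) * (a * N + D) := by
        have hcross : 0 ≤ C₁ * D + C₃ * C₂ * (a * N) := by positivity
        linarith

theorem exists_norm_smul_sub_trendMap_le (h : M.IsCanonical) (hc : ∃ v, M.Pi 1 *ᵥ v = M.c)
    (hjsr : jointSpectralRadius {1 + F.boldβT 1 * F.boldα, 1 + F.boldβT (-1) * F.boldα} < 1)
    (hdet : SignType.sign (F.core 1).det = SignType.sign (F.core (-1)).det)
    (hdet0 : (F.core 1).det ≠ 0) :
    ∃ C > 0, ∀ (u : ℕ → ZSpace m) (z : ℤ → ZSpace m), M.Generates u z →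
      ∀ n t : ℕ, t ≤ n → ∀ a : ℝ, 0 ≤ a → ∀ Z₀ : ZSpace m,
        ‖a • z t - F.trendMap (act (M.GammaOne (yPart Z₀)) Z₀ + a • ∑ s ∈ Finset.Icc 1 t, u s)‖ ≤
          C * (a * F.pathSize u z n + ‖a • z 0 - Z₀‖) := by
  obtain ⟨C₁, hC₁, hstate⟩ := F.exists_norm_state_le_pathSize h hjsr
  obtain ⟨C₂, hC₂, hinv⟩ := F.exists_norm_sub_trendMap_le hdet hdet0
  obtain ⟨C₃, hC₃, hαperp⟩ := F.exists_norm_αperp_mulVec_sub_le h hc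
  refine ⟨C₂ * (C₁ + C₃ * (2 * C₁ + 1)), by positivity, fun u z hz n t ht a ha Z₀ => ?_⟩
  set B := F.pathSize u z n
  set D := ‖a • z 0 - Z₀‖
  have hB : 0 ≤ B := F.pathSize_nonneg u z n
  have hξ : ‖WithLp.ofLp (F.eqError (a • z t))‖ ≤ a * (C₁ * B) := by
    rw [F.eqError_smul ha, WithLp.ofLp_smul, norm_smul, Real.norm_of_nonneg ha]
    exact mul_le_mul_of_nonneg_left
      ((F.norm_ofLp_eqError_le_state z t).trans (hstate u z hz n t ht)) ha
  have hstates : ‖F.state z t‖ + ‖F.state z 0‖ ≤ 2 * C₁ * B := by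
    have h0 := hstate u z hz n 0 n.zero_le
    have ht := hstate u z hz n t ht
    rw [Nat.cast_zero] at h0
    linarith
  calc _ ≤ C₂ * (a * (C₁ * B) + C₃ * (a * (2 * C₁ * B) + D)) := by
        refine (hinv _ _).trans (mul_le_mul_of_nonneg_left (add_le_add hξ ?_) hC₂.le)
        refine (hαperp u z hz t a ha Z₀).trans (mul_le_mul_of_nonneg_left ?_ hC₃.le)
        exact add_le_add_left (mul_le_mul_of_nonneg_left hstates ha) D
    _ ≤ C₂ * (C₁ + C₃ * (2 * C₁ + 1)) * (a * B + D) := by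
        have hcross : 0 ≤ C₂ * (C₁ * D + C₃ * (2 * C₁ * D + a * B)) := by positivity
        linarith

end KinkedFactorisation

end PathwiseBounds

end CKSVAR

namespace CadlagPath

variable {E F : Type*} [PseudoEMetricSpace E] [PseudoEMetricSpace F]

theorem edist_le {f g : CadlagPath E} {C : ℝ≥0∞} : edist f g ≤ C ↔ ∀ s, edist (f s) (g s) ≤ C :=
  UniformFun.edist_le

/-- Composition of a cadlag path with a continuous map; this is how the limit process of the
theorem is obtained from the driving Brownian motion. -/
def map (G : E → F) (hG : Continuous G) (f : CadlagPath E) : CadlagPath F :=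
  ⟨UniformFun.ofFun fun s => G (f s), fun t => by
    obtain ⟨hright, l, hleft⟩ := f.2 t
    exact ⟨hG.continuousAt.comp_continuousWithinAt hright, G l, (hG.tendsto l).comp hleft⟩⟩

theorem map_apply (G : E → F) (hG : Continuous G) (f : CadlagPath E) (s : I) :
    map G hG f s = G (f s) := rfl

theorem lipschitzWith_map {K : ℝ≥0} {G : E → F} (hG : LipschitzWith K G) :
    LipschitzWith K (map G hG.continuous) := by
  intro f g
  refine edist_le.2 fun s => (hG _ _).trans ?_
  gcongr
  exact edist_le.1 le_rfl s

end CadlagPath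

section StepPath

variable {E : Type*} [PseudoEMetricSpace E]

theorem floor_natCast_mul_le (n : ℕ) (s : I) : ⌊(n : ℝ) * (s : ℝ)⌋₊ ≤ n :=
  Nat.floor_le_of_le (mul_le_of_le_one_right (Nat.cast_nonneg n) s.2.2)

theorem edist_stepPath_le {n : ℕ} {f g : ℕ → E} {C : ℝ≥0∞}
    (h : ∀ j ≤ n, edist (f j) (g j) ≤ C) : edist (stepPath n f) (stepPath n g) ≤ C :=
  CadlagPath.edist_le.2 fun s => h _ (floor_natCast_mul_le n s)

theorem aemeasurable_stepPath [SecondCountableTopology E] [MeasurableSpace E] [BorelSpace E]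
    {Ω : Type*} [MeasurableSpace Ω] {P : Measure Ω} {n : ℕ} {f : ℕ → Ω → E}
    (hf : ∀ j ≤ n, AEMeasurable (f j) P) :
    AEMeasurable (fun ω => stepPath n fun j => f j ω) P := by
  -- The space of cadlag paths is not separable, so measurability is deduced from the continuity
  -- of the step path in its `n + 1` values.
  let φ : (Fin (n + 1) → E) → CadlagPath E := fun x => stepPath n fun j => x (Fin.ofNat (n + 1) j)
  have hφ : Continuous φ := by
    refine LipschitzWith.continuous (K := 1) fun x y => ?_
    rw [ENNReal.coe_one, one_mul]
    exact edist_stepPath_le fun j _ => edist_le_pi_edist x y _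
  have heq : (fun ω => stepPath n fun j => f j ω) = φ ∘ fun ω (i : Fin (n + 1)) => f i ω := by
    funext ω
    refine Subtype.ext (funext fun s => ?_)
    change f _ ω = f (Fin.ofNat (n + 1) _ : Fin (n + 1)) ω
    rw [Fin.val_ofNat, Nat.mod_eq_of_lt (Nat.lt_succ_of_le (floor_natCast_mul_le n s))]
  rw [heq]
  exact hφ.measurable.comp_aemeasurable
    (aemeasurable_pi_lambda _ fun i => hf i (Nat.le_of_lt_succ i.2))

end StepPath

section ConvergenceInDistribution

variable {ι E Ω Ω' : Type*} {l : Filter ι} [PseudoEMetricSpace E] [MeasurableSpace E]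
  [BorelSpace E] [MeasurableSpace Ω] [MeasurableSpace Ω'] {P : Measure Ω} [IsProbabilityMeasure P]
  {P' : Measure Ω'} [IsProbabilityMeasure P'] {X Y : ι → Ω → E} {Z : Ω' → E}

theorem limsup_map_le_map_cthickening (hX : TendstoInDistribution X l Z (fun _ => P) P')
    (hY : ∀ i, AEMeasurable (Y i) P) {ε : ℝ}
    (hXY : Tendsto (fun i => P {ω | ENNReal.ofReal ε < edist (X i ω) (Y i ω)}) l (𝓝 0))
    {F : Set E} (hF : IsClosed F) :
    limsup (fun i => P.map (Y i) F) l ≤ P'.map Z (Metric.cthickening ε F) := by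
  have hle (i : ι) : P.map (Y i) F ≤ P.map (X i) (Metric.cthickening ε F) +
      P {ω | ENNReal.ofReal ε < edist (X i ω) (Y i ω)} := by
    rw [Measure.map_apply_of_aemeasurable (hY i) hF.measurableSet,
      Measure.map_apply_of_aemeasurable (hX.forall_aemeasurable i)
        Metric.isClosed_cthickening.measurableSet]
    refine (measure_mono fun ω hω => ?_).trans (measure_union_le _ _)
    rcases lt_or_ge (ENNReal.ofReal ε) (edist (X i ω) (Y i ω)) with hfar | hnear
    · exact Or.inr hfar
    · exact Or.inl (Metric.mem_cthickening_of_edist_le _ _ _ _ hω hnear)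
  calc limsup (fun i => P.map (Y i) F) l
      ≤ limsup (fun i => P.map (X i) (Metric.cthickening ε F) +
          P {ω | ENNReal.ofReal ε < edist (X i ω) (Y i ω)}) l :=
        limsup_le_limsup (Eventually.of_forall hle)
    _ = limsup (fun i => P.map (X i) (Metric.cthickening ε F)) l :=
        ENNReal.limsup_add_of_right_tendsto_zero hXY _
    _ ≤ P'.map Z (Metric.cthickening ε F) :=
        ProbabilityMeasure.limsup_measure_closed_le_of_tendsto hX.tendsto
          Metric.isClosed_cthickening

theorem tendstoInDistribution_of_edist_le [l.IsCountablyGenerated] {f : ι → Ω → ℝ}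
    (hX : TendstoInDistribution X l Z (fun _ => P) P') (hY : ∀ i, AEMeasurable (Y i) P)
    (hf : TendstoInMeasure P f l fun _ => 0)
    (hXY : ∀ i, ∀ᵐ ω ∂P, edist (X i ω) (Y i ω) ≤ ENNReal.ofReal (f i ω)) :
    TendstoInDistribution Y l Z (fun _ => P) P' where
  forall_aemeasurable := hY
  aemeasurable_limit := hX.aemeasurable_limit
  tendsto := by
    refine tendsto_of_forall_isClosed_limsup_le' fun F hF => ?_
    have hthick {ε : ℝ} (hε : 0 < ε) :
        limsup (fun i => P.map (Y i) F) l ≤ P'.map Z (Metric.cthickening ε F) := by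
      refine limsup_map_le_map_cthickening hX hY ?_ hF
      refine tendsto_of_tendsto_of_tendsto_of_le_of_le tendsto_const_nhds
        (tendstoInMeasure_iff_norm.1 hf ε hε) (fun _ => zero_le) fun i => measure_mono_ae ?_
      filter_upwards [hXY i] with ω hω hfar
      have hlt : ε < f i ω :=
        (ENNReal.ofReal_lt_ofReal_iff_of_nonneg hε.le).1 (lt_of_lt_of_le hfar hω)
      change ε ≤ ‖f i ω - 0‖
      rw [sub_zero]
      exact hlt.le.trans (Real.le_norm_self _)
    have hlim : Tendsto (fun ε => P'.map Z (Metric.cthickening ε F)) (𝓝[>] 0) (𝓝 (P'.map Z F)) :=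
      (tendsto_measure_cthickening_of_isClosed
        ⟨1, one_pos, measure_ne_top _ _⟩ hF).mono_left nhdsWithin_le_nhds
    exact ge_of_tendsto hlim (eventually_nhdsWithin_of_forall fun ε hε => hthick hε)

end ConvergenceInDistribution

section VanishingInProbability

variable {ι Ω : Type*} [MeasurableSpace Ω] {P : Measure Ω} {l : Filter ι}

theorem tendstoInMeasure_zero_of_norm_le {E F : Type*} [SeminormedAddCommGroup E]
    [SeminormedAddCommGroup F] {f : ι → Ω → E} {g : ι → Ω → F} {C : ℝ} (hC : 0 < C)
    (hf : TendstoInMeasure P f l fun _ => 0) (h : ∀ i, ∀ᵐ ω ∂P, ‖g i ω‖ ≤ C * ‖f i ω‖) :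
    TendstoInMeasure P g l fun _ => 0 := by
  rw [tendstoInMeasure_iff_norm] at hf ⊢
  intro ε hε
  refine tendsto_of_tendsto_of_tendsto_of_le_of_le tendsto_const_nhds (hf (ε / C) (by positivity))
    (fun _ => zero_le) fun i => measure_mono_ae ?_
  filter_upwards [h i] with ω hω (hmem : ε ≤ ‖g i ω - 0‖)
  change ε / C ≤ ‖f i ω - 0‖
  rw [sub_zero] at hmem ⊢
  exact (div_le_iff₀' hC).2 (hmem.trans hω)

theorem tendstoInMeasure_add {E : Type*} [SeminormedAddCommGroup E] {f g : ι → Ω → E}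
    {f' g' : Ω → E} (hf : TendstoInMeasure P f l f') (hg : TendstoInMeasure P g l g') :
    TendstoInMeasure P (fun i ω => f i ω + g i ω) l fun ω => f' ω + g' ω := by
  rw [tendstoInMeasure_iff_norm] at hf hg ⊢
  intro ε hε
  have hsum := (hf (ε / 2) (by positivity)).add (hg (ε / 2) (by positivity))
  rw [add_zero] at hsum
  refine tendsto_of_tendsto_of_tendsto_of_le_of_le tendsto_const_nhds hsum (fun _ => zero_le)
    fun i => (measure_mono fun ω (hω : ε ≤ ‖_‖) => ?_).trans (measure_union_le _ _)
  by_contra hcon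
  simp only [Set.mem_union, Set.mem_ofPred_eq, not_or, not_le] at hcon
  rw [add_sub_add_comm] at hω
  linarith [norm_add_le (f i ω - f' ω) (g i ω - g' ω)]

theorem tendstoInMeasure_finsetSum {κ E : Type*} [SeminormedAddCommGroup E] (s : Finset κ)
    {f : κ → ι → Ω → E} {f' : κ → Ω → E} (hf : ∀ j ∈ s, TendstoInMeasure P (f j) l (f' j)) :
    TendstoInMeasure P (fun i ω => ∑ j ∈ s, f j i ω) l fun ω => ∑ j ∈ s, f' j ω := by
  classical
  induction s using Finset.induction_on with
  | empty =>
    refine tendstoInMeasure_iff_norm.2 fun ε hε => ?_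
    simp only [Finset.sum_empty, sub_self, norm_zero, not_le.2 hε, Set.ofPred_false,
      measure_empty, tendsto_const_nhds]
  | insert j s hj ih =>
    simp only [Finset.sum_insert hj]
    exact tendstoInMeasure_add (hf j (Finset.mem_insert_self j s))
      (ih fun i hi => hf i (Finset.mem_insert_of_mem hi))

theorem tendstoInMeasure_inv_sqrt [IsFiniteMeasure P] :
    TendstoInMeasure P (fun (n : ℕ) (_ : Ω) => (√(n : ℝ))⁻¹) atTop fun _ => 0 :=
  tendstoInMeasure_of_tendsto_ae (fun _ => aestronglyMeasurable_const) <| ae_of_all _ fun _ =>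
    tendsto_inv_atTop_zero.comp (Real.tendsto_sqrt_atTop.comp tendsto_natCast_atTop_atTop)

end VanishingInProbability

section Moments

variable {Ω E : Type*} [MeasurableSpace Ω] {P : Measure Ω}

theorem measure_le_sup_nnnorm_le {ι : Type*} [SeminormedAddCommGroup E] (P : Measure Ω)
    (s : Finset ι) (w : ι → Ω → E) {x : ℝ} (hx : 0 < x) :
    P {ω | x ≤ NNReal.toReal (s.sup fun t => ‖w t ω‖₊)} ≤ ∑ t ∈ s, P {ω | x ≤ ‖w t ω‖} := by
  refine (measure_mono fun ω hω => ?_).trans (measure_biUnion_finset_le s _)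
  lift x to ℝ≥0 using hx.le
  obtain ⟨t, ht, hle⟩ := (Finset.le_sup_iff (NNReal.coe_pos.1 hx)).1 (NNReal.coe_le_coe.1 hω)
  exact Set.mem_biUnion ht (NNReal.coe_le_coe.2 hle)

theorem measure_le_norm_le_of_eLpNorm_le [SeminormedAddCommGroup E] {f : Ω → E} {p : ℝ}
    (hp : 0 < p) {C : ℝ≥0} (hf : AEStronglyMeasurable f P)
    (hC : eLpNorm f (ENNReal.ofReal p) P ≤ C) {x : ℝ} (hx : 0 < x) :
    P {ω | x ≤ ‖f ω‖} ≤ ENNReal.ofReal ((C / x) ^ p) := by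
  have hset : {ω | x ≤ ‖f ω‖} = {ω | ENNReal.ofReal x ≤ ‖f ω‖ₑ} := by
    ext ω
    simp only [Set.mem_ofPred_eq]
    rw [← ofReal_norm, ENNReal.ofReal_le_ofReal_iff (norm_nonneg _)]
  have hx' : ENNReal.ofReal x ≠ 0 := (ENNReal.ofReal_pos.2 hx).ne'
  calc P {ω | x ≤ ‖f ω‖}
      ≤ (ENNReal.ofReal x)⁻¹ ^ p * eLpNorm f (ENNReal.ofReal p) P ^ p := by
        have hmarkov := meas_ge_le_mul_pow_eLpNorm_enorm P (ENNReal.ofReal_pos.2 hp).ne'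
          ENNReal.ofReal_ne_top hf hx' fun h => absurd h ENNReal.ofReal_ne_top
        rwa [ENNReal.toReal_ofReal hp.le, ← hset] at hmarkov
    _ ≤ (ENNReal.ofReal x)⁻¹ ^ p * (C : ℝ≥0∞) ^ p := by gcongr
    _ = ENNReal.ofReal ((C / x) ^ p) := by
        rw [← ENNReal.mul_rpow_of_nonneg _ _ hp.le,
          ← ENNReal.ofReal_rpow_of_nonneg (by positivity) hp.le, div_eq_inv_mul,
          ENNReal.ofReal_mul (by positivity), ENNReal.ofReal_inv_of_pos hx,
          ENNReal.ofReal_coe_nnreal]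

theorem tendsto_natCast_mul_rpow_zero {c : ℝ} (hc : 0 ≤ c) {p : ℝ} (hp : 2 < p) :
    Tendsto (fun n : ℕ => (n : ℝ) * (c / √n) ^ p) atTop (𝓝 0) := by
  have hpow : Tendsto (fun n : ℕ => c ^ p * (n : ℝ) ^ (-(p / 2 - 1))) atTop (𝓝 0) := by
    have hp' : 0 < p / 2 - 1 := by linarith
    have hrpow := (tendsto_rpow_neg_atTop hp').comp (tendsto_natCast_atTop_atTop (R := ℝ))
    simpa only [Function.comp_def, mul_zero] using hrpow.const_mul (c ^ p)
  refine hpow.congr' ?_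
  filter_upwards [eventually_gt_atTop 0] with n hn
  have hn' : (0 : ℝ) < n := Nat.cast_pos.2 hn
  rw [Real.div_rpow hc (Real.sqrt_nonneg _), Real.sqrt_eq_rpow, ← Real.rpow_mul hn'.le, neg_sub,
    Real.rpow_sub hn', Real.rpow_one, one_div_mul_eq_div, mul_div_left_comm]

variable [NormedAddCommGroup E]

theorem isStarStationary_of_eLpNorm_le {w : ℕ → ℕ → Ω → E} {p : ℝ} (hp : 2 < p) {C : ℝ≥0}
    (hw : ∀ n, ∀ t, 1 ≤ t → AEStronglyMeasurable (w n t) P)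
    (hC : ∀ n, ∀ t, 1 ≤ t → eLpNorm (w n t) (ENNReal.ofReal p) P ≤ C) :
    IsStarStationary P w := by
  rw [IsStarStationary, tendstoInMeasure_iff_norm]
  intro ε hε
  have hlim : Tendsto (fun n : ℕ => ENNReal.ofReal ((n : ℝ) * ((C / ε) / √n) ^ p)) atTop
      (𝓝 0) := by
    simpa only [ENNReal.ofReal_zero] using
      ENNReal.tendsto_ofReal (tendsto_natCast_mul_rpow_zero (c := C / ε) (by positivity) hp)
  refine tendsto_of_tendsto_of_tendsto_of_le_of_le' tendsto_const_nhds hlim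
    (Eventually.of_forall fun n => zero_le) ?_
  filter_upwards [eventually_gt_atTop 0] with n hn
  have hsqrt : 0 < √(n : ℝ) := Real.sqrt_pos.2 (Nat.cast_pos.2 hn)
  have hterm : ∀ t ∈ Finset.Icc 1 n,
      P {ω | ε * √n ≤ ‖w n t ω‖} ≤ ENNReal.ofReal (((C / ε) / √n) ^ p) := by
    intro t ht
    have ht' := (Finset.mem_Icc.1 ht).1
    rw [div_div]
    exact measure_le_norm_le_of_eLpNorm_le (by linarith) (hw n t ht') (hC n t ht')
      (mul_pos hε hsqrt)
  calc P {ω | ε ≤ ‖(√(n : ℝ))⁻¹ *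
        NNReal.toReal ((Finset.Icc 1 n).sup fun t => ‖w n t ω‖₊) - 0‖}
      = P {ω | ε * √n ≤ NNReal.toReal ((Finset.Icc 1 n).sup fun t => ‖w n t ω‖₊)} := by
        congr 1 with ω
        rw [Set.mem_ofPred_eq, Set.mem_ofPred_eq, sub_zero, Real.norm_of_nonneg (by positivity),
          le_inv_mul_iff₀' hsqrt]
    _ ≤ ∑ t ∈ Finset.Icc 1 n, P {ω | ε * √n ≤ ‖w n t ω‖} :=
        measure_le_sup_nnnorm_le P _ (w n) (mul_pos hε hsqrt)
    _ ≤ ∑ _ ∈ Finset.Icc 1 n, ENNReal.ofReal (((C / ε) / √n) ^ p) := Finset.sum_le_sum hterm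
    _ = ENNReal.ofReal ((n : ℝ) * ((C / ε) / √n) ^ p) := by
        rw [Finset.sum_const, Nat.card_Icc, Nat.add_sub_cancel, nsmul_eq_mul,
          ENNReal.ofReal_mul (Nat.cast_nonneg n), ENNReal.ofReal_natCast]

theorem tendstoInMeasure_inv_sqrt_mul_norm {f : ℕ → Ω → E} {p : ℝ} (hp : 2 < p) {C : ℝ≥0}
    (hf : ∀ n, AEStronglyMeasurable (f n) P)
    (hC : ∀ n, eLpNorm (f n) (ENNReal.ofReal p) P ≤ C) :
    TendstoInMeasure P (fun (n : ℕ) ω => (√(n : ℝ))⁻¹ * ‖f n ω‖) atTop fun _ => 0 := by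
  refine tendstoInMeasure_zero_of_norm_le one_pos
    (isStarStationary_of_eLpNorm_le (w := fun n _ => f n) hp (fun n _ _ => hf n) fun n _ _ => hC n)
    fun n => ae_of_all _ fun ω => ?_
  rcases Nat.eq_zero_or_pos n with rfl | hn
  · simp
  · rw [Finset.sup_const ⟨1, Finset.mem_Icc.2 ⟨le_rfl, hn⟩⟩, coe_nnnorm, one_mul]

theorem isStarStationary_of_norm_le {w : ℕ → ℕ → Ω → E} {B : ℕ → Ω → ℝ} {C : ℝ} (hC : 0 < C)
    (hB : TendstoInMeasure P (fun (n : ℕ) ω => (√(n : ℝ))⁻¹ * B n ω) atTop fun _ => 0)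
    (h : ∀ n, ∀ᵐ ω ∂P, ∀ t ≤ n, ‖w n t ω‖ ≤ C * B n ω) : IsStarStationary P w := by
  refine tendstoInMeasure_zero_of_norm_le hC hB fun n => ?_
  filter_upwards [h n] with ω hω
  have hB0 : 0 ≤ C * B n ω := (norm_nonneg _).trans (hω n le_rfl)
  have hsup := toReal_sup_nnnorm_le (s := Finset.Icc 1 n) (f := fun t => w n t ω) hB0
    fun t ht => hω t (Finset.mem_Icc.1 ht).2
  rw [norm_mul, norm_mul, Real.norm_of_nonneg (NNReal.coe_nonneg _), mul_left_comm,
    Real.norm_of_nonneg (nonneg_of_mul_nonneg_right hB0 hC)]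
  exact mul_le_mul_of_nonneg_left hsup (norm_nonneg _)

end Moments

namespace CKSVAR

variable {m k : ℕ} {M : CKSVAR m k} {Ω : Type*} [MeasurableSpace Ω] {P : Measure Ω}

theorem aemeasurable_of_generates (hcanon : M.IsCanonical) {u : ℕ → Ω → ZSpace m}
    {z : ℤ → Ω → ZSpace m} (hu : ∀ t, 1 ≤ t → AEMeasurable (u t) P)
    (hz : ∀ t : ℤ, -(k : ℤ) + 1 ≤ t → t ≤ 0 → AEMeasurable (z t) P)
    (hgen : ∀ᵐ ω ∂P, M.Generates (fun t => u t ω) (fun t => z t ω)) (t : ℕ) :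
    ∀ s : ℤ, -(k : ℤ) + 1 ≤ s → s ≤ t → AEMeasurable (z s) P := by
  induction t with
  | zero => exact hz
  | succ t ih =>
    intro s hs hs'
    rcases lt_or_eq_of_le hs' with hlt | rfl
    · exact ih s hs (by push_cast at hlt; omega)
    have hrhs : AEMeasurable (fun ω => WithLp.toLp 2 (M.c +
        ∑ i ∈ Finset.Icc 1 k, M.PhiStar i *ᵥ zStar (z (((t + 1 : ℕ) : ℤ) - (i : ℤ)) ω) +
          WithLp.ofLp (u (t + 1) ω)) : Ω → ZSpace m) P := by
      refine (PiLp.continuous_toLp 2 _).measurable.comp_aemeasurable ?_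
      refine AEMeasurable.add (AEMeasurable.const_add ?_ _)
        ((PiLp.continuous_ofLp 2 _).measurable.comp_aemeasurable (hu (t + 1) (by omega)))
      refine Finset.aemeasurable_fun_sum _ fun i hi => ?_
      have hlag := Finset.mem_Icc.1 hi
      exact (continuous_const.matrix_mulVec continuous_zStar).measurable.comp_aemeasurable
        (ih _ (by push_cast; omega) (by push_cast; omega))
    refine hrhs.congr ?_
    filter_upwards [hgen] with ω hω
    apply WithLp.ofLp_injective 2
    rw [← hcanon.mulVec_zStar (z _ ω)]
    exact (hω (t + 1) (by omega)).symm

theorem KinkedFactorisation.tendstoInMeasure_initialSize {r d : ℕ} (F : M.KinkedFactorisation r d)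
    (hk : 0 < k) {z : ℕ → ℤ → Ω → ZSpace m} {p : ℝ} (hp : 2 < p) {C : ℝ≥0}
    (hz : ∀ n, ∀ t : ℤ, -(k : ℤ) + 1 ≤ t → t ≤ 0 → AEMeasurable (z n t) P)
    (herror : ∀ n, eLpNorm (fun ω => F.eqError (z n 0 ω)) (ENNReal.ofReal p) P ≤ C)
    (hincrement : ∀ n, ∀ t : ℤ, -(k : ℤ) + 2 ≤ t → t ≤ 0 →
      eLpNorm (fun ω => z n t ω - z n (t - 1) ω) (ENNReal.ofReal p) P ≤ C) :
    TendstoInMeasure P (fun (n : ℕ) ω => (√(n : ℝ))⁻¹ * F.initialSize fun t => z n t ω) atTop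
      fun _ => 0 := by
  have hξ : TendstoInMeasure P (fun (n : ℕ) ω => (√(n : ℝ))⁻¹ * ‖F.eqError (z n 0 ω)‖) atTop
      fun _ => 0 :=
    tendstoInMeasure_inv_sqrt_mul_norm hp
      (fun n => (F.continuous_eqError.measurable.comp_aemeasurable
        (hz n 0 (by omega) le_rfl)).aestronglyMeasurable) herror
  have hΔ := tendstoInMeasure_finsetSum (P := P) (l := atTop) (Finset.range (k - 1))
    (f := fun j (n : ℕ) ω => (√(n : ℝ))⁻¹ * ‖z n (-(j : ℤ)) ω - z n (-(j : ℤ) - 1) ω‖)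
    (f' := fun _ _ => 0) fun j hj => by
      have hj' := Finset.mem_range.1 hj
      exact tendstoInMeasure_inv_sqrt_mul_norm hp
        (fun n => ((hz n _ (by omega) (by omega)).sub
          (hz n _ (by omega) (by omega))).aestronglyMeasurable)
        fun n => hincrement n (-(j : ℤ)) (by omega) (by omega)
  simpa only [initialSize, mul_add, Finset.mul_sum, Finset.sum_const_zero, add_zero] using
    tendstoInMeasure_add hξ hΔ

end CKSVAR

namespace CKSVAR.KinkedFactorisation

variable {m k r d : ℕ} {M : CKSVAR m k} (F : M.KinkedFactorisation r d)
  {Ω Ω' : Type*} [MeasurableSpace Ω] [MeasurableSpace Ω'] {P : Measure Ω} [IsProbabilityMeasure P]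
  {P' : Measure Ω'} [IsProbabilityMeasure P'] {u : ℕ → Ω → ZSpace m} {z : ℕ → ℤ → Ω → ZSpace m}

theorem tendstoInMeasure_pathSize (hustar : IsStarStationary P fun _ t ω => u t ω)
    (hinit : TendstoInMeasure P
      (fun (n : ℕ) ω => (√(n : ℝ))⁻¹ * F.initialSize fun t => z n t ω) atTop fun _ => 0) :
    TendstoInMeasure P
      (fun (n : ℕ) ω => (√(n : ℝ))⁻¹ * F.pathSize (fun t => u t ω) (fun t => z n t ω) n) atTop
      fun _ => 0 := by
  simpa only [pathSize, mul_add, mul_one, add_zero] using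
    tendstoInMeasure_add (tendstoInMeasure_add hinit tendstoInMeasure_inv_sqrt) hustar

/-- The map from the limit of the scaled partial sums of the errors to the limit of the scaled
process started at `Z₀`. -/
noncomputable def limitMap (Z₀ v : ZSpace m) : ZSpace m :=
  F.trendMap (act (M.GammaOne (yPart Z₀)) Z₀ + v)

theorem exists_lipschitzWith_limitMap
    (hdet : SignType.sign (F.core 1).det = SignType.sign (F.core (-1)).det)
    (hdet0 : (F.core 1).det ≠ 0) (Z₀ : ZSpace m) : ∃ K, LipschitzWith K (F.limitMap Z₀) := by
  obtain ⟨K, hK, hlip⟩ := F.exists_norm_trendMap_sub_le hdet hdet0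
  refine ⟨⟨K, hK.le⟩, LipschitzWith.of_dist_le_mul fun v v' => ?_⟩
  rw [dist_eq_norm, dist_eq_norm]
  refine (hlip _ _).trans_eq ?_
  rw [add_sub_add_left_eq_sub]
  rfl

theorem tendstoInDistribution_stepPath (hk : 0 < k) (hcanon : M.IsCanonical)
    (hu : ∀ t, 1 ≤ t → AEMeasurable (u t) P)
    (hz : ∀ n, ∀ t : ℤ, -(k : ℤ) + 1 ≤ t → t ≤ 0 → AEMeasurable (z n t) P)
    (hgen : ∀ n, ∀ᵐ ω ∂P, M.Generates (fun t => u t ω) (fun t => z n t ω))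
    (hustar : IsStarStationary P fun _ t ω => u t ω) {U : Ω' → CadlagPath (ZSpace m)}
    (hUn : TendstoInDistribution
      (fun (n : ℕ) ω => stepPath n fun j => (√(n : ℝ))⁻¹ • ∑ t ∈ Finset.Icc 1 j, u t ω)
      atTop U (fun _ => P) P')
    (hcpos : ∃ v, M.Pi 1 *ᵥ v = M.c)
    (hjsr : jointSpectralRadius {1 + F.boldβT 1 * F.boldα, 1 + F.boldβT (-1) * F.boldα} < 1)
    (hdet : SignType.sign (F.core 1).det = SignType.sign (F.core (-1)).det)
    (hdet0 : (F.core 1).det ≠ 0)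
    (hinit : TendstoInMeasure P
      (fun (n : ℕ) ω => (√(n : ℝ))⁻¹ * F.initialSize fun t => z n t ω) atTop fun _ => 0)
    {Z₀ : ZSpace m}
    (hinit₀ : TendstoInMeasure P (fun (n : ℕ) ω => (√(n : ℝ))⁻¹ • z n 0 ω) atTop fun _ => Z₀)
    {K : ℝ≥0} (hK : LipschitzWith K (F.limitMap Z₀)) :
    TendstoInDistribution (fun (n : ℕ) ω => stepPath n fun j => (√(n : ℝ))⁻¹ • z n j ω) atTop
      (fun ω => CadlagPath.map (F.limitMap Z₀) hK.continuous (U ω)) (fun _ => P) P' := by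
  obtain ⟨C, hC, hpath⟩ := F.exists_norm_smul_sub_trendMap_le hcanon hcpos hjsr hdet hdet0
  have hstart : TendstoInMeasure P (fun (n : ℕ) ω => ‖(√(n : ℝ))⁻¹ • z n 0 ω - Z₀‖) atTop
      fun _ => 0 := by
    rw [tendstoInMeasure_iff_norm] at hinit₀ ⊢
    simpa only [sub_zero, norm_norm] using hinit₀
  have hremainder := tendstoInMeasure_add (F.tendstoInMeasure_pathSize hustar hinit) hstart
  rw [add_zero] at hremainder
  refine tendstoInDistribution_of_edist_le
    (hUn.continuous_comp (CadlagPath.lipschitzWith_map hK).continuous)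
    (fun n => aemeasurable_stepPath fun j _ =>
      (aemeasurable_of_generates hcanon hu (hz n) (hgen n) j j (by omega) le_rfl).fun_const_smul _)
    (f := fun n ω => C * ((√(n : ℝ))⁻¹ * F.pathSize (fun t => u t ω) (fun t => z n t ω) n +
      ‖(√(n : ℝ))⁻¹ • z n 0 ω - Z₀‖)) ?_ fun n => ?_
  · exact tendstoInMeasure_zero_of_norm_le hC hremainder fun n => ae_of_all _ fun ω => by
      rw [norm_mul, Real.norm_of_nonneg hC.le]
  · filter_upwards [hgen n] with ω hω
    refine edist_stepPath_le
      (f := fun j => F.limitMap Z₀ ((√(n : ℝ))⁻¹ • ∑ t ∈ Finset.Icc 1 j, u t ω)) fun j hj => ?_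
    rw [edist_comm, edist_dist, dist_eq_norm]
    exact ENNReal.ofReal_le_ofReal (hpath _ _ hω n j hj _ (by positivity) Z₀)

end CKSVAR.KinkedFactorisation

theorem theorem2_general {m k r d : ℕ} (hk : 2 ≤ k)
    {Ω Ω' : Type*} [MeasurableSpace Ω] [MeasurableSpace Ω']
    (P : Measure Ω) [IsProbabilityMeasure P] (P' : Measure Ω') [IsProbabilityMeasure P']
    (M : CKSVAR m k) (hcanon : M.IsCanonical)
    (u : ℕ → Ω → ZSpace m) (z : ℕ → ℤ → Ω → ZSpace m)
    (hu : ∀ t, 1 ≤ t → AEMeasurable (u t) P)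
    (hz : ∀ n, ∀ t : ℤ, -(k : ℤ) + 1 ≤ t → t ≤ 0 → AEMeasurable (z n t) P)
    (hgen : ∀ n, ∀ᵐ ω ∂P, M.Generates (fun t => u t ω) (fun t => z n t ω))
    (hustar : IsStarStationary P fun _ t ω => u t ω) (U : Ω' → CadlagPath (ZSpace m))
    (hUn : TendstoInDistribution
      (fun (n : ℕ) ω => stepPath n fun j => (√(n : ℝ))⁻¹ • ∑ t ∈ Finset.Icc 1 j, u t ω)
      atTop U (fun _ => P) P')
    (hcpos : ∃ v, M.Pi 1 *ᵥ v = M.c) (F : M.KinkedFactorisation r d)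
    (hjsr : jointSpectralRadius {1 + F.boldβT 1 * F.boldα, 1 + F.boldβT (-1) * F.boldα} < 1)
    (hdet : SignType.sign (F.core 1).det = SignType.sign (F.core (-1)).det)
    (hdet0 : (F.core 1).det ≠ 0)
    (hinit : TendstoInMeasure P
      (fun (n : ℕ) ω => (√(n : ℝ))⁻¹ * F.initialSize fun t => z n t ω) atTop fun _ => 0)
    (Z₀ : ZSpace m)
    (hinit₀ : TendstoInMeasure P (fun (n : ℕ) ω => (√(n : ℝ))⁻¹ • z n 0 ω) atTop fun _ => Z₀)
    (U₀ : Ω' → I → ZSpace m) (hU₀ : ∀ ω s, U₀ ω s = act (M.GammaOne (yPart Z₀)) Z₀ + U ω s) :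
    IsStarStationary P (fun n t ω => F.eqError (z n t ω)) ∧
    IsStarStationary P (fun n t ω => z n t ω - z n ((t : ℤ) - 1) ω) ∧
    ∃ Z : Ω' → CadlagPath (ZSpace m),
      TendstoInDistribution (fun (n : ℕ) ω => stepPath n fun j => (√(n : ℝ))⁻¹ • z n j ω)
        atTop Z (fun _ => P) P' ∧
      ∀ ω s,
        Z ω s = act (F.proj (yPart (Z ω s))) (U₀ ω s) ∧
        Z ω s = act (F.proj (F.vartheta ⬝ᵥ WithLp.ofLp (U₀ ω s))) (U₀ ω s) ∧
        SignType.sign (yPart (Z ω s)) =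
          SignType.sign (F.vartheta ⬝ᵥ WithLp.ofLp (U₀ ω s)) := by
  have hsize := F.tendstoInMeasure_pathSize hustar hinit
  obtain ⟨C₁, hC₁, herror⟩ := F.exists_norm_eqError_le hcanon hjsr
  obtain ⟨C₂, hC₂, hincrement⟩ := F.exists_norm_sub_prev_le hk hcanon hjsr
  obtain ⟨K, hK⟩ := F.exists_lipschitzWith_limitMap hdet hdet0 Z₀
  refine ⟨isStarStationary_of_norm_le hC₁ hsize fun n => (hgen n).mono fun ω hω =>
      herror _ _ hω n,
    isStarStationary_of_norm_le hC₂ hsize fun n => (hgen n).mono fun ω hω => hincrement _ _ hω n,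
    fun ω => CadlagPath.map (F.limitMap Z₀) hK.continuous (U ω),
    F.tendstoInDistribution_stepPath (by omega) hcanon hu hz hgen hustar hUn hcpos hjsr hdet hdet0
      hinit hinit₀ hK, fun ω s => ?_⟩
  have hlimit : CadlagPath.map (F.limitMap Z₀) hK.continuous (U ω) s = F.trendMap (U₀ ω s) := by
    rw [CadlagPath.map_apply, CKSVAR.KinkedFactorisation.limitMap, hU₀]
  rw [hlimit, F.proj_yPart_trendMap hdet hdet0]
  exact ⟨rfl, rfl, F.sign_yPart_trendMap hdet hdet0 _⟩

theorem theorem2 {m k r d : ℕ} (hk : 2 ≤ k)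
    {Ω Ω' : Type*} [MeasurableSpace Ω] [MeasurableSpace Ω']
    (P : Measure Ω) [IsProbabilityMeasure P] (P' : Measure Ω') [IsProbabilityMeasure P']
    -- the data are generated by a canonical CKSVAR; for each sample size `n`, `z n` is the process
    (M : CKSVAR m k) (hcanon : M.IsCanonical)
    (u : ℕ → Ω → ZSpace m) (z : ℕ → ℤ → Ω → ZSpace m)
    (hu : ∀ t, 1 ≤ t → AEMeasurable (u t) P)
    (hz : ∀ n, ∀ t : ℤ, -(k : ℤ) + 1 ≤ t → t ≤ 0 → AEMeasurable (z n t) P)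
    (hgen : ∀ n, ∀ᵐ ω ∂P, M.Generates (fun t => u t ω) (fun t => z n t ω))
    -- the errors: moments and invariance principle
    (δ : ℝ) (hδ : 0 < δ)
    (humom : ∃ C : ℝ≥0, ∀ t, 1 ≤ t → eLpNorm (u t) (ENNReal.ofReal (2 + δ)) P ≤ C)
    (V : Matrix (ZIdx m) (ZIdx m) ℝ) (hV : V.PosDef)
    (U : Ω' → CadlagPath (ZSpace m)) (hU : IsBrownianMotion (fun s ω => U ω s) V P')
    (hUn : TendstoInDistribution
      (fun (n : ℕ) ω => stepPath n fun j => (√(n : ℝ))⁻¹ • ∑ t ∈ Finset.Icc 1 j, u t ω)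
      atTop U (fun _ => P) P')
    -- unit roots and ranks
    (qpos qneg : ℕ) (hrootpos : M.UnitRoots 1 qpos) (hrootneg : M.UnitRoots (-1) qneg)
    (hqpos : (M.Pi 1).rank + qpos = m + 1) (hqneg : (M.Pi (-1)).rank + qneg = m + 1)
    (hcpos : ∃ v, M.Pi 1 *ᵥ v = M.c) (hcneg : ∃ v, M.Pi (-1) *ᵥ v = M.c)
    (hrpos : (M.Pi 1).rank = r) (hrneg : (M.Pi (-1)).rank = r) (hrx : M.PiX.rank = r)
    -- any choice of the factorisation and of the orthocomplements
    (F : M.KinkedFactorisation r d)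
    (hjsr : jointSpectralRadius {1 + F.boldβT 1 * F.boldα, 1 + F.boldβT (-1) * F.boldα} < 1)
    (hdet : SignType.sign (F.core 1).det = SignType.sign (F.core (-1)).det)
    (hdet0 : (F.core 1).det ≠ 0)
    -- initial conditions
    (hinit : ∃ C : ℝ≥0, ∀ n,
      (∀ t : ℤ, -(k : ℤ) + 1 ≤ t → t ≤ 0 →
        eLpNorm (fun ω => F.eqError (z n t ω)) (ENNReal.ofReal (2 + δ)) P ≤ C) ∧
      (∀ t : ℤ, -(k : ℤ) + 2 ≤ t → t ≤ 0 →
        eLpNorm (fun ω => z n t ω - z n (t - 1) ω) (ENNReal.ofReal (2 + δ)) P ≤ C))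
    (Z₀ : ZSpace m) (hZ₀ : Z₀ ∈ M.commonTrends)
    (hinit₀ : TendstoInMeasure P (fun (n : ℕ) ω => (√(n : ℝ))⁻¹ • z n 0 ω) atTop (fun _ => Z₀))
    -- the limiting driving process
    (U₀ : Ω' → I → ZSpace m) (hU₀ : ∀ ω s, U₀ ω s = act (M.GammaOne (yPart Z₀)) Z₀ + U ω s) :
    IsStarStationary P (fun n t ω => F.eqError (z n t ω)) ∧
    IsStarStationary P (fun n t ω => z n t ω - z n ((t : ℤ) - 1) ω) ∧
    ∃ Z : Ω' → CadlagPath (ZSpace m),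
      TendstoInDistribution (fun (n : ℕ) ω => stepPath n fun j => (√(n : ℝ))⁻¹ • z n j ω)
        atTop Z (fun _ => P) P' ∧
      ∀ ω s,
        Z ω s = act (F.proj (yPart (Z ω s))) (U₀ ω s) ∧
        Z ω s = act (F.proj (F.vartheta ⬝ᵥ WithLp.ofLp (U₀ ω s))) (U₀ ω s) ∧
        SignType.sign (yPart (Z ω s)) =
          SignType.sign (F.vartheta ⬝ᵥ WithLp.ofLp (U₀ ω s)) := by
  obtain ⟨Cu, hCu⟩ := humom
  obtain ⟨Ci, hCi⟩ := hinit
  have hp : 2 < 2 + δ := lt_add_of_pos_right 2 hδ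
  exact theorem2_general hk P P' M hcanon u z hu hz hgen
    (isStarStationary_of_eLpNorm_le hp (fun _ t ht => (hu t ht).aestronglyMeasurable)
      fun _ => hCu) U hUn hcpos F hjsr hdet hdet0
    (F.tendstoInMeasure_initialSize (by omega) hp hz
      (fun n => (hCi n).1 0 (by omega) le_rfl) fun n => (hCi n).2) Z₀ hinit₀ U₀ hU₀
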